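/- **Proposition 3.4.** Let $r\in\{3,5,7\}$, let $q\in\mathbb C$ be a primitive $r$-th root of unity and put $\mu=1-q^{-2}$. *The algebra.* Let $A$ be the reduced quantum group $\mathbb C_q[SL_2]$, i.e. the complex algebra generated by $t=(t^i{}_j)=\begin{pmatrix}a&b\\c&d\end{pmatrix}$ with relations $$ba=qab,\quad ca=qac,\quad db=qbd,\quad dc=qcd,\quad cb=bc,\quad da-ad=q\mu bc,\quad ad-q^{-1}bc=1,$$ $$a^r=d^r=1,\qquad b^r=c^r=0,$$ with the matrix coproduct and antipode $Sa=d$, $Sb=-qb$, $Sc=-q^{-1}c$, $Sd=a$. *The invariant 1-forms.* Let $\Lambda^1$ have basis $e_1{}^1=e_a$, $e_1{}^2=e_b$, $e_2{}^1=e_c$, $e_2{}^2=e_d$, with the left coaction $\Delta_L e_i{}^j=\sum_{k,l}(St^k{}_i)t^j{}_l\otimes e_k{}^l$ and the left action of $A$ given by $$a\triangleright(e_a,e_b,e_c,e_d)=(qe_a+q\mu^2e_d,\ e_b,\ e_c,\ q^{-1}e_d),\qquad b\triangleright(e_a,e_b,e_c,e_d)=(\mu e_c,\ q\mu e_d,\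 0,\ 0),$$ $$c\triangleright(e_a,e_b,e_c,e_d)=(\mu e_b,\ 0,\ q\mu e_d,\ 0),\qquad d\triangleright(e_a,e_b,e_c,e_d)=(q^{-1}e_a,\ e_b,\ e_c,\ qe_d).$$ Let $\Psi(e_i{}^j\otimes f)=\sum_{k,l}\big((St^k{}_i)t^j{}_l\triangleright f\big)\otimes e_k{}^l$ be the associated braiding on $\Lambda^1\otimes\Lambda^1$. *The forms.* Let $\Lambda=T\Lambda^1/\bigoplus_n\ker A_n$ with its induced grading $\Lambda=\bigoplus_n\Lambda^n$, where $A_0=\mathrm{id}$ and $$A_n=(\mathrm{id}\otimes A_{n-1})\big(\mathrm{id}-\Psi_{12}+\Psi_{12}\Psi_{23}-\cdots+(-1)^{n-1}\Psi_{12}\cdots\Psi_{n-1,n}\big).$$ Let $\Omega=\Lambda\otimes A$ be the crossed product algebra, in which $h\,e=(h_{(1)}\triangleright e)\,h_{(2)}$ for $h\in A$, $e\in\Lambda^1$, so that $t^i{}_j\,e=\sum_k(t^i{}_k\triangleright e)\,t^k{}_j$. Put $\Omega^n=\Lambda^nA$ and $\theta=e_a+e_d$, and define $\mathrm d:\Omega^n\to\Omega^{n+1}$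 by $\mathrm d\omega=(-1)^n\omega\theta-\theta\omega$. Then $\mathrm d^2=0$; let $H^n$ be the cohomology of $(\Omega,\mathrm d)$ in degree $n$. *Claim.* For every $n\ge0$, $H^n$ is finite-dimensional and $\dim H^n=\dim\Lambda^n$. These dimensions are $1,4,6,4,1$ for $n=0,1,2,3,4$ and $0$ for $n>4$. Moreover, writing $e_{bd}=e_b\wedge e_d$, $e_{bcd}=e_b\wedge e_c\wedge e_d$, etc., the following are closed forms whose classes form a basis of the stated cohomology space. - $H^2$: $m_1=e_{bd}\,ac^{r-1}$, $m_2=e_{ab}\,ac^{r-1}$, $m_3=e_{ac}\,a^{r-1}b^{r-1}$, $m_4=e_{cd}\,a^{r-1}b^{r-1}$, $m_5=(e_{ac}-e_{cd})\,a^{r-1}c-e_{ad}$, $m_6=e_{bd}\,ab^{r-1}c^{r-2}+q^4e_{cd}\,a^{r-1}b^{r-2}c^{r-1}$. - $H^3$: $\Theta=e_{bcd}\,b^{r-1}c^{r-1}$, $h_1^*=e_{abd}\,ac^{r-1}$, $h_2^*=e_{acd}\,a^{r-1}b^{r-1}$, $s=e_{abd}\,ab^{r-1}c^{r-2}+q^4e_{acd}\,a^{r-1}b^{r-2}c^{r-1}$.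 - $H^4$: $e_{abcd}\,b^{r-1}c^{r-1}$. -/

import Mathlib

open scoped Matrix

noncomputable section

namespace QSL2

/-- `μ = 1 - q⁻²`. -/
def mu (q : ℂ) : ℂ := 1 - q⁻¹ ^ 2

/-! ### The reduced quantum group -/

/-- The defining relations of the reduced algebra `ℂ_q[SL₂]` imposed on a `2 × 2` array
`t = (a b; c d)` of elements of an algebra. -/
inductive CoordRel {R : Type} [Ring R] [Algebra ℂ R] (q : ℂ) (r : ℕ) (t : Fin 2 → Fin 2 → R) :
    R → R → Prop
  | ba : CoordRel q r t (t 0 1 * t 0 0) (q • (t 0 0 * t 0 1))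
  | ca : CoordRel q r t (t 1 0 * t 0 0) (q • (t 0 0 * t 1 0))
  | db : CoordRel q r t (t 1 1 * t 0 1) (q • (t 0 1 * t 1 1))
  | dc : CoordRel q r t (t 1 1 * t 1 0) (q • (t 1 0 * t 1 1))
  | cb : CoordRel q r t (t 1 0 * t 0 1) (t 0 1 * t 1 0)
  | da : CoordRel q r t (t 1 1 * t 0 0 - t 0 0 * t 1 1) ((q * mu q) • (t 0 1 * t 1 0))
  | qdet : CoordRel q r t (t 0 0 * t 1 1 - q⁻¹ • (t 0 1 * t 1 0)) 1
  | a_pow : CoordRel q r t (t 0 0 ^ r) 1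
  | b_pow : CoordRel q r t (t 0 1 ^ r) 0
  | c_pow : CoordRel q r t (t 1 0 ^ r) 0
  | d_pow : CoordRel q r t (t 1 1 ^ r) 1

/-- The algebra of functions `A` on the reduced quantum group. -/
def CoordAlg (q : ℂ) (r : ℕ) : Type :=
  RingQuot (CoordRel q r fun i j => FreeAlgebra.ι ℂ ((i, j) : Fin 2 × Fin 2))

instance (q : ℂ) (r : ℕ) : Ring (CoordAlg q r) := inferInstanceAs (Ring (RingQuot _))

instance (q : ℂ) (r : ℕ) : Algebra ℂ (CoordAlg q r) := inferInstanceAs (Algebra ℂ (RingQuot _))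

/-- The projection of the free algebra onto `A`. -/
def CoordAlg.mk (q : ℂ) (r : ℕ) : FreeAlgebra ℂ (Fin 2 × Fin 2) →ₐ[ℂ] CoordAlg q r :=
  RingQuot.mkAlgHom ℂ (CoordRel q r fun i j => FreeAlgebra.ι ℂ ((i, j) : Fin 2 × Fin 2))

/-! ### The crossed module `Λ¹` and its braiding

The basis `e₁¹ = e_a, e₁² = e_b, e₂¹ = e_c, e₂² = e_d` of `Λ¹` is numbered `0, 1, 2, 3`. -/

/-- The index `i` of the basis element `e_i^j`. -/
def row : Fin 4 → Fin 2 := ![0, 0, 1, 1]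

/-- The index `j` of the basis element `e_i^j`. -/
def col : Fin 4 → Fin 2 := ![0, 1, 0, 1]

/-- The matrix of `a ▷` on `Λ¹`; column `x` holds the coordinates of `a ▷ e_x`. -/
def actA (q : ℂ) : Matrix (Fin 4) (Fin 4) ℂ :=
  !![q, 0, 0, 0;
     0, 1, 0, 0;
     0, 0, 1, 0;
     q * mu q ^ 2, 0, 0, q⁻¹]

/-- The matrix of `b ▷`, that is `e_a ↦ μ e_c`, `e_b ↦ q μ e_d`, `e_c, e_d ↦ 0`. -/
def actB (q : ℂ) : Matrix (Fin 4) (Fin 4) ℂ :=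
  !![0, 0, 0, 0;
     0, 0, 0, 0;
     mu q, 0, 0, 0;
     0, q * mu q, 0, 0]

/-- The matrix of `c ▷`, that is `e_a ↦ μ e_b`, `e_c ↦ q μ e_d`, `e_b, e_d ↦ 0`. -/
def actC (q : ℂ) : Matrix (Fin 4) (Fin 4) ℂ :=
  !![0, 0, 0, 0;
     mu q, 0, 0, 0;
     0, 0, 0, 0;
     0, 0, q * mu q, 0]

/-- The matrix of `d ▷`. -/
def actD (q : ℂ) : Matrix (Fin 4) (Fin 4) ℂ :=
  !![q⁻¹, 0, 0, 0;
     0, 1, 0, 0;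
     0, 0, 1, 0;
     0, 0, 0, q]

/-- `act q i j` is the matrix of `t^i_j ▷` on `Λ¹`. -/
def act (q : ℂ) : Fin 2 → Fin 2 → Matrix (Fin 4) (Fin 4) ℂ :=
  ![![actA q, actB q], ![actC q, actD q]]

/-- `actS q i j` is the matrix of `(S t^i_j) ▷` on `Λ¹`, where the antipode is
`S a = d`, `S b = -q b`, `S c = -q⁻¹ c`, `S d = a`. -/
def actS (q : ℂ) : Fin 2 → Fin 2 → Matrix (Fin 4) (Fin 4) ℂ :=
  ![![actD q, -(q • actB q)], ![-(q⁻¹ • actC q), actA q]]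

/-- The crossed module braiding `Ψ(e ⊗ f) = e⁽¹⁾ ▷ f ⊗ e⁽²⁾` for the coaction
`Δ_L e_i^j = ∑_{k,l} (S t^k_i) t^j_l ⊗ e_k^l`. Explicitly,
`Ψ(e_i^j ⊗ f) = ∑_{k,l} ((S t^k_i) t^j_l ▷ f) ⊗ e_k^l`; the entry at `(y, z), (x, f)` is the
coefficient of `e_y ⊗ e_z` in `Ψ(e_x ⊗ e_f)`. -/
def braiding (q : ℂ) : Matrix (Fin 4 × Fin 4) (Fin 4 × Fin 4) ℂ :=
  fun yz xf =>
    (actS q (row yz.2) (row xf.1) * act q (col xf.1) (col yz.2)) yz.1 xf.2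

/-! ### Braided factorials

Operators on `(Λ¹)^{⊗ n}` are matrices indexed by the words `Fin n → Fin 4`. -/

/-- `id ⊗ M` on `Λ¹ ⊗ (Λ¹)^{⊗ n}`. -/
def idTensor {n : ℕ} (M : Matrix (Fin n → Fin 4) (Fin n → Fin 4) ℂ) :
    Matrix (Fin (n + 1) → Fin 4) (Fin (n + 1) → Fin 4) ℂ :=
  fun w w' => if w 0 = w' 0 then M (Fin.tail w) (Fin.tail w') else 0

/-- `Ψ₁₂ = Ψ ⊗ id` on `(Λ¹)^{⊗ (n + 2)}`. -/
def braid12 (q : ℂ) (n : ℕ) :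
    Matrix (Fin (n + 2) → Fin 4) (Fin (n + 2) → Fin 4) ℂ :=
  fun w w' =>
    if Fin.tail (Fin.tail w) = Fin.tail (Fin.tail w') then
      braiding q (w 0, w 1) (w' 0, w' 1)
    else 0

/-- The braided integer `[n, -Ψ] = id - Ψ₁₂ + Ψ₁₂ Ψ₂₃ - ⋯ + (-1)^{n-1} Ψ₁₂ ⋯ Ψ_{n-1,n}`,
through `[n, -Ψ] = id - Ψ₁₂ (id ⊗ [n - 1, -Ψ])`. -/
def braidedInt (q : ℂ) : (n : ℕ) → Matrix (Fin n → Fin 4) (Fin n → Fin 4) ℂ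
  | 0 => 1
  | 1 => 1
  | n + 2 => 1 - braid12 q n * idTensor (braidedInt q (n + 1))

/-- The braided factorial `A_n = [n, -Ψ]! = (id ⊗ A_{n-1}) [n, -Ψ]`. -/
def braidedFactorial (q : ℂ) : (n : ℕ) → Matrix (Fin n → Fin 4) (Fin n → Fin 4) ℂ
  | 0 => 1
  | n + 1 => idTensor (braidedFactorial q n) * braidedInt q (n + 1)

/-! ### Invariant forms -/

/-- The product `e_{w 0} e_{w 1} ⋯ e_{w (n - 1)}`. -/
def word {R : Type} [Ring R] (e : Fin 4 → R) {n : ℕ} (w : Fin n → Fin 4) : R :=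
  (List.ofFn fun i => e (w i)).prod

/-- The relations of the Woronowicz exterior algebra: every element of `⊕ₙ ker A_n` is zero. -/
inductive FormRel {R : Type} [Ring R] [Algebra ℂ R] (q : ℂ) (e : Fin 4 → R) : R → R → Prop
  | ker {n : ℕ} (v : (Fin n → Fin 4) → ℂ) (hv : braidedFactorial q n *ᵥ v = 0) :
      FormRel q e (∑ w, v w • word e w) 0

/-- The algebra of right-invariant forms `Λ = TΛ¹ / ⊕ₙ ker A_n`. -/
def InvForms (q : ℂ) : Type :=
  RingQuot (FormRel q (FreeAlgebra.ι ℂ : Fin 4 → FreeAlgebra ℂ (Fin 4)))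

instance (q : ℂ) : Ring (InvForms q) := inferInstanceAs (Ring (RingQuot _))

instance (q : ℂ) : Algebra ℂ (InvForms q) := inferInstanceAs (Algebra ℂ (RingQuot _))

/-- The projection of the tensor algebra onto `Λ`. -/
def InvForms.mk (q : ℂ) : FreeAlgebra ℂ (Fin 4) →ₐ[ℂ] InvForms q :=
  RingQuot.mkAlgHom ℂ (FormRel q (FreeAlgebra.ι ℂ : Fin 4 → FreeAlgebra ℂ (Fin 4)))

/-- The basis elements `e_a, e_b, e_c, e_d` in `Λ`. -/
def invE (q : ℂ) (x : Fin 4) : InvForms q :=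
  InvForms.mk q (FreeAlgebra.ι ℂ x)

/-- The degree `n` component `Λⁿ` of `Λ`. -/
def invFormsDeg (q : ℂ) (n : ℕ) : Submodule ℂ (InvForms q) :=
  Submodule.span ℂ (Set.range fun w : Fin n → Fin 4 => word (invE q) w)

/-! ### The exterior algebra of the quantum group -/

/-- Generators of the exterior algebra: the coordinate functions `t^i_j` and the invariant
1-forms `e_x`. -/
inductive Gen : Type
  | t (i j : Fin 2) : Gen
  | e (x : Fin 4) : Gen

/-- Coordinate functions in the free algebra. -/
def freeT (i j : Fin 2) : FreeAlgebra ℂ Gen := FreeAlgebra.ι ℂ (Gen.t i j)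

/-- Invariant 1-forms in the free algebra. -/
def freeE (x : Fin 4) : FreeAlgebra ℂ Gen := FreeAlgebra.ι ℂ (Gen.e x)

/-- The relations of the crossed product `Ω = Λ ⊗ A`: those of `A`, those of `Λ`, and the
bimodule relations `h e = (h₍₁₎ ▷ e) h₍₂₎`, which for the generators `h = t^i_j` read
`t^i_j e_x = ∑ₖ (t^i_k ▷ e_x) t^k_j`. -/
inductive OmegaRel (q : ℂ) (r : ℕ) : FreeAlgebra ℂ Gen → FreeAlgebra ℂ Gen → Prop
  | coord {x y : FreeAlgebra ℂ Gen} : CoordRel q r freeT x y → OmegaRel q r x y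
  | form {x y : FreeAlgebra ℂ Gen} : FormRel q freeE x y → OmegaRel q r x y
  | cross (i j : Fin 2) (x : Fin 4) :
      OmegaRel q r (freeT i j * freeE x)
        (∑ k : Fin 2, (∑ y : Fin 4, act q i k y x • freeE y) * freeT k j)

/-- The exterior algebra `Ω` of differential forms on the reduced quantum group for the
4-dimensional bicovariant calculus: the crossed product of `Λ` and `A` by the action `▷`. -/
def Omega (q : ℂ) (r : ℕ) : Type := RingQuot (OmegaRel q r)

instance (q : ℂ) (r : ℕ) : Ring (Omega q r) := inferInstanceAs (Ring (RingQuot _))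

instance (q : ℂ) (r : ℕ) : Algebra ℂ (Omega q r) := inferInstanceAs (Algebra ℂ (RingQuot _))

/-- The projection of the free algebra onto `Ω`. -/
def Omega.mk (q : ℂ) (r : ℕ) : FreeAlgebra ℂ Gen →ₐ[ℂ] Omega q r :=
  RingQuot.mkAlgHom ℂ (OmegaRel q r)

variable (q : ℂ) (r : ℕ)

/-- The coordinate functions `t^i_j` in `Ω`. -/
def t (i j : Fin 2) : Omega q r := Omega.mk q r (freeT i j)

/-- The invariant 1-forms `e_a, e_b, e_c, e_d` in `Ω`. -/
def e (x : Fin 4) : Omega q r := Omega.mk q r (freeE x)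

theorem coordRel_map {R S : Type} [Ring R] [Algebra ℂ R] [Ring S] [Algebra ℂ S]
    (f : R →ₐ[ℂ] S) {t : Fin 2 → Fin 2 → R} {t' : Fin 2 → Fin 2 → S}
    (ht : ∀ i j, f (t i j) = t' i j) {x y : R} (h : CoordRel q r t x y) :
    CoordRel q r t' (f x) (f y) := by
  cases h <;> simp only [map_mul, map_smul, map_sub, map_pow, map_one, map_zero, ht]
  · exact .ba
  · exact .ca
  · exact .db
  · exact .dc
  · exact .cb
  · exact .da
  · exact .qdet
  · exact .a_pow
  · exact .b_pow
  · exact .c_pow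
  · exact .d_pow

theorem word_map {R S : Type} [Ring R] [Algebra ℂ R] [Ring S] [Algebra ℂ S]
    (f : R →ₐ[ℂ] S) {e : Fin 4 → R} {e' : Fin 4 → S}
    (he : ∀ x, f (e x) = e' x) {n : ℕ} (w : Fin n → Fin 4) : f (word e w) = word e' w := by
  simp only [word, map_list_prod, List.map_ofFn]
  congr 2
  funext i
  exact he _

theorem formRel_map {R S : Type} [Ring R] [Algebra ℂ R] [Ring S] [Algebra ℂ S]
    (f : R →ₐ[ℂ] S) {e : Fin 4 → R} {e' : Fin 4 → S}
    (he : ∀ x, f (e x) = e' x) {x y : R} (h : FormRel q e x y) :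
    FormRel q e' (f x) (f y) := by
  obtain ⟨v, hv⟩ := h
  simp only [map_sum, map_smul, map_zero, word_map f he]
  exact .ker v hv

/-- The canonical homomorphism `A → Ω`. -/
def ofCoord : CoordAlg q r →ₐ[ℂ] Omega q r :=
  RingQuot.liftAlgHom ℂ
    ⟨(Omega.mk q r).comp
        (FreeAlgebra.lift ℂ fun p : Fin 2 × Fin 2 => freeT p.1 p.2),
      fun _ _ h => RingQuot.mkAlgHom_rel ℂ
        (OmegaRel.coord (coordRel_map q r _ (fun i j => by simp) h))⟩

/-- The canonical homomorphism `Λ → Ω`. -/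
def ofInv : InvForms q →ₐ[ℂ] Omega q r :=
  RingQuot.liftAlgHom ℂ
    ⟨(Omega.mk q r).comp (FreeAlgebra.lift ℂ freeE),
      fun _ _ h => RingQuot.mkAlgHom_rel ℂ
        (OmegaRel.form (formRel_map q _ (fun x => by simp) h))⟩

/-- The space `Ωⁿ = Λⁿ A` of `n`-forms. -/
def forms (n : ℕ) : Submodule ℂ (Omega q r) :=
  Submodule.span ℂ
    {ω | ∃ l ∈ invFormsDeg q n, ∃ h : CoordAlg q r, ω = ofInv q r l * ofCoord q r h}

/-- The biinvariant 1-form `θ = e_a + e_d`. -/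
def theta : Omega q r := e q r 0 + e q r 3

/-- The exterior derivative on forms of degree `n`: `d ω = -[θ, ω}`, that is `ω θ - θ ω` for
`n` even and `-(θ ω + ω θ)` for `n` odd. -/
def extD (n : ℕ) : Omega q r →ₗ[ℂ] Omega q r :=
  (-1 : ℂ) ^ n • LinearMap.mulRight ℂ (theta q r) - LinearMap.mulLeft ℂ (theta q r)

/-- Closed `n`-forms. -/
def cocycles (n : ℕ) : Submodule ℂ (Omega q r) :=
  forms q r n ⊓ LinearMap.ker (extD q r n)

/-- Exact `n`-forms. -/
def coboundaries : ℕ → Submodule ℂ (Omega q r)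
  | 0 => ⊥
  | n + 1 => (forms q r n).map (extD q r n)

/-- The noncommutative de Rham cohomology `Hⁿ`, closed forms modulo exact forms. -/
abbrev DeRham (n : ℕ) : Type :=
  ↥(cocycles q r n) ⧸ (coboundaries q r n).submoduleOf (cocycles q r n)

/-- The forms `v i` are closed `n`-forms whose classes form a basis of `Hⁿ`. -/
def RepresentBasis (n : ℕ) {ι : Type} (v : ι → Omega q r) : Prop :=
  ∃ hv : ∀ i, v i ∈ cocycles q r n,
    LinearIndependent ℂ (fun i => (Submodule.Quotient.mk ⟨v i, hv i⟩ : DeRham q r n)) ∧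
    Submodule.span ℂ
      (Set.range fun i => (Submodule.Quotient.mk ⟨v i, hv i⟩ : DeRham q r n)) = ⊤

theorem ofInv_invE (x : Fin 4) : ofInv q r (invE q x) = e q r x := by
  refine (RingQuot.liftAlgHom_mkAlgHom_apply ℂ _ _ _).trans ?_
  simp [e]

theorem ofCoord_mk (x : FreeAlgebra ℂ (Fin 2 × Fin 2)) :
    ofCoord q r (CoordAlg.mk q r x)
      = Omega.mk q r (FreeAlgebra.lift ℂ (fun p : Fin 2 × Fin 2 => freeT p.1 p.2) x) :=
  RingQuot.liftAlgHom_mkAlgHom_apply ℂ _ _ _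

theorem Omega.mk_rel {x y : FreeAlgebra ℂ Gen} (h : OmegaRel q r x y) :
    Omega.mk q r x = Omega.mk q r y :=
  RingQuot.mkAlgHom_rel ℂ h

theorem t_mul_e (i j : Fin 2) (x : Fin 4) :
    t q r i j * e q r x =
      ∑ k : Fin 2, (∑ y : Fin 4, act q i k y x • e q r y) * t q r k j := by
  have h := Omega.mk_rel q r (OmegaRel.cross i j x)
  simp only [map_mul, map_sum, map_smul] at h
  exact h

theorem form_rel {n : ℕ} (v : (Fin n → Fin 4) → ℂ) (hv : braidedFactorial q n *ᵥ v = 0) :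
    ∑ w, v w • word (e q r) w = 0 := by
  have h' := (Omega.mk_rel q r (OmegaRel.form (FormRel.ker v hv))).trans (map_zero _)
  simpa only [map_sum, map_smul, word_map (Omega.mk q r) (e' := e q r) (fun _ => rfl)] using h'

theorem idTensor_one (n : ℕ) : idTensor (1 : Matrix (Fin n → Fin 4) (Fin n → Fin 4) ℂ) = 1 := by
  ext w w'
  by_cases h0 : w 0 = w' 0 <;> by_cases h1 : Fin.tail w = Fin.tail w'
  · have : w = w' := by
      rw [← Fin.cons_self_tail w, ← Fin.cons_self_tail w', h0, h1]
    subst this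
    simp [idTensor]
  · have : w ≠ w' := fun h => h1 (by rw [h])
    simp [idTensor, h0, h1, this]
  · have : w ≠ w' := fun h => h0 (by rw [h])
    simp [idTensor, h0, this]
  · have : w ≠ w' := fun h => h0 (by rw [h])
    simp [idTensor, h0, this]

theorem braidedFactorial_two : braidedFactorial q 2 = 1 - braid12 q 0 := by
  simp [braidedFactorial, braidedInt, idTensor_one]

theorem braid12_zero (w w' : Fin 2 → Fin 4) :
    braid12 q 0 w w' = braiding q (w 0, w 1) (w' 0, w' 1) :=
  if_pos (Subsingleton.elim _ _)

theorem theta_mul_theta (hq : q ≠ 0) : theta q r * theta q r = 0 := by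
  have key := form_rel q r (n := 2)
    (fun w => (![1, 0, 0, 1] : Fin 4 → ℂ) (w 0) * (![1, 0, 0, 1] : Fin 4 → ℂ) (w 1)) (by
      rw [braidedFactorial_two, Matrix.sub_mulVec, Matrix.one_mulVec, sub_eq_zero]
      funext w
      simp only [Matrix.mulVec, dotProduct]
      rw [← (piFinTwoEquiv fun _ => Fin 4).symm.sum_comp, Fintype.sum_prod_type]
      simp only [braid12_zero, piFinTwoEquiv_symm_apply,
        Fin.sum_univ_four, braiding]
      generalize w 0 = x
      generalize w 1 = y
      fin_cases x <;> fin_cases y <;>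
        simp [row, col, act, actS, actA, actB, actC, actD, mu, Matrix.mul_apply,
          Fin.sum_univ_four] <;> field_simp <;> ring)
  rw [← (piFinTwoEquiv fun _ => Fin 4).symm.sum_comp, Fintype.sum_prod_type] at key
  simp only [Fin.sum_univ_four, piFinTwoEquiv_symm_apply, word] at key
  simp [List.ofFn_succ] at key
  simp only [theta, add_mul, mul_add]
  rw [← key]
  abel

theorem ofCoord_mul_e (h : CoordAlg q r) (x : Fin 4) :
    ∃ g : Fin 4 → CoordAlg q r, ofCoord q r h * e q r x = ∑ y, e q r y * ofCoord q r (g y) := by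
  obtain ⟨f, rfl⟩ : ∃ f, CoordAlg.mk q r f = h := RingQuot.mkAlgHom_surjective ℂ _ h
  induction f using FreeAlgebra.induction generalizing x with
  | grade0 z =>
    refine ⟨fun y => if y = x then algebraMap ℂ _ z else 0, ?_⟩
    simp [apply_ite (ofCoord q r), Algebra.commutes]
  | grade1 p =>
    refine ⟨fun y => ∑ k, act q p.1 k y x • CoordAlg.mk q r (FreeAlgebra.ι ℂ (k, p.2)), ?_⟩
    have := t_mul_e q r p.1 p.2 x
    simp only [map_sum, map_smul, ofCoord_mk, FreeAlgebra.lift_ι_apply]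
    refine this.trans ?_
    simp only [Finset.sum_mul, Finset.mul_sum, smul_mul_assoc, mul_smul_comm]
    exact Finset.sum_comm
  | mul f g hf hg =>
    obtain ⟨v, hv⟩ := hg x
    choose u hu using fun y => hf y
    refine ⟨fun z => ∑ y, u y z * v y, ?_⟩
    simp only [map_mul, mul_assoc, hv, map_sum, Finset.mul_sum]
    rw [Finset.sum_comm]
    refine Finset.sum_congr rfl fun y _ => ?_
    rw [← mul_assoc, hu, Finset.sum_mul]
    simp only [mul_assoc]
  | add f g hf hg =>
    obtain ⟨u, hu⟩ := hf x
    obtain ⟨v, hv⟩ := hg x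
    refine ⟨fun y => u y + v y, ?_⟩
    simp only [map_add, add_mul, hu, hv, mul_add, Finset.sum_add_distrib]

theorem invE_mul_mem {n : ℕ} {l : InvForms q} (hl : l ∈ invFormsDeg q n) (x : Fin 4) :
    invE q x * l ∈ invFormsDeg q (n + 1) := by
  induction hl using Submodule.span_induction with
  | mem l hl =>
    obtain ⟨w, rfl⟩ := hl
    refine Submodule.subset_span ⟨Fin.cons x w, ?_⟩
    simp [word, List.ofFn_succ]
  | zero => simp
  | add a b _ _ ha hb => rw [mul_add]; exact add_mem ha hb
  | smul c a _ ha => rw [mul_smul_comm]; exact Submodule.smul_mem _ c ha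

theorem mul_invE_mem {n : ℕ} {l : InvForms q} (hl : l ∈ invFormsDeg q n) (x : Fin 4) :
    l * invE q x ∈ invFormsDeg q (n + 1) := by
  induction hl using Submodule.span_induction with
  | mem l hl =>
    obtain ⟨w, rfl⟩ := hl
    refine Submodule.subset_span ⟨Fin.snoc w x, ?_⟩
    simp only [word]
    rw [List.ofFn_succ_last]
    simp
  | zero => simp
  | add a b _ _ ha hb => rw [add_mul]; exact add_mem ha hb
  | smul c a _ ha => rw [smul_mul_assoc]; exact Submodule.smul_mem _ c ha

theorem e_mul_mem {n : ℕ} {ω : Omega q r} (hω : ω ∈ forms q r n) (x : Fin 4) :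
    e q r x * ω ∈ forms q r (n + 1) := by
  induction hω using Submodule.span_induction with
  | mem ω hω =>
    obtain ⟨l, hl, h, rfl⟩ := hω
    refine Submodule.subset_span ⟨_, invE_mul_mem q hl x, h, ?_⟩
    rw [map_mul, ofInv_invE, mul_assoc]
  | zero => simp
  | add a b _ _ ha hb => rw [mul_add]; exact add_mem ha hb
  | smul c a _ ha => rw [mul_smul_comm]; exact Submodule.smul_mem _ c ha

theorem mul_e_mem {n : ℕ} {ω : Omega q r} (hω : ω ∈ forms q r n) (x : Fin 4) :
    ω * e q r x ∈ forms q r (n + 1) := by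
  induction hω using Submodule.span_induction with
  | mem ω hω =>
    obtain ⟨l, hl, h, rfl⟩ := hω
    obtain ⟨g, hg⟩ := ofCoord_mul_e q r h x
    rw [mul_assoc, hg, Finset.mul_sum]
    refine Submodule.sum_mem _ fun y _ => ?_
    refine Submodule.subset_span ⟨_, mul_invE_mem q hl y, g y, ?_⟩
    rw [map_mul, ofInv_invE, mul_assoc]
  | zero => simp
  | add a b _ _ ha hb => rw [add_mul]; exact add_mem ha hb
  | smul c a _ ha => rw [smul_mul_assoc]; exact Submodule.smul_mem _ c ha

/-- The exterior derivative raises the degree by one. -/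
theorem extD_mem {n : ℕ} {ω : Omega q r} (hω : ω ∈ forms q r n) :
    extD q r n ω ∈ forms q r (n + 1) := by
  simp only [extD, theta, LinearMap.sub_apply, LinearMap.smul_apply, LinearMap.mulRight_apply,
    LinearMap.mulLeft_apply, mul_add, add_mul]
  exact sub_mem
    (Submodule.smul_mem _ _ (add_mem (mul_e_mem q r hω 0) (mul_e_mem q r hω 3)))
    (add_mem (e_mul_mem q r hω 0) (e_mul_mem q r hω 3))

/-- The exterior derivative squares to zero. -/
theorem extD_extD (hq : q ≠ 0) (n : ℕ) (ω : Omega q r) :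
    extD q r (n + 1) (extD q r n ω) = 0 := by
  have h := theta_mul_theta q r hq
  simp only [extD, LinearMap.sub_apply, LinearMap.smul_apply, LinearMap.mulRight_apply,
    LinearMap.mulLeft_apply, sub_mul, mul_sub, smul_mul_assoc, mul_smul_comm, mul_assoc, h,
    mul_zero, smul_zero, ← mul_assoc (theta q r) (theta q r), zero_mul, pow_succ]
  module

/-- Exact forms are closed. -/
theorem coboundaries_le_cocycles (hq : q ≠ 0) (n : ℕ) :
    coboundaries q r n ≤ cocycles q r n := by
  cases n with
  | zero => exact bot_le
  | succ n =>
    rintro _ ⟨ω, hω, rfl⟩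
    exact ⟨extD_mem q r hω, extD_extD q r hq n ω⟩

/-- The 2-forms `m₁, …, m₆`. -/
def repH2 : Fin 6 → Omega q r :=
  let a := t q r 0 0
  let b := t q r 0 1
  let c := t q r 1 0
  let ea := e q r 0
  let eb := e q r 1
  let ec := e q r 2
  let ed := e q r 3
  ![eb * ed * a * c ^ (r - 1),
    ea * eb * a * c ^ (r - 1),
    ea * ec * a ^ (r - 1) * b ^ (r - 1),
    ec * ed * a ^ (r - 1) * b ^ (r - 1),
    (ea * ec - ec * ed) * a ^ (r - 1) * c - ea * ed,
    eb * ed * a * b ^ (r - 1) * c ^ (r - 2)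
      + q ^ 4 • (ec * ed * a ^ (r - 1) * b ^ (r - 2) * c ^ (r - 1))]

/-- The 3-forms `Θ, h₁*, h₂*, s`. -/
def repH3 : Fin 4 → Omega q r :=
  let a := t q r 0 0
  let b := t q r 0 1
  let c := t q r 1 0
  let ea := e q r 0
  let eb := e q r 1
  let ec := e q r 2
  let ed := e q r 3
  ![eb * ec * ed * b ^ (r - 1) * c ^ (r - 1),
    ea * eb * ed * a * c ^ (r - 1),
    ea * ec * ed * a ^ (r - 1) * b ^ (r - 1),
    ea * eb * ed * a * b ^ (r - 1) * c ^ (r - 2)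
      + q ^ 4 • (ea * ec * ed * a ^ (r - 1) * b ^ (r - 2) * c ^ (r - 1))]

/-- The 4-form `e_a e_b e_c e_d b^{r-1} c^{r-1}`. -/
def repH4 : Fin 1 → Omega q r :=
  ![e q r 0 * e q r 1 * e q r 2 * e q r 3 * t q r 0 1 ^ (r - 1) * t q r 1 0 ^ (r - 1)]

end QSL2

end

/-!
The cohomology is computed in explicit coordinates, by a contracting homotopy that leaves a small
complex over.

*The algebras.* `Λ` is a quotient by the kernels of all braided factorials, so that relations are
easy to derive and hard to exclude. The tensors of degree two fixed by the braiding give quadratic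
relations, through which the sixteen ordered monomials in `e_a, e_b, e_c, e_d` span `Λ`
(`invE_mul_invRec`). Conversely `Λ` acts on the space `V` with these monomials as a basis. On `V`
there are braided partial derivatives, and the braided integer computes the derivatives of a
product (`der_ofTensor`); as a form is determined by its derivatives, `ker A_n` acts by zero on
the unit (`ofTensor_eq_zero`), and since the right multiplications commute with the left ones and
generate `V` from the unit, it acts by zero (`sum_word_leftE_eq_zero`). So the monomials are a
basis of `Λ`. Likewise `A` acts on the functions on the monomials `a ^ i b ^ j c ^ k`, and `Λ ⊗ A`
carries an action of `Ω` (`omegaRep`); the relations on `r`-th powers hold by the `q`-binomial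
theorem at a root of unity (`add_pow_primitiveRoot`). The value on the unit gives coordinates in
`Fam r V` on the forms of each degree (`formRec_formCoord`, `formCoord_formRec`), and `d` becomes
an explicit operator `famD` there (`formCoord_extD`).

*Homotopies.* The operator `∂_a` satisfies `d ∂_a + ∂_a d = q ^ s - 1` for a charge `s` that `d`
preserves (`famD_dera`), so that only the part with `s = 0` matters. There is a second conserved
charge `t = i - j + k`. Another homotopy has an anticommutator with `d` that is triangular for the
filtration by powers of `b`, with diagonal coefficient `(q ^ x - 1) (q ^ (x + 2) - 1) / q ^ x` on
the layer `b ^ j`, where `x = t + 2 j` (`famD_homC`). Hence a closed form can be cleared of its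
top layer unless that layer is critical, `t + 2 j = 0` or `t + 2 j + 2 = 0`
(`IsClosed.lower_layer`). On a critical layer `d` induces a differential on `V`, namely `critZero`
or `critOne`. For `t ≠ 0` the two critical layers are adjacent and the complex made from both is
exact (`critPair_exact`). For `t = 0` they are the lowest layer and the top one, which do not
interact, and each of them contributes an eight-dimensional cohomology.

*The classes.* For `t = 0` sixteen functionals `dual` on forms vanish on exact forms
(`dual_famD`), and a closed form on which all of them vanish is exact (`exists_famD_eq`). The
closed forms `rep` (`famD_rep`), which include those of the proposition, are dual to them
(`dual_rep`). So their classes are a basis of the cohomology (`representBasis_rep`), indexed in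
each degree by the ordered monomials of this degree in `Λ`, and this gives the dimensions.
-/

open scoped Matrix

noncomputable section

namespace QSL2

/-! ### The q-binomial theorem -/

/-- The Gaussian binomial coefficient `[a + b choose a]` at `w`, through Pascal's rule. -/
def gauss (w : ℂ) : ℕ → ℕ → ℂ
  | 0, _ => 1
  | _ + 1, 0 => 1
  | a + 1, b + 1 => gauss w a (b + 1) + w ^ (a + 1) * gauss w (a + 1) b

/-- `[n]!` up to the factor `(w - 1) ^ n`. -/
def qfac (w : ℂ) (n : ℕ) : ℂ := ∏ i ∈ Finset.range n, (w ^ (i + 1) - 1)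

theorem qfac_succ (w : ℂ) (n : ℕ) : qfac w (n + 1) = qfac w n * (w ^ (n + 1) - 1) :=
  Finset.prod_range_succ _ _

theorem gauss_zero_right (w : ℂ) (a : ℕ) : gauss w a 0 = 1 := by cases a <;> simp [gauss]

theorem gauss_mul_qfac (w : ℂ) (a b : ℕ) :
    gauss w a b * (qfac w a * qfac w b) = qfac w (a + b) := by
  induction a generalizing b with
  | zero => simp [gauss, qfac]
  | succ a iha =>
    induction b with
    | zero => simp [gauss, qfac]
    | succ b ihb =>
      have h1 := iha (b + 1)
      have e1 : a + 1 + (b + 1) = (a + b + 1) + 1 := by ring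
      have e2 : a + (b + 1) = a + b + 1 := by ring
      have e3 : a + 1 + b = a + b + 1 := by ring
      rw [e2] at h1
      rw [e3] at ihb
      rw [e1, qfac_succ w (a + b + 1), gauss]
      rw [qfac_succ w b] at h1 ⊢
      rw [qfac_succ w a] at ihb ⊢
      linear_combination (w ^ (a + 1) - 1) * h1 + w ^ (a + 1) * (w ^ (b + 1) - 1) * ihb

/-- At an `r`-th root of unity the inner coefficients vanish: `[r]! = 0`, while `[a]!` and
`[b]!` are nonzero. -/
theorem gauss_eq_zero {w : ℂ} {a b r : ℕ} (hw : IsPrimitiveRoot w r) (hab : a + b = r)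
    (ha : a ≠ 0) (hb : b ≠ 0) : gauss w a b = 0 := by
  have key := gauss_mul_qfac w a b
  have hne : ∀ n, n < r → qfac w n ≠ 0 := fun n hn =>
    Finset.prod_ne_zero_iff.2 fun i hi => sub_ne_zero.2 <|
      hw.pow_ne_one_of_pos_of_lt (Nat.succ_ne_zero i) (by have := Finset.mem_range.1 hi; omega)
  have h0 : qfac w (a + b) = 0 := by
    refine Finset.prod_eq_zero (i := a + b - 1) (Finset.mem_range.2 (by omega)) ?_
    rw [show a + b - 1 + 1 = r by omega, hw.pow_eq_one, sub_self]
  rw [h0] at key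
  exact (mul_eq_zero.1 key).resolve_right
    (mul_ne_zero (hne a (by omega)) (hne b (by omega)))

section
variable {R : Type} [Ring R] [Algebra ℂ R]

theorem mul_pow_qcomm {x y : R} {w : ℂ} (h : y * x = w • (x * y)) (n : ℕ) :
    y * x ^ n = w ^ n • (x ^ n * y) := by
  induction n with
  | zero => simp
  | succ n ih =>
    rw [pow_succ, ← mul_assoc, ih, smul_mul_assoc, mul_assoc, h, mul_smul_comm, smul_smul,
      mul_assoc, pow_succ]

theorem add_pow_qcomm {x y : R} {w : ℂ} (h : y * x = w • (x * y)) (n : ℕ) :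
    (x + y) ^ n =
      ∑ p ∈ Finset.HasAntidiagonal.antidiagonal n, gauss w p.1 p.2 • (x ^ p.1 * y ^ p.2) := by
  induction n with
  | zero => simp [gauss]
  | succ n ih =>
    have split : ∀ p ∈ Finset.HasAntidiagonal.antidiagonal (n + 1),
        gauss w p.1 p.2 • (x ^ p.1 * y ^ p.2) =
        (if p.1 = 0 then 0 else gauss w (p.1 - 1) p.2) • (x ^ p.1 * y ^ p.2) +
        (if p.2 = 0 then 0 else w ^ p.1 * gauss w p.1 (p.2 - 1)) • (x ^ p.1 * y ^ p.2) := by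
      rintro ⟨a, b⟩ hab
      rw [Finset.HasAntidiagonal.mem_antidiagonal] at hab
      rw [← add_smul]
      congr 1
      rcases a with _ | a <;> rcases b with _ | b
      · simp at hab
      · simp [gauss]
      · simp [gauss_zero_right]
      · simp [gauss]
    rw [Finset.sum_congr rfl split, Finset.sum_add_distrib, Finset.Nat.sum_antidiagonal_succ,
      Finset.Nat.sum_antidiagonal_succ', pow_succ', ih, add_mul, Finset.mul_sum, Finset.mul_sum]
    congr 1
    · simp [pow_succ', mul_assoc]
    · simp only [if_true, zero_smul, zero_add, Nat.add_eq_zero_iff, one_ne_zero, and_false,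
        if_false, Nat.add_sub_cancel]
      refine Finset.sum_congr rfl fun p _ => ?_
      rw [mul_smul_comm, ← mul_assoc, mul_pow_qcomm h, smul_mul_assoc, smul_smul, mul_assoc,
        ← pow_succ', mul_comm]

/-- This makes `r`-th powers compatible with the coproduct of `A`, and so the relations
`a ^ r = d ^ r = 1` and `b ^ r = c ^ r = 0`. -/
theorem add_pow_primitiveRoot {x y : R} {w : ℂ} {r : ℕ} (hw : IsPrimitiveRoot w r) (hr : r ≠ 0)
    (h : y * x = w • (x * y)) : (x + y) ^ r = x ^ r + y ^ r := by
  obtain ⟨n, rfl⟩ := Nat.exists_eq_succ_of_ne_zero hr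
  rw [add_pow_qcomm h, Nat.succ_eq_add_one, Finset.Nat.sum_antidiagonal_succ]
  rcases n with _ | n
  · simp [gauss, gauss_zero_right, add_comm]
  · rw [Finset.Nat.sum_antidiagonal_succ', Finset.sum_eq_zero]
    · simp [gauss, gauss_zero_right, add_comm]
    · intro p hp
      rw [Finset.HasAntidiagonal.mem_antidiagonal] at hp
      rw [gauss_eq_zero hw (by omega) (by omega) (by omega), zero_smul]

/-! ### Realizations of the coordinate algebra -/

/-- The entries of the array `t` satisfy the relations of `A`. -/
def IsCoord (q : ℂ) (r : ℕ) (t : Fin 2 → Fin 2 → R) : Prop :=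
  ∀ x y, CoordRel q r t x y → x = y

/-- The matrix coproduct: the product of two commuting arrays satisfying the relations of `A`
satisfies them as well. -/
theorem IsCoord.coproduct {q : ℂ} {r : ℕ} {s t : Fin 2 → Fin 2 → R}
    (hs : IsCoord q r s) (ht : IsCoord q r t) (hst : ∀ i j k l, t i j * s k l = s k l * t i j)
    (hq : IsPrimitiveRoot (q ^ 2) r) (hr : r ≠ 0) :
    IsCoord q r fun i j => s i 0 * t 0 j + s i 1 * t 1 j := by
  have q0 : q ≠ 0 := fun h => by
    have := hq.pow_eq_one
    simp [h, hr] at this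
  have s1 := hs _ _ .ba
  have s2 := hs _ _ .ca
  have s3 := hs _ _ .db
  have s4 := hs _ _ .dc
  have s5 := hs _ _ .cb
  have s6 := sub_eq_iff_eq_add.1 (hs _ _ .da)
  have s7 := sub_eq_iff_eq_add.1 (hs _ _ .qdet)
  have t1 := ht _ _ .ba
  have t2 := ht _ _ .ca
  have t3 := ht _ _ .db
  have t4 := ht _ _ .dc
  have t5 := ht _ _ .cb
  have t6 := sub_eq_iff_eq_add.1 (ht _ _ .da)
  have t7 := sub_eq_iff_eq_add.1 (ht _ _ .qdet)
  rw [s7] at s6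
  rw [t7] at t6
  have mm : ∀ i j k l m n o p, (s i j * t k l) * (s m n * t o p) =
      (s i j * s m n) * (t k l * t o p) := fun i j k l m n o p => by
    rw [mul_assoc, ← mul_assoc (t k l), hst, mul_assoc, ← mul_assoc, ← mul_assoc]
  have pw : ∀ i j k l (n : ℕ), (s i j * t k l) ^ n = s i j ^ n * t k l ^ n := fun i j k l n =>
    (Commute.mul_pow (show Commute _ _ from (hst k l i j).symm) n)
  have hb : ∀ j, (s 0 1 * t 1 j) * (s 0 0 * t 0 j) =
      q ^ 2 • ((s 0 0 * t 0 j) * (s 0 1 * t 1 j)) := by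
    intro j
    rw [mm, mm, s1]
    fin_cases j
    · simp only [Fin.zero_eta, t2, smul_mul_assoc, mul_smul_comm, smul_smul, pow_two]
    · simp only [Fin.mk_one, t3, smul_mul_assoc, mul_smul_comm, smul_smul, pow_two]
  have hd : ∀ j, (s 1 1 * t 1 j) * (s 1 0 * t 0 j) =
      q ^ 2 • ((s 1 0 * t 0 j) * (s 1 1 * t 1 j)) := by
    intro j
    rw [mm, mm, s4]
    fin_cases j
    · simp only [Fin.zero_eta, t2, smul_mul_assoc, mul_smul_comm, smul_smul, pow_two]
    · simp only [Fin.mk_one, t3, smul_mul_assoc, mul_smul_comm, smul_smul, pow_two]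
  have sa := hs _ _ .a_pow
  have sb := hs _ _ .b_pow
  have sc := hs _ _ .c_pow
  have sd := hs _ _ .d_pow
  have ta := ht _ _ .a_pow
  have tb := ht _ _ .b_pow
  have tc := ht _ _ .c_pow
  have td := ht _ _ .d_pow
  rintro _ _ (_ | _)
  iterate 7
    · simp only [mul_add, add_mul, mm, s1, s2, s3, s4, s5, s6, s7, t1, t2, t3, t4, t5, t6, t7,
        smul_mul_assoc, mul_smul_comm, one_mul, mul_one, mu]
      match_scalars <;> field_simp <;> ring
  · rw [add_pow_primitiveRoot hq hr (hb 0), pw, pw, sa, ta, sb, tc]; simp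
  · rw [add_pow_primitiveRoot hq hr (hb 1), pw, pw, sa, tb, sb, td]; simp
  · rw [add_pow_primitiveRoot hq hr (hd 0), pw, pw, sc, ta, sd, tc]; simp
  · rw [add_pow_primitiveRoot hq hr (hd 1), pw, pw, sc, tb, sd, td]; simp
end

/-! ### The exterior algebra `Λ` on a basis -/

/-- The space with basis `1, e_a, e_b, e_c, e_d, e_ab, e_ac, e_ad, e_bc, e_bd, e_cd, e_abc, e_abd,
e_acd, e_bcd, e_abcd`, in this order, that carries the model of `Λ`. -/
abbrev V : Type := Fin 16 → ℂ

/-- The coordinate functionals on `V`. -/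
abbrev co (i : Fin 16) : V →ₗ[ℂ] ℂ := LinearMap.proj i

/-- Left multiplication by `e_a` on the ordered monomials. Each component of the `pi` is the
coefficient of one basis element in the image, and likewise for the operators below. -/
def La (q : ℂ) : V →ₗ[ℂ] V :=
  LinearMap.pi ![0, co 0, 0, 0, 0, co 2, co 3, co 4, (mu q) • co 1, 0, 0, co 8, co 9, co 10,
    (mu q) • co 7, co 14]

/-- Left multiplication by `e_b`. -/
def Lb (q : ℂ) : V →ₗ[ℂ] V :=
  LinearMap.pi ![0, 0, co 0, 0, 0, -((q⁻¹ ^ 2) • co 1), 0, 0, co 3,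
    (q⁻¹ ^ 2 * mu q) • co 1 + co 4, 0, -((q⁻¹ ^ 2) • co 6), -((q⁻¹ ^ 2) • co 7), 0,
    -((q⁻¹ ^ 2 * mu q) • co 6) + co 10, -((q⁻¹ ^ 2) • co 13)]

/-- Left multiplication by `e_c`. -/
def Lc (q : ℂ) : V →ₗ[ℂ] V :=
  LinearMap.pi ![0, 0, 0, co 0, 0, 0, -((q ^ 2) • co 1), 0, -co 2, 0, -((mu q) • co 1) + co 4,
    (q ^ 2) • co 5, 0, -((q ^ 2) • co 7), -((mu q) • co 5) - co 9, (q ^ 2) • co 12]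

/-- Left multiplication by `e_d`. -/
def Ld (q : ℂ) : V →ₗ[ℂ] V :=
  LinearMap.pi ![0, 0, 0, 0, co 0, 0, 0, -co 1, -((mu q) • co 1), -co 2, -co 3, 0, co 5, co 6,
    -((mu q) • co 7) + co 8, -co 11]

/-- Right multiplication by `e_a`. -/
def Ra (q : ℂ) : V →ₗ[ℂ] V :=
  LinearMap.pi ![0, co 0, 0, 0, 0, -((q⁻¹ ^ 2) • co 2), -((q ^ 2) • co 3), -co 4,
    (mu q) • co 1 - (mu q) • co 4, (q⁻¹ ^ 2 * mu q) • co 2, -((mu q) • co 3),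
    -((mu q) • co 7) + co 8, (q⁻¹ ^ 2 * mu q) • co 5 + (q⁻¹ ^ 2) • co 9,
    -((mu q) • co 6) + (q ^ 2) • co 10, -((mu q) • co 7), -co 14]

/-- Right multiplication by `e_b`. -/
def Rb : V →ₗ[ℂ] V :=
  LinearMap.pi ![0, 0, co 0, 0, 0, co 1, 0, 0, -co 3, -co 4, 0, -co 6, -co 7, 0, co 10, co 13]

/-- Right multiplication by `e_c`. -/
def Rc : V →ₗ[ℂ] V :=
  LinearMap.pi ![0, 0, 0, co 0, 0, 0, co 1, 0, co 2, 0, -co 4, co 5, 0, -co 7, -co 9, -co 12]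

/-- Right multiplication by `e_d`. -/
def Rd : V →ₗ[ℂ] V :=
  LinearMap.pi ![0, 0, 0, 0, co 0, 0, 0, co 1, 0, co 2, co 3, 0, co 5, co 6, co 8, co 11]

/-- The action of `a` on `Λ`. -/
def rhoA (q : ℂ) : V →ₗ[ℂ] V :=
  LinearMap.pi ![co 0, q • co 1, co 2, co 3, (q * mu q ^ 2) • co 1 + q⁻¹ • co 4, q • co 5,
    q • co 6, co 7, co 8, -((q * mu q ^ 2) • co 5) + q⁻¹ • co 9, q⁻¹ • co 10, q • co 11, co 12,
    co 13, q⁻¹ • co 14, co 15]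

/-- The action of `b` on `Λ`. -/
def rhoB (q : ℂ) : V →ₗ[ℂ] V :=
  LinearMap.pi ![0, 0, 0, (mu q) • co 1, (q * mu q) • co 2, 0, 0, (q ^ 2 * mu q) • co 5,
    -((mu q) • co 5), 0, (q * mu q) • co 7 - (q * mu q) • co 8, 0, 0, -((q ^ 2 * mu q) • co 11),
    -((q * mu q) • co 12), 0]

/-- The action of `c` on `Λ`. -/
def rhoC (q : ℂ) : V →ₗ[ℂ] V :=
  LinearMap.pi ![0, 0, (mu q) • co 1, 0, (q * mu q) • co 3, 0, 0, (mu q) • co 6, (mu q) • co 6,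
    (q⁻¹ * mu q) • co 7 + (q * mu q) • co 8, 0, 0, (mu q) • co 11, 0, (q⁻¹ * mu q) • co 13, 0]

/-- The action of `d` on `Λ`. -/
def rhoD (q : ℂ) : V →ₗ[ℂ] V :=
  LinearMap.pi ![co 0, q⁻¹ • co 1, co 2, co 3, q • co 4, q⁻¹ • co 5, q⁻¹ • co 6, co 7, co 8,
    (q * mu q ^ 2) • co 5 + q • co 9, q • co 10, q⁻¹ • co 11, co 12, co 13,
    -((q * mu q ^ 2) • co 11) + q • co 14, co 15]

/-- The braided partial derivative `∂_a`. The four derivatives are fixed by `∂_y 1 = 0` and the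
braided Leibniz rule `der_mul_leftE`. -/
def dera : V →ₗ[ℂ] V :=
  LinearMap.pi ![co 1, 0, co 5, co 6, co 7, 0, 0, 0, co 11, co 12, co 13, 0, 0, 0, co 15, 0]

/-- The braided partial derivative `∂_b`. -/
def derb : V →ₗ[ℂ] V :=
  LinearMap.pi ![co 2, -co 5, 0, co 8, co 9, 0, -co 11, -co 12, 0, 0, co 14, 0, 0, -co 15, 0, 0]

/-- The braided partial derivative `∂_c`. -/
def derc : V →ₗ[ℂ] V :=
  LinearMap.pi ![co 3, -co 6, -co 8, 0, co 10, co 11, 0, -co 13, 0, -co 14, 0, 0, co 15, 0, 0, 0]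

/-- The braided partial derivative `∂_d`. -/
def derd (q : ℂ) : V →ₗ[ℂ] V :=
  LinearMap.pi ![co 4, -co 7 - (q ^ 2 * mu q) • co 8, -((q ^ 2 * mu q) • co 5) - (q ^ 2) • co 9,
    (mu q) • co 6 - (q⁻¹ ^ 2) • co 10, (mu q) • co 8, (q ^ 2) • co 12, (q⁻¹ ^ 2) • co 13,
    -((mu q) • co 11) - (q ^ 2 * mu q) • co 14, co 14, -((q ^ 2 * mu q) • co 12), (mu q) • co 13,
    -co 15, 0, 0, 0, 0]

theorem V_ext {u v : V} (h : u 0 = v 0 ∧ u 1 = v 1 ∧ u 2 = v 2 ∧ u 3 = v 3 ∧ u 4 = v 4 ∧ u 5 = v 5 ∧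
    u 6 = v 6 ∧ u 7 = v 7 ∧ u 8 = v 8 ∧ u 9 = v 9 ∧ u 10 = v 10 ∧ u 11 = v 11 ∧ u 12 = v 12 ∧
    u 13 = v 13 ∧ u 14 = v 14 ∧ u 15 = v 15) : u = v := by
  obtain ⟨h0, h1, h2, h3, h4, h5, h6, h7, h8, h9, h10, h11, h12, h13, h14, h15⟩ := h
  funext i
  fin_cases i <;> assumption

/-- Left multiplication by the basis elements of `Λ¹`. -/
def leftE (q : ℂ) : Fin 4 → Module.End ℂ V := ![La q, Lb q, Lc q, Ld q]

/-- Right multiplication by the basis elements of `Λ¹`. -/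
def rightE (q : ℂ) : Fin 4 → Module.End ℂ V := ![Ra q, Rb, Rc, Rd]

/-- The action of the coordinate functions on `Λ`. -/
def rho (q : ℂ) : Fin 2 → Fin 2 → Module.End ℂ V := ![![rhoA q, rhoB q], ![rhoC q, rhoD q]]

/-- The braided partial derivatives on `Λ`. -/
def der (q : ℂ) : Fin 4 → Module.End ℂ V := ![dera, derb, derc, derd q]

variable {q : ℂ}

set_option maxHeartbeats 1000000 in
theorem leftE_mul_rightE (hq : q ≠ 0) (x y : Fin 4) :
    leftE q x * rightE q y = rightE q y * leftE q x := by
  refine LinearMap.ext fun v => V_ext ?_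
  fin_cases x <;> fin_cases y <;>
    simp only [leftE, rightE, La, Lb, Lc, Ld, Ra, Rb, Rc, Rd, Module.End.mul_apply,
      LinearMap.pi_apply, LinearMap.proj_apply, LinearMap.add_apply, LinearMap.sub_apply,
      LinearMap.neg_apply, LinearMap.smul_apply,
      LinearMap.zero_apply,
      smul_eq_mul, Matrix.cons_val, Fin.reduceFinMk, Fin.zero_eta,
      Fin.mk_one, Fin.isValue] <;>
    and_intros <;> (first | ring1 | ((try simp only [mu]) <;> field_simp <;> ring1))

set_option maxHeartbeats 1000000 in
theorem rho_mul_leftE (hq : q ≠ 0) (i j : Fin 2) (x : Fin 4) :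
    rho q i j * leftE q x = ∑ k, (∑ y, act q i k y x • leftE q y) * rho q k j := by
  refine LinearMap.ext fun v => V_ext ?_
  simp only [Fin.sum_univ_two, Fin.sum_univ_four]
  fin_cases i <;> fin_cases j <;> fin_cases x <;>
    simp only [leftE, rho, La, Lb, Lc, Ld, rhoA, rhoB, rhoC, rhoD, act, actA, actB, actC, actD,
      Matrix.of_apply, zero_smul, one_smul, zero_mul, mul_zero, zero_add, add_zero, neg_zero,
      sub_zero, Module.End.mul_apply, LinearMap.pi_apply, LinearMap.proj_apply,
      LinearMap.add_apply, LinearMap.sub_apply, LinearMap.neg_apply, LinearMap.smul_apply,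
      LinearMap.zero_apply, Pi.add_apply, Pi.smul_apply,
      smul_eq_mul, Matrix.cons_val, Fin.reduceFinMk, Fin.zero_eta,
      Fin.mk_one, Fin.isValue] <;>
    and_intros <;> (first | ring1 | ((try simp only [mu]) <;> field_simp <;> ring1))

set_option maxHeartbeats 1000000 in
theorem rho_mul_rightE (hq : q ≠ 0) (i j : Fin 2) (y : Fin 4) :
    rho q i j * rightE q y = ∑ k, (∑ z, act q k j z y • rightE q z) * rho q i k := by
  refine LinearMap.ext fun v => V_ext ?_
  simp only [Fin.sum_univ_two, Fin.sum_univ_four]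
  fin_cases i <;> fin_cases j <;> fin_cases y <;>
    simp only [rightE, rho, Ra, Rb, Rc, Rd, rhoA, rhoB, rhoC, rhoD, act, actA, actB, actC, actD,
      Matrix.of_apply, zero_smul, one_smul, zero_mul, mul_zero, zero_add, add_zero, neg_zero,
      sub_zero, Module.End.mul_apply, LinearMap.pi_apply, LinearMap.proj_apply,
      LinearMap.add_apply, LinearMap.sub_apply, LinearMap.neg_apply, LinearMap.smul_apply,
      LinearMap.zero_apply, Pi.add_apply, Pi.smul_apply,
      smul_eq_mul, Matrix.cons_val, Fin.reduceFinMk, Fin.zero_eta,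
      Fin.mk_one, Fin.isValue] <;>
    and_intros <;> (first | ring1 | ((try simp only [mu]) <;> field_simp <;> ring1))

set_option maxHeartbeats 2000000 in
/-- The braided Leibniz rule. -/
theorem der_mul_leftE (hq : q ≠ 0) (x y : Fin 4) :
    der q y * leftE q x =
      (if y = x then 1 else 0) - ∑ f, ∑ z, braiding q (y, z) (x, f) • (leftE q z * der q f) := by
  refine LinearMap.ext fun v => V_ext ?_
  simp only [Fin.sum_univ_four]
  fin_cases x <;> fin_cases y <;>
    simp only [braiding, row, col, act, actS, actA, actB, actC, actD, Matrix.mul_apply,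
      Fin.sum_univ_four, leftE, der, La, Lb, Lc, Ld, dera, derb, derc, derd, Matrix.of_apply,
      Matrix.neg_apply, Matrix.smul_apply, Fin.reduceEq, if_true, if_false, Module.End.one_apply,
      zero_smul, one_smul, zero_mul, mul_zero, zero_add, add_zero, one_mul, mul_one, neg_zero,
      sub_zero, neg_mul, mul_neg, Module.End.mul_apply, LinearMap.pi_apply, LinearMap.proj_apply,
      LinearMap.add_apply, LinearMap.sub_apply, LinearMap.neg_apply, LinearMap.smul_apply,
      LinearMap.zero_apply, Pi.add_apply, Pi.sub_apply, Pi.smul_apply,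
      Pi.zero_apply, smul_eq_mul, Matrix.cons_val, Fin.reduceFinMk, Fin.zero_eta,
      Fin.mk_one, Fin.isValue] <;>
    and_intros <;> (first | ring1 | ((try simp only [mu]) <;> field_simp <;> ring1))

theorem rhoA_pow (hq : q ≠ 0) (n : ℕ) : rhoA q ^ n =
    LinearMap.pi ![co 0, q ^ n • co 1, co 2, co 3,
      (mu q * (q ^ n - q⁻¹ ^ n)) • co 1 + q⁻¹ ^ n • co 4, q ^ n • co 5, q ^ n • co 6, co 7, co 8,
      -((mu q * (q ^ n - q⁻¹ ^ n)) • co 5) + q⁻¹ ^ n • co 9, q⁻¹ ^ n • co 10, q ^ n • co 11,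
      co 12, co 13, q⁻¹ ^ n • co 14, co 15] := by
  induction n with
  | zero => exact LinearMap.ext fun v => V_ext (by simp)
  | succ n ih =>
    rw [pow_succ', ih]
    refine LinearMap.ext fun v => V_ext ?_
    simp [rhoA, pow_succ] <;> and_intros <;>
      (first | ring1 | ((try simp only [mu]) <;> field_simp <;> ring1))

theorem rhoD_pow (hq : q ≠ 0) (n : ℕ) : rhoD q ^ n =
    LinearMap.pi ![co 0, q⁻¹ ^ n • co 1, co 2, co 3, q ^ n • co 4, q⁻¹ ^ n • co 5,
      q⁻¹ ^ n • co 6, co 7, co 8, (mu q * (q ^ n - q⁻¹ ^ n)) • co 5 + q ^ n • co 9, q ^ n • co 10,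
      q⁻¹ ^ n • co 11, co 12, co 13, -((mu q * (q ^ n - q⁻¹ ^ n)) • co 11) + q ^ n • co 14,
      co 15] := by
  induction n with
  | zero => exact LinearMap.ext fun v => V_ext (by simp)
  | succ n ih =>
    rw [pow_succ', ih]
    refine LinearMap.ext fun v => V_ext ?_
    simp [rhoD, pow_succ] <;> and_intros <;>
      (first | ring1 | ((try simp only [mu]) <;> field_simp <;> ring1))

theorem rhoB_pow_three : rhoB q ^ 3 = 0 :=
  LinearMap.ext fun v => V_ext (by simp [pow_succ, rhoB])

theorem rhoC_pow_three : rhoC q ^ 3 = 0 :=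
  LinearMap.ext fun v => V_ext (by simp [pow_succ, rhoC])

set_option maxHeartbeats 1000000 in
/-- The action on `Λ` factors through `A`. -/
theorem isCoord_rho {r : ℕ} (hq : q ≠ 0) (hr : 3 ≤ r) (hqr : q ^ r = 1) :
    IsCoord q r (rho q) := by
  rintro _ _ (_ | _)
  iterate 7
    · refine LinearMap.ext fun v => V_ext ?_
      simp [rho, rhoA, rhoB, rhoC, rhoD] <;> and_intros <;>
        (first | ring1 | ((try simp only [mu]) <;> field_simp <;> ring1))
  · change rhoA q ^ r = 1
    rw [rhoA_pow hq, inv_pow, hqr]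
    exact LinearMap.ext fun v => V_ext (by simp)
  · change rhoB q ^ r = 0
    rw [← Nat.sub_add_cancel hr, pow_add, rhoB_pow_three, mul_zero]
  · change rhoC q ^ r = 0
    rw [← Nat.sub_add_cancel hr, pow_add, rhoC_pow_three, mul_zero]
  · change rhoD q ^ r = 1
    rw [rhoD_pow hq, inv_pow, hqr]
    exact LinearMap.ext fun v => V_ext (by simp)

/-! ### Functions on the monomial basis of the coordinate algebra -/

section
variable {r : ℕ} {E : Type} [AddCommGroup E] [Module ℂ E]

/-- Families indexed by the monomials `a ^ i b ^ j c ^ k`, with exponents in `ZMod r`: an element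
`f` stands for `∑ f i j k ⊗ a ^ i b ^ j c ^ k`. The powers of `q` with such exponents are the values
of an additive character `χ` with `χ 1 = q`. -/
abbrev Fam (r : ℕ) (E : Type) : Type := ZMod r → ZMod r → ZMod r → E

variable (χ : AddChar (ZMod r) ℂ)

/-- Multiplication by `a` on the monomial basis. -/
def opA : Module.End ℂ (Fam r E) where
  toFun f i j k := f (i - 1) j k
  map_add' _ _ := rfl
  map_smul' _ _ := rfl

/-- Multiplication by `a⁻¹` on the monomial basis. -/
def opAinv : Module.End ℂ (Fam r E) where
  toFun f i j k := f (i + 1) j k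
  map_add' _ _ := rfl
  map_smul' _ _ := rfl

/-- Multiplication by `b` on the monomial basis; `j = 0` would be reached from `b ^ (r - 1)`. -/
def opB : Module.End ℂ (Fam r E) where
  toFun f i j k := if j = 0 then 0 else χ i • f i (j - 1) k
  map_add' f g := by funext i j k; by_cases h : j = 0 <;> simp [h]
  map_smul' c f := by funext i j k; by_cases h : j = 0 <;> simp [h, smul_comm c]

/-- Multiplication by `c` on the monomial basis. -/
def opC : Module.End ℂ (Fam r E) where
  toFun f i j k := if k = 0 then 0 else χ i • f i j (k - 1)
  map_add' f g := by funext i j k; by_cases h : k = 0 <;> simp [h]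
  map_smul' c f := by funext i j k; by_cases h : k = 0 <;> simp [h, smul_comm c]

/-- Multiplication by `d = a⁻¹ (1 + q⁻¹ b c)` on the monomial basis. -/
def opD : Module.End ℂ (Fam r E) := opAinv + (χ 1)⁻¹ • (opAinv * opB χ * opC χ)

/-- The left regular action of the coordinate functions on the monomial basis. -/
def tau : Fin 2 → Fin 2 → Module.End ℂ (Fam r E) := ![![opA, opB χ], ![opC χ, opD χ]]

@[simp] theorem opA_apply (f : Fam r E) (i j k : ZMod r) : opA f i j k = f (i - 1) j k := rfl

@[simp] theorem opAinv_apply (f : Fam r E) (i j k : ZMod r) :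
    opAinv f i j k = f (i + 1) j k := rfl

@[simp] theorem opB_apply (f : Fam r E) (i j k : ZMod r) :
    opB χ f i j k = if j = 0 then 0 else χ i • f i (j - 1) k := rfl

@[simp] theorem opC_apply (f : Fam r E) (i j k : ZMod r) :
    opC χ f i j k = if k = 0 then 0 else χ i • f i j (k - 1) := rfl

/-- An operator that strictly raises a level bounded by `n` is nilpotent of order `n`. -/
theorem pow_eq_zero_of_lowers (lev : ZMod r → ZMod r → ZMod r → ℕ) (P : Module.End ℂ (Fam r E))
    (hP : ∀ f i j k, (∀ i' j' k', lev i' j' k' < lev i j k → f i' j' k' = 0) → P f i j k = 0)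
    {n : ℕ} (hn : ∀ i j k, lev i j k < n) : P ^ n = 0 := by
  have key : ∀ m f i j k, lev i j k < m → (P ^ m) f i j k = 0 := by
    intro m
    induction m with
    | zero => intro f i j k h; omega
    | succ m ih =>
      intro f i j k h
      rw [pow_succ']
      exact hP _ _ _ _ fun i' j' k' h' => ih f _ _ _ (by omega)
  ext f i j k
  exact key n f i j k (hn i j k)

theorem val_sub_one_lt [Fact (1 < r)] {j : ZMod r} (hj : j ≠ 0) : (j - 1).val < j.val := by
  have h1 : (1 : ZMod r).val = 1 := ZMod.val_one r
  have hp : 0 < j.val := Nat.pos_of_ne_zero fun h => hj ((ZMod.val_eq_zero j).1 h)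
  rw [ZMod.val_sub (by omega)]
  omega

theorem opAinv_mul_opA : (opAinv * opA : Module.End ℂ (Fam r E)) = 1 := by
  ext f i j k; simp

theorem opA_mul_opAinv : (opA * opAinv : Module.End ℂ (Fam r E)) = 1 := by
  ext f i j k; simp

theorem opB_mul_opA : (opB χ * opA : Module.End ℂ (Fam r E)) = χ 1 • (opA * opB χ) := by
  ext f i j k
  by_cases hj : j = 0 <;> simp [hj, smul_smul, ← AddChar.map_add_eq_mul]

theorem opC_mul_opA : (opC χ * opA : Module.End ℂ (Fam r E)) = χ 1 • (opA * opC χ) := by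
  ext f i j k
  by_cases hj : k = 0 <;> simp [hj, smul_smul, ← AddChar.map_add_eq_mul]

theorem opC_mul_opB : (opC χ * opB χ : Module.End ℂ (Fam r E)) = opB χ * opC χ := by
  ext f i j k
  by_cases hj : j = 0 <;> by_cases hk : k = 0 <;> simp [hj, hk, smul_smul]

theorem opA_pow (n : ℕ) (f : Fam r E) (i j k : ZMod r) :
    (opA ^ n : Module.End ℂ (Fam r E)) f i j k = f (i - n) j k := by
  induction n generalizing i with
  | zero => simp
  | succ n ih => rw [pow_succ', Module.End.mul_apply, opA_apply, ih]; congr 1; push_cast; ring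

theorem opA_pow_r : (opA : Module.End ℂ (Fam r E)) ^ r = 1 := by
  ext f i j k; simp [opA_pow]

theorem opAinv_pow_r : (opAinv : Module.End ℂ (Fam r E)) ^ r = 1 := by
  have h : Commute (opAinv : Module.End ℂ (Fam r E)) opA := by
    rw [Commute, SemiconjBy, opAinv_mul_opA, opA_mul_opAinv]
  have := h.mul_pow r
  rwa [opAinv_mul_opA, one_pow, opA_pow_r, mul_one, eq_comm] at this

theorem opB_pow_r [NeZero r] [Fact (1 < r)] : (opB χ : Module.End ℂ (Fam r E)) ^ r = 0 :=
  pow_eq_zero_of_lowers (fun _ j _ => j.val) _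
    (fun f i j k h => by
      by_cases hj : j = 0
      · simp [hj]
      · simp [hj, h i (j - 1) k (val_sub_one_lt hj)])
    fun _ j _ => j.val_lt

theorem opC_pow_r [NeZero r] [Fact (1 < r)] : (opC χ : Module.End ℂ (Fam r E)) ^ r = 0 :=
  pow_eq_zero_of_lowers (fun _ _ k => k.val) _
    (fun f i j k h => by
      by_cases hj : k = 0
      · simp [hj]
      · simp [hj, h i j (k - 1) (val_sub_one_lt hj)])
    fun _ _ k => k.val_lt

theorem chi_ne_zero (i : ZMod r) : χ i ≠ 0 := by
  intro h
  have := χ.map_add_eq_mul i (-i)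
  simp [h] at this

theorem opBC_mul_opAinv : (opB χ * opC χ * opAinv : Module.End ℂ (Fam r E)) =
    (χ 1)⁻¹ ^ 2 • (opAinv * (opB χ * opC χ)) := by
  have h := chi_ne_zero χ 1
  ext f i j k
  by_cases hj : j = 0 <;> by_cases hk : k = 0 <;>
    simp [hj, hk, smul_smul, AddChar.map_add_eq_mul]
  congr 1
  field_simp

theorem opD_apply (f : Fam r E) (i j k : ZMod r) :
    opD χ f i j k = f (i + 1) j k + (χ 1)⁻¹ • (if j = 0 then 0 else
      χ (i + 1) • if k = 0 then 0 else χ (i + 1) • f (i + 1) (j - 1) (k - 1)) := rfl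

theorem opD_mul_opB : (opD χ * opB χ : Module.End ℂ (Fam r E)) = χ 1 • (opB χ * opD χ) := by
  ext f i j k
  by_cases hj : j = 0
  · simp [hj, opD_apply]
  · simp only [Module.End.mul_apply, opD_apply, opB_apply, hj, if_false, LinearMap.smul_apply,
      Pi.smul_apply, smul_add, smul_smul, smul_ite, smul_zero, ← AddChar.map_add_eq_mul]
    congr 1
    · rw [add_comm]
    · split_ifs
      all_goals first
        | rfl
        | (congr 1; simp only [AddChar.map_add_eq_mul]; ring)

theorem opD_mul_opC : (opD χ * opC χ : Module.End ℂ (Fam r E)) = χ 1 • (opC χ * opD χ) := by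
  ext f i j k
  by_cases hk : k = 0
  · simp [hk, opD_apply]
  · simp only [Module.End.mul_apply, opD_apply, opC_apply, hk, if_false, LinearMap.smul_apply,
      Pi.smul_apply, smul_add, smul_smul, smul_ite, smul_zero, ← AddChar.map_add_eq_mul]
    congr 1
    · rw [add_comm]
    · split_ifs
      all_goals first
        | rfl
        | (congr 1; simp only [AddChar.map_add_eq_mul]; ring)

/-- The regular representation exists: the monomials `a ^ i b ^ j c ^ k` are a basis of `A`.
The relation `d ^ r = 1` holds by the `q`-binomial theorem, since `a⁻¹` and `a⁻¹ b c` commute up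
to `q ^ 2`. -/
theorem isCoord_tau [NeZero r] [Fact (1 < r)] (hχ : IsPrimitiveRoot (χ 1 ^ 2) r) :
    IsCoord (χ 1) r (tau χ : Fin 2 → Fin 2 → Module.End ℂ (Fam r E)) := by
  have h0 := chi_ne_zero χ 1
  have a1 : (opAinv * opA : Module.End ℂ (Fam r E)) = 1 := opAinv_mul_opA
  have a2 : (opA * opAinv : Module.End ℂ (Fam r E)) = 1 := opA_mul_opAinv
  have ba : (opB χ * opA : Module.End ℂ (Fam r E)) = χ 1 • (opA * opB χ) := opB_mul_opA χ
  have ca : (opC χ * opA : Module.End ℂ (Fam r E)) = χ 1 • (opA * opC χ) := opC_mul_opA χ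
  have bci : (opB χ * opC χ * opAinv : Module.End ℂ (Fam r E)) =
    (χ 1)⁻¹ ^ 2 • (opAinv * (opB χ * opC χ)) := opBC_mul_opAinv χ
  rintro _ _ (_ | _)
  · exact ba
  · exact ca
  · exact opD_mul_opB χ
  · exact opD_mul_opC χ
  · exact opC_mul_opB χ
  · change opD χ * opA - opA * opD χ = (χ 1 * mu (χ 1)) • (opB χ * opC χ)
    have e1 : (opAinv * opB χ * opC χ * opA : Module.End ℂ (Fam r E)) =
        χ 1 ^ 2 • (opB χ * opC χ) := by
      rw [mul_assoc, ca, mul_smul_comm, mul_assoc, ← mul_assoc (opB χ), ba, smul_mul_assoc,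
        mul_smul_comm, mul_assoc, ← mul_assoc opAinv, a1, one_mul, smul_smul, pow_two]
    have e2 : (opA * (opAinv * opB χ * opC χ) : Module.End ℂ (Fam r E)) = opB χ * opC χ := by
      rw [mul_assoc, ← mul_assoc, a2, one_mul]
    rw [opD, add_mul, mul_add, a1, a2, smul_mul_assoc, mul_smul_comm, e1, e2, mu]
    match_scalars <;> field_simp <;> ring
  · change opA * opD χ - (χ 1)⁻¹ • (opB χ * opC χ) = 1
    rw [opD, mul_add, a2, mul_smul_comm, mul_assoc, ← mul_assoc, a2, one_mul, add_sub_cancel_right]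
  · exact opA_pow_r
  · exact opB_pow_r χ
  · exact opC_pow_r χ
  · change opD χ ^ r = 1
    have hw : IsPrimitiveRoot ((χ 1)⁻¹ ^ 2) r := by rw [inv_pow]; exact hχ.inv
    rw [opD, add_pow_primitiveRoot hw (NeZero.ne r), opAinv_pow_r, smul_pow,
      pow_eq_zero_of_lowers (fun _ j _ => j.val), smul_zero, add_zero]
    · intro f i j k h
      by_cases hj : j = 0
      · simp [hj]
      · by_cases hk : k = 0
        · simp [hk]
        · simp [hj, hk, h (i + 1) (j - 1) (k - 1) (val_sub_one_lt hj)]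
    · exact fun _ j _ => j.val_lt
    · rw [smul_mul_assoc, mul_smul_comm, mul_assoc opAinv, mul_assoc, bci, mul_smul_comm,
        smul_comm]
end

/-! ### The kernel of the braided factorials acts trivially -/

section
variable {q : ℂ}

/-- The unit of `Λ`. -/
def oneV : V := Pi.single 0 1

/-- The element of the model of `Λ` represented by a tensor of degree `n`. -/
def ofTensor (q : ℂ) {n : ℕ} (u : (Fin n → Fin 4) → ℂ) : V :=
  ∑ w, u w • word (leftE q) w oneV

/-- The component `u_y` of a tensor `u = ∑ e_y ⊗ u_y`. -/
def slice {n : ℕ} (y : Fin 4) (u : (Fin (n + 1) → Fin 4) → ℂ) : (Fin n → Fin 4) → ℂ :=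
  fun w => u (Fin.cons y w)

theorem sum_words {M : Type} [AddCommMonoid M] {n : ℕ} (f : (Fin (n + 1) → Fin 4) → M) :
    ∑ w, f w = ∑ y, ∑ w, f (Fin.cons y w) := by
  rw [← (Fin.consEquiv fun _ => Fin 4).sum_comp, Fintype.sum_prod_type]
  rfl

theorem word_cons {R : Type} [Ring R] (e : Fin 4 → R) {n : ℕ} (x : Fin 4) (w : Fin n → Fin 4) :
    word e (Fin.cons x w : Fin (n + 1) → Fin 4) = e x * word e w := by
  simp [word, List.ofFn_succ]

theorem word_zero {R : Type} [Ring R] (e : Fin 4 → R) (w : Fin 0 → Fin 4) : word e w = 1 := by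
  simp [word]

theorem ofTensor_succ {n : ℕ} (u : (Fin (n + 1) → Fin 4) → ℂ) :
    ofTensor q u = ∑ x, leftE q x (ofTensor q (slice x u)) := by
  simp only [ofTensor, sum_words, word_cons, Module.End.mul_apply, map_sum, map_smul, slice]

theorem ofTensor_sub {n : ℕ} (u v : (Fin n → Fin 4) → ℂ) :
    ofTensor q (u - v) = ofTensor q u - ofTensor q v := by
  simp [ofTensor, sub_smul]

theorem ofTensor_sum_smul {n : ℕ} {ι : Type} (s : Finset ι) (c : ι → ℂ)
    (u : ι → (Fin n → Fin 4) → ℂ) :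
    ofTensor q (∑ i ∈ s, c i • u i) = ∑ i ∈ s, c i • ofTensor q (u i) := by
  simp only [ofTensor, Finset.sum_apply, Pi.smul_apply, Finset.sum_smul, smul_eq_mul, mul_smul,
    Finset.smul_sum]
  exact Finset.sum_comm

theorem slice_idTensor {n : ℕ} (M : Matrix (Fin n → Fin 4) (Fin n → Fin 4) ℂ)
    (u : (Fin (n + 1) → Fin 4) → ℂ) (y : Fin 4) :
    slice y (idTensor M *ᵥ u) = M *ᵥ slice y u := by
  funext w
  simp [slice, Matrix.mulVec, dotProduct, sum_words, idTensor]

theorem slice_braid12 {n : ℕ} (u : (Fin (n + 2) → Fin 4) → ℂ) (y z : Fin 4) :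
    slice z (slice y (braid12 q n *ᵥ u)) =
      ∑ p : Fin 4 × Fin 4, braiding q (y, z) p • slice p.2 (slice p.1 u) := by
  funext w
  simp [slice, Matrix.mulVec, dotProduct, sum_words, braid12, Fintype.sum_prod_type,
    Finset.sum_apply, Fin.tail_cons]

theorem der_oneV (y : Fin 4) : der q y oneV = 0 := by
  refine V_ext ?_
  fin_cases y <;> simp [der, dera, derb, derc, derd, oneV]

/-- The braided integer computes the partial derivatives of a product. -/
theorem der_ofTensor (hq : q ≠ 0) {n : ℕ} (u : (Fin (n + 1) → Fin 4) → ℂ) (y : Fin 4) :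
    der q y (ofTensor q u) = ofTensor q (slice y (braidedInt q (n + 1) *ᵥ u)) := by
  have step : ∀ {m : ℕ} (u : (Fin (m + 1) → Fin 4) → ℂ) (y : Fin 4), der q y (ofTensor q u) =
      ofTensor q (slice y u) - ∑ z, leftE q z (∑ p : Fin 4 × Fin 4,
        braiding q (y, z) p • der q p.2 (ofTensor q (slice p.1 u))) := by
    intro m u y
    rw [ofTensor_succ, map_sum]
    simp only [← Module.End.mul_apply, der_mul_leftE hq, LinearMap.sub_apply,
      Finset.sum_sub_distrib]
    congr 1
    · rw [Finset.sum_eq_single y]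
      · simp
      · intro x _ hx
        simp [hx.symm]
      · simp
    · simp only [LinearMap.sum_apply, LinearMap.smul_apply, Module.End.mul_apply, map_sum,
        map_smul, Fintype.sum_prod_type]
      symm
      rw [Finset.sum_comm]
      refine Finset.sum_congr rfl fun x _ => ?_
      rw [Finset.sum_comm]
  induction n generalizing y with
  | zero =>
    rw [step]
    simp only [braidedInt, Matrix.one_mulVec]
    simp [ofTensor, word_zero, der_oneV]
  | succ n ih =>
    rw [step, show braidedInt q (n + 1 + 1) = 1 - braid12 q n * idTensor (braidedInt q (n + 1))
      from rfl, Matrix.sub_mulVec, Matrix.one_mulVec, ← Matrix.mulVec_mulVec]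
    rw [show ∀ a b : (Fin (n + 2) → Fin 4) → ℂ, slice y (a - b) = slice y a - slice y b
      from fun _ _ => rfl, ofTensor_sub]
    congr 1
    rw [ofTensor_succ]
    simp only [slice_braid12, ofTensor_sum_smul, slice_idTensor, ih]

/-- A form without constant term whose partial derivatives all vanish is zero. -/
theorem eq_zero_of_der_eq_zero {v : V} (h0 : v 0 = 0) (h : ∀ y, der q y v = 0) : v = 0 := by
  have key : ∀ y i, der q y v i = 0 := fun y i => by rw [h y]; rfl
  have a0 := key 0 0
  have a2 := key 0 2
  have a3 := key 0 3
  have a4 := key 0 4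
  have a8 := key 0 8
  have a9 := key 0 9
  have a10 := key 0 10
  have a14 := key 0 14
  have b0 := key 1 0
  have b3 := key 1 3
  have b4 := key 1 4
  have b10 := key 1 10
  have c0 := key 2 0
  have c4 := key 2 4
  have d0 := key 3 0
  simp only [der, dera, derb, derc, derd, Matrix.cons_val, LinearMap.pi_apply,
    LinearMap.proj_apply] at a0 a2 a3 a4 a8 a9 a10 a14 b0 b3 b4 b10 c0 c4 d0
  exact V_ext (by simp only [*, Pi.zero_apply, and_self])

/-- By induction on the degree: `A_{n + 1} = (id ⊗ A_n) [n + 1]`, and the braided integer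
`[n + 1]` computes the partial derivatives, which are killed by `A_n`. -/
theorem ofTensor_eq_zero (hq : q ≠ 0) {n : ℕ} (u : (Fin n → Fin 4) → ℂ)
    (hu : braidedFactorial q n *ᵥ u = 0) : ofTensor q u = 0 := by
  induction n with
  | zero =>
    rw [show braidedFactorial q 0 = 1 from rfl, Matrix.one_mulVec] at hu
    simp [hu, ofTensor]
  | succ n ih =>
    refine eq_zero_of_der_eq_zero (q := q) ?_ fun y => ?_
    · rw [ofTensor_succ, Finset.sum_apply]
      exact Finset.sum_eq_zero fun x _ => by
        fin_cases x <;> simp [leftE, La, Lb, Lc, Ld]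
    · rw [der_ofTensor hq]
      refine ih _ ?_
      rw [← slice_idTensor, Matrix.mulVec_mulVec]
      exact congrArg (slice y) hu

/-- The unit generates the model under right multiplication. As right multiplications commute with
left ones, an operator built from left multiplications is zero when it kills the unit. -/
theorem V_cyclic (S : Submodule ℂ V) (h1 : oneV ∈ S)
    (hS : ∀ x, ∀ v ∈ S, rightE q x v ∈ S) : S = ⊤ := by
  have a := hS 0 _ h1
  have b := hS 1 _ h1
  have c := hS 2 _ h1
  have d := hS 3 _ h1
  have ab := hS 1 _ a
  have ac := hS 2 _ a
  have ad := hS 3 _ a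
  have bc := hS 2 _ b
  have bd := hS 3 _ b
  have cd := hS 3 _ c
  have abc := hS 2 _ ab
  have abd := hS 3 _ ab
  have acd := hS 3 _ ac
  have bcd := hS 3 _ bc
  have abcd := hS 3 _ abc
  rw [Submodule.eq_top_iff']
  intro v
  have key : v = v 0 • oneV + v 1 • rightE q 0 oneV + v 2 • rightE q 1 oneV +
      v 3 • rightE q 2 oneV + v 4 • rightE q 3 oneV + v 5 • rightE q 1 (rightE q 0 oneV) +
      v 6 • rightE q 2 (rightE q 0 oneV) + v 7 • rightE q 3 (rightE q 0 oneV) +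
      v 8 • rightE q 2 (rightE q 1 oneV) + v 9 • rightE q 3 (rightE q 1 oneV) +
      v 10 • rightE q 3 (rightE q 2 oneV) +
      v 11 • rightE q 2 (rightE q 1 (rightE q 0 oneV)) +
      v 12 • rightE q 3 (rightE q 1 (rightE q 0 oneV)) +
      v 13 • rightE q 3 (rightE q 2 (rightE q 0 oneV)) +
      v 14 • rightE q 3 (rightE q 2 (rightE q 1 oneV)) +
      v 15 • rightE q 3 (rightE q 2 (rightE q 1 (rightE q 0 oneV))) :=
    V_ext (by simp [rightE, Ra, Rb, Rc, Rd, oneV])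
  rw [key]
  have sm : ∀ (z : ℂ) {x : V}, x ∈ S → z • x ∈ S := fun z _ hx => S.smul_mem z hx
  repeat' first | exact sm _ ‹_› | refine S.add_mem ?_ ?_

/-- `ker A_n` acts by zero on the model of `Λ`. -/
theorem sum_word_leftE_eq_zero (hq : q ≠ 0) {n : ℕ} (u : (Fin n → Fin 4) → ℂ)
    (hu : braidedFactorial q n *ᵥ u = 0) : ∑ w, u w • word (leftE q) w = 0 := by
  have hR : ∀ x, ∀ w : Fin n → Fin 4, Commute (word (leftE q) w) (rightE q x) := fun x w =>
    Commute.list_prod_left _ _ fun y hy => by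
      obtain ⟨i, rfl⟩ := List.mem_ofFn.1 hy
      exact leftE_mul_rightE hq _ _
  have key := V_cyclic (q := q) (LinearMap.ker (∑ w, u w • word (leftE q) w))
    (by simpa [ofTensor] using ofTensor_eq_zero hq u hu) (fun x v hv => by
      have hc : Commute (∑ w, u w • word (leftE q) w) (rightE q x) :=
        Commute.sum_left _ _ _ fun w _ => (hR x w).smul_left _
      rw [LinearMap.mem_ker] at hv ⊢
      rw [← Module.End.mul_apply, hc.eq, Module.End.mul_apply, hv, map_zero])
  exact LinearMap.ker_eq_top.1 key
end

/-! ### The relations of `Λ` -/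

section
variable {q : ℂ}

/-- A tensor of degree two fixed by the braiding gives a relation of `Λ`. -/
theorem quadratic_rel (u : Fin 4 → Fin 4 → ℂ)
    (hu : ∀ y z, ∑ x, ∑ f, braiding q (y, z) (x, f) * u x f = u y z) :
    ∑ x, ∑ y, u x y • (invE q x * invE q y) = 0 := by
  have hk : braidedFactorial q 2 *ᵥ (fun w : Fin 2 → Fin 4 => u (w 0) (w 1)) = 0 := by
    rw [braidedFactorial_two, Matrix.sub_mulVec, Matrix.one_mulVec, sub_eq_zero]
    funext w
    rw [← hu (w 0) (w 1)]
    simp only [Matrix.mulVec, dotProduct]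
    rw [← (piFinTwoEquiv fun _ => Fin 4).symm.sum_comp, Fintype.sum_prod_type]
    simp [braid12_zero]
  have key : InvForms.mk q (∑ w : Fin 2 → Fin 4,
      u (w 0) (w 1) • word (FreeAlgebra.ι ℂ : Fin 4 → FreeAlgebra ℂ (Fin 4)) w) =
      InvForms.mk q 0 :=
    RingQuot.mkAlgHom_rel ℂ (FormRel.ker (n := 2) _ hk)
  rw [map_zero, ← (piFinTwoEquiv fun _ => Fin 4).symm.sum_comp, Fintype.sum_prod_type] at key
  rw [← key]
  simp [word, List.ofFn_succ, invE]

set_option maxHeartbeats 1000000 in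
/-- The braiding on `Λ¹ ⊗ Λ¹` in coordinates. -/
theorem braiding_sum (hq : q ≠ 0) (u : Fin 4 → Fin 4 → ℂ) (y z : Fin 4) :
    ∑ x, ∑ f, braiding q (y, z) (x, f) * u x f =
      (![![u 0 0,
          q⁻¹ ^ 2 * u 1 0,
          q ^ 2 * u 2 0,
          u 3 0],
        ![u 0 1 + mu q * u 1 0,
          u 1 1,
          -(mu q * u 0 0) + u 2 1 + mu q * u 3 0,
          -(q⁻¹ ^ 2 * mu q * u 1 0) + u 3 1],
        ![u 0 2 - q ^ 2 * mu q * u 2 0,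
          mu q * u 0 0 + u 1 2 - mu q * u 3 0,
          u 2 2,
          mu q * u 2 0 + u 3 2],
        ![q ^ 2 * mu q ^ 2 * u 0 0 + u 0 3 + q ^ 2 * mu q * u 1 2 -
            q ^ 2 * mu q * u 2 1 - q ^ 2 * mu q ^ 2 * u 3 0,
          q ^ 2 * mu q * u 0 1 + q ^ 2 * u 1 3 - q ^ 2 * mu q * u 3 1,
          -(mu q * u 0 2) + mu q ^ 2 * (q ^ 2 + 1) * u 2 0 + q⁻¹ ^ 2 * u 2 3 + mu q * u 3 2,
          -(mu q ^ 2 * u 0 0) - mu q * u 1 2 + mu q * u 2 1 + mu q ^ 2 * u 3 0 + u 3 3]] :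
        Fin 4 → Fin 4 → ℂ) y z := by
  simp only [Fin.sum_univ_four]
  fin_cases y <;> fin_cases z <;>
    simp only [braiding, row, col, act, actS, actA, actB, actC, actD, Matrix.mul_apply,
      Fin.sum_univ_four, Matrix.of_apply, Matrix.neg_apply, Matrix.smul_apply, smul_eq_mul,
      Matrix.cons_val, Fin.reduceFinMk, Fin.zero_eta, Fin.mk_one, Fin.isValue, zero_mul, mul_zero,
      zero_add, add_zero, one_mul, mul_one, neg_zero, neg_mul] <;>
    (first | ring1 | ((try simp only [mu]) <;> field_simp <;> ring1))

set_option maxHeartbeats 2000000 in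
theorem inv_relations (hq : q ≠ 0) :
    (invE q 1 * invE q 1 = 0 ∧ invE q 2 * invE q 2 = 0 ∧ invE q 3 * invE q 3 = 0) ∧
    (invE q 0 * invE q 0 = mu q • (invE q 1 * invE q 2) ∧
    invE q 1 * invE q 0 = -(q⁻¹ ^ 2 • (invE q 0 * invE q 1)) +
      (q⁻¹ ^ 2 * mu q) • (invE q 1 * invE q 3) ∧
    invE q 2 * invE q 0 = -(q ^ 2 • (invE q 0 * invE q 2)) - mu q • (invE q 2 * invE q 3) ∧
    invE q 3 * invE q 0 = -(invE q 0 * invE q 3) - mu q • (invE q 1 * invE q 2)) ∧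
    (invE q 2 * invE q 1 = -(invE q 1 * invE q 2) ∧
    invE q 3 * invE q 1 = -(invE q 1 * invE q 3) ∧
    invE q 3 * invE q 2 = -(invE q 2 * invE q 3)) := by
  have rel : ∀ u : Matrix (Fin 4) (Fin 4) ℂ,
      (∀ y z, ∑ x, ∑ f, braiding q (y, z) (x, f) * u x f = u y z) →
      ∑ x, ∑ y, u x y • (invE q x * invE q y) = 0 := fun u => quadratic_rel u
  -- The ten matrices are a basis of the tensors of degree two fixed by the braiding.
  have bb := rel !![0, 0, 0, 0; 0, 1, 0, 0; 0, 0, 0, 0; 0, 0, 0, 0] ?_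
  have cc := rel !![0, 0, 0, 0; 0, 0, 0, 0; 0, 0, 1, 0; 0, 0, 0, 0] ?_
  have dd := rel !![0, 0, 0, 0; 0, 0, 0, 0; 0, 0, 0, 0; 0, 0, 0, 1] ?_
  have aa := rel !![1, 0, 0, 0; 0, 0, -mu q, 0; 0, 0, 0, 0; 0, 0, 0, 0] ?_
  have ba := rel !![0, q⁻¹ ^ 2, 0, 0; 1, 0, 0, -(q⁻¹ ^ 2 * mu q); 0, 0, 0, 0; 0, 0, 0, 0] ?_
  have ca := rel !![0, 0, q ^ 2, 0; 0, 0, 0, 0; 1, 0, 0, mu q; 0, 0, 0, 0] ?_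
  have da := rel !![0, 0, 0, 1; 0, 0, mu q, 0; 0, 0, 0, 0; 1, 0, 0, 0] ?_
  have cb := rel !![0, 0, 0, 0; 0, 0, 1, 0; 0, 1, 0, 0; 0, 0, 0, 0] ?_
  have db := rel !![0, 0, 0, 0; 0, 0, 0, 1; 0, 0, 0, 0; 0, 1, 0, 0] ?_
  have dc := rel !![0, 0, 0, 0; 0, 0, 0, 0; 0, 0, 0, 1; 0, 0, 1, 0] ?_
  · simp [Fin.sum_univ_four] at bb cc dd aa ba ca da cb db dc
    refine ⟨⟨bb, cc, dd⟩, ⟨?_, ?_, ?_, ?_⟩, ?_, ?_, ?_⟩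
    · exact sub_eq_zero.1 (Eq.trans (by module) aa)
    · exact sub_eq_zero.1 (Eq.trans (by module) ba)
    · exact sub_eq_zero.1 (Eq.trans (by module) ca)
    · exact sub_eq_zero.1 (Eq.trans (by module) da)
    · exact sub_eq_zero.1 (Eq.trans (by module) cb)
    · exact sub_eq_zero.1 (Eq.trans (by module) db)
    · exact sub_eq_zero.1 (Eq.trans (by module) dc)
  all_goals
    intro y z
    refine (braiding_sum hq _ y z).trans ?_
    fin_cases y <;> fin_cases z <;> simp only [Matrix.of_apply, Matrix.cons_val, Fin.zero_eta,
      Fin.mk_one, Fin.reduceFinMk, Fin.isValue, mul_zero, mul_one, add_zero, zero_add, sub_zero,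
      neg_zero] <;>
      (first | ring1 | ((try simp only [mu]) <;> field_simp <;> ring1))
end

/-! ### Monomial bases -/

section
variable (q : ℂ)

/-- The ordered monomials in `e_a, e_b, e_c, e_d`, numbered as the basis of `V`. -/
def invBasis : Fin 16 → InvForms q :=
  ![1, invE q 0, invE q 1, invE q 2, invE q 3, invE q 0 * invE q 1, invE q 0 * invE q 2,
    invE q 0 * invE q 3, invE q 1 * invE q 2, invE q 1 * invE q 3, invE q 2 * invE q 3,
    invE q 0 * invE q 1 * invE q 2, invE q 0 * invE q 1 * invE q 3, invE q 0 * invE q 2 * invE q 3,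
    invE q 1 * invE q 2 * invE q 3, invE q 0 * invE q 1 * invE q 2 * invE q 3]

/-- The element of `Λ` with given coordinates. -/
def invRec : V →ₗ[ℂ] InvForms q := Fintype.linearCombination ℂ (invBasis q)

theorem invRec_apply (v : V) : invRec q v = ∑ l, v l • invBasis q l :=
  Fintype.linearCombination_apply ℂ _ _

variable {q}

theorem sum_sixteen {M : Type} [AddCommMonoid M] (f : Fin 16 → M) : ∑ l, f l =
    f 0 + f 1 + f 2 + f 3 + f 4 + f 5 + f 6 + f 7 + f 8 + f 9 + f 10 + f 11 + f 12 + f 13 + f 14 +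
      f 15 := by
  simp only [Fin.sum_univ_castSucc, Fin.sum_univ_zero, zero_add]
  rfl

set_option maxHeartbeats 2000000 in
/-- The ordered monomials reduce products in `Λ` as in the model. -/
theorem invE_mul_invRec (hq : q ≠ 0) (x : Fin 4) (v : V) :
    invE q x * invRec q v = invRec q (leftE q x v) := by
  obtain ⟨⟨bb, cc, dd⟩, ⟨aa, ba, ca, da⟩, cb, db, dc⟩ := inv_relations hq
  have assoc : ∀ {x y z : InvForms q}, x * y = z → ∀ u, x * (y * u) = z * u := fun h u => by
    rw [← mul_assoc, h]
  simp only [invRec_apply, sum_sixteen, mul_add, mul_smul_comm]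
  fin_cases x <;>
  · simp [leftE, La, Lb, Lc, Ld, invBasis, add_mul, sub_mul, mul_assoc,
      bb, cc, dd, aa, ba, ca, da, cb, db, dc, assoc bb, assoc cc, assoc aa, assoc ba,
      assoc ca, assoc da, assoc cb, assoc db, assoc dc, -mul_eq_mul_left_iff]
    try (match_scalars <;> ring1)
end

section
variable {r : ℕ} (χ : AddChar (ZMod r) ℂ)

/-- The coordinate functions in `A`. -/
def coord (q : ℂ) (r : ℕ) (i j : Fin 2) : CoordAlg q r := CoordAlg.mk q r (FreeAlgebra.ι ℂ (i, j))

theorem isCoord_coord (q : ℂ) (r : ℕ) : IsCoord q r (coord q r) := by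
  have key : ∀ {x y}, CoordRel q r (fun i j => FreeAlgebra.ι ℂ ((i, j) : Fin 2 × Fin 2)) x y →
      CoordAlg.mk q r x = CoordAlg.mk q r y := fun h => RingQuot.mkAlgHom_rel ℂ h
  rintro _ _ (_ | _)
  · simpa only [coord, map_mul, map_smul] using key .ba
  · simpa only [coord, map_mul, map_smul] using key .ca
  · simpa only [coord, map_mul, map_smul] using key .db
  · simpa only [coord, map_mul, map_smul] using key .dc
  · simpa only [coord, map_mul, map_smul] using key .cb
  · simpa only [coord, map_mul, map_smul, map_sub] using key .da
  · simpa only [coord, map_mul, map_smul, map_sub, map_one] using key .qdet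
  · simpa only [coord, map_pow, map_one] using key .a_pow
  · simpa only [coord, map_pow, map_zero] using key .b_pow
  · simpa only [coord, map_pow, map_zero] using key .c_pow
  · simpa only [coord, map_pow, map_one] using key .d_pow

/-- The monomials `a ^ i b ^ j c ^ k`. -/
def mono (q : ℂ) (r : ℕ) (i j k : ZMod r) : CoordAlg q r :=
  coord q r 0 0 ^ i.val * coord q r 0 1 ^ j.val * coord q r 1 0 ^ k.val

/-- The element of `A` with given coordinates. -/
def coordRec (q : ℂ) (r : ℕ) [NeZero r] : Fam r ℂ →ₗ[ℂ] CoordAlg q r where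
  toFun f := ∑ i, ∑ j, ∑ k, f i j k • mono q r i j k
  map_add' f g := by simp only [Pi.add_apply, add_smul, Finset.sum_add_distrib]
  map_smul' c f := by
    simp only [Pi.smul_apply, smul_eq_mul, mul_smul, Finset.smul_sum, RingHom.id_apply]

theorem coordRec_apply (q : ℂ) (r : ℕ) [NeZero r] (f : Fam r ℂ) :
    coordRec q r f = ∑ i, ∑ j, ∑ k, f i j k • mono q r i j k := rfl

theorem pow_val_add_one {R : Type} [Monoid R] [NeZero r] [Fact (1 < r)] {x : R}
    (hx : x ^ r = 1) (i : ZMod r) :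
    x ^ (i + 1).val = x * x ^ i.val := by
  rw [ZMod.val_add, ZMod.val_one, ← pow_eq_pow_mod _ hx, pow_succ']

theorem ite_pow_val_add_one {R : Type} [Ring R] [NeZero r] [Fact (1 < r)] {x : R} (hx : x ^ r = 0)
    (i : ZMod r) : (if i + 1 = 0 then 0 else x ^ (i + 1).val) = x * x ^ i.val := by
  have hlt := i.val_lt
  have h1 : (i + 1).val = (i.val + 1) % r := by rw [ZMod.val_add, ZMod.val_one]
  rw [← pow_succ']
  split_ifs with h
  · have : r ∣ i.val + 1 := Nat.dvd_of_mod_eq_zero (by rw [← h1, h, ZMod.val_zero])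
    have : i.val + 1 = r := le_antisymm hlt (Nat.le_of_dvd (by omega) this)
    rw [this, hx]
  · rw [h1, Nat.mod_eq_of_lt]
    rcases Nat.lt_or_ge (i.val + 1) r with h' | h'
    · exact h'
    · exfalso
      apply h
      rw [← ZMod.val_eq_zero, h1, le_antisymm hlt h', Nat.mod_self]

theorem chi_eq_pow (i : ZMod r) [NeZero r] : χ i = χ 1 ^ i.val := by
  rw [← AddChar.map_nsmul_eq_pow, nsmul_one, ZMod.natCast_zmod_val]

theorem sum_shift [NeZero r] {M : Type} [AddCommMonoid M] (f : ZMod r → M) :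
    ∑ i, f i = ∑ i, f (i + 1) :=
  (Equiv.sum_comp (Equiv.addRight (1 : ZMod r)) f).symm

/-- Induction over the algebra `A`. -/
theorem coordAlg_induction {q : ℂ} {p : CoordAlg q r → Prop} (h0 : ∀ z, p (algebraMap ℂ _ z))
    (h1 : ∀ i j, p (coord q r i j)) (hm : ∀ x y, p x → p y → p (x * y))
    (ha : ∀ x y, p x → p y → p (x + y)) (x : CoordAlg q r) : p x := by
  obtain ⟨f, rfl⟩ : ∃ f, CoordAlg.mk q r f = x := RingQuot.mkAlgHom_surjective ℂ _ x
  induction f using FreeAlgebra.induction with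
  | grade0 z => rw [AlgHom.commutes]; exact h0 z
  | grade1 g => exact h1 g.1 g.2
  | mul f g hf hg => rw [map_mul]; exact hm _ _ hf hg
  | add f g hf hg => rw [map_add]; exact ha _ _ hf hg

/-- Induction over the algebra `Λ`. -/
theorem invForms_induction {q : ℂ} {p : InvForms q → Prop} (h0 : ∀ z, p (algebraMap ℂ _ z))
    (h1 : ∀ x, p (invE q x)) (hm : ∀ x y, p x → p y → p (x * y))
    (ha : ∀ x y, p x → p y → p (x + y)) (x : InvForms q) : p x := by
  obtain ⟨f, rfl⟩ : ∃ f, InvForms.mk q f = x := RingQuot.mkAlgHom_surjective ℂ _ x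
  induction f using FreeAlgebra.induction with
  | grade0 z => rw [AlgHom.commutes]; exact h0 z
  | grade1 g => exact h1 g
  | mul f g hf hg => rw [map_mul]; exact hm _ _ hf hg
  | add f g hf hg => rw [map_add]; exact ha _ _ hf hg

/-- `d = a⁻¹ (1 + q⁻¹ b c)`. -/
theorem IsCoord.d_eq {R : Type} [Ring R] [Algebra ℂ R] [NeZero r] {q : ℂ}
    {t : Fin 2 → Fin 2 → R} (ht : IsCoord q r t) :
    t 1 1 = t 0 0 ^ (r - 1) * (1 + q⁻¹ • (t 0 1 * t 1 0)) := by
  rw [← sub_eq_iff_eq_add.1 (ht _ _ .qdet), ← mul_assoc, ← pow_succ,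
    Nat.sub_add_cancel (NeZero.one_le), ht _ _ .a_pow, one_mul]

variable [NeZero r] [Fact (1 < r)]

theorem coordRec_opA (f : Fam r ℂ) :
    coordRec (χ 1) r (opA f) = coord (χ 1) r 0 0 * coordRec (χ 1) r f := by
  have ha := isCoord_coord (χ 1) r _ _ .a_pow
  rw [coordRec_apply, sum_shift, coordRec_apply]
  simp only [opA_apply, add_sub_cancel_right, Finset.mul_sum, mul_smul_comm,
    mono, pow_val_add_one ha, mul_assoc]

theorem coordRec_opB (f : Fam r ℂ) :
    coordRec (χ 1) r (opB χ f) = coord (χ 1) r 0 1 * coordRec (χ 1) r f := by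
  have hba := isCoord_coord (χ 1) r _ _ .ba
  have hb := isCoord_coord (χ 1) r _ _ .b_pow
  simp only [coordRec_apply, Finset.mul_sum, mul_smul_comm]
  refine Finset.sum_congr rfl fun i _ => ?_
  rw [sum_shift]
  refine Finset.sum_congr rfl fun j _ => Finset.sum_congr rfl fun k _ => ?_
  simp only [opB_apply, add_sub_cancel_right, mono]
  have key : coord (χ 1) r 0 1 *
      (coord (χ 1) r 0 0 ^ i.val * coord (χ 1) r 0 1 ^ j.val * coord (χ 1) r 1 0 ^ k.val) =
      χ i • (coord (χ 1) r 0 0 ^ i.val * (coord (χ 1) r 0 1 * coord (χ 1) r 0 1 ^ j.val) *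
        coord (χ 1) r 1 0 ^ k.val) := by
    simp only [← mul_assoc, mul_pow_qcomm hba, smul_mul_assoc, ← chi_eq_pow]
  rw [key, ← ite_pow_val_add_one hb]
  split_ifs
  · simp
  · simp [smul_smul, mul_comm]

theorem coordRec_opC (f : Fam r ℂ) :
    coordRec (χ 1) r (opC χ f) = coord (χ 1) r 1 0 * coordRec (χ 1) r f := by
  have hca := isCoord_coord (χ 1) r _ _ .ca
  have hcb : Commute (coord (χ 1) r 1 0) (coord (χ 1) r 0 1) := isCoord_coord (χ 1) r _ _ .cb
  have hc := isCoord_coord (χ 1) r _ _ .c_pow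
  simp only [coordRec_apply, Finset.mul_sum, mul_smul_comm]
  refine Finset.sum_congr rfl fun i _ => Finset.sum_congr rfl fun j _ => ?_
  rw [sum_shift]
  refine Finset.sum_congr rfl fun k _ => ?_
  simp only [opC_apply, add_sub_cancel_right, mono]
  have key : coord (χ 1) r 1 0 *
      (coord (χ 1) r 0 0 ^ i.val * coord (χ 1) r 0 1 ^ j.val * coord (χ 1) r 1 0 ^ k.val) =
      χ i • (coord (χ 1) r 0 0 ^ i.val * coord (χ 1) r 0 1 ^ j.val *
        (coord (χ 1) r 1 0 * coord (χ 1) r 1 0 ^ k.val)) := by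
    simp only [← mul_assoc, mul_pow_qcomm hca, smul_mul_assoc, ← chi_eq_pow]
    rw [mul_assoc (_ ^ i.val), (hcb.pow_right j.val).eq, ← mul_assoc]
  rw [key, ← ite_pow_val_add_one hc]
  split_ifs
  · simp
  · simp [smul_smul, mul_comm]

/-! ### The action of `A` and `Λ` on their models -/

/-- The regular representation of `A` in coordinates. -/
def coordRep (hχ : IsPrimitiveRoot (χ 1 ^ 2) r) :
    CoordAlg (χ 1) r →ₐ[ℂ] Module.End ℂ (Fam r ℂ) :=
  RingQuot.liftAlgHom ℂ ⟨FreeAlgebra.lift ℂ fun p : Fin 2 × Fin 2 => tau χ p.1 p.2, fun _ _ h =>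
    isCoord_tau χ hχ _ _ (coordRel_map (χ 1) r _ (fun i j => by simp) h)⟩

theorem coordRep_coord (hχ : IsPrimitiveRoot (χ 1 ^ 2) r) (i j : Fin 2) :
    coordRep χ hχ (coord (χ 1) r i j) = tau χ i j :=
  (RingQuot.liftAlgHom_mkAlgHom_apply ℂ _ _ _).trans (by simp)

theorem coordRec_coordRep (hχ : IsPrimitiveRoot (χ 1 ^ 2) r) (h : CoordAlg (χ 1) r) (f : Fam r ℂ) :
    coordRec (χ 1) r (coordRep χ hχ h f) = h * coordRec (χ 1) r f := by
  have hA := coordRec_opA (r := r) χ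
  have hB := coordRec_opB (r := r) χ
  have hC := coordRec_opC (r := r) χ
  induction h using coordAlg_induction generalizing f with
  | h0 z =>
    rw [AlgHom.commutes, Module.algebraMap_end_apply, map_smul, Algebra.smul_def]
  | h1 i j =>
    rw [coordRep_coord]
    fin_cases i <;> fin_cases j
    · exact hA f
    · exact hB f
    · exact hC f
    · have hp : ∀ n f, coordRec (χ 1) r ((opA ^ n : Module.End ℂ (Fam r ℂ)) f) =
          coord (χ 1) r 0 0 ^ n * coordRec (χ 1) r f := by
        intro n
        induction n with
        | zero => simp
        | succ n ih =>
          intro f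
          rw [pow_succ', Module.End.mul_apply, hA, ih, pow_succ', mul_assoc]
      change coordRec (χ 1) r (tau χ 1 1 f) = coord (χ 1) r 1 1 * _
      rw [(isCoord_tau χ hχ).d_eq, (isCoord_coord (χ 1) r).d_eq]
      change coordRec (χ 1) r ((opA ^ (r - 1) : Module.End ℂ (Fam r ℂ))
        (f + (χ 1)⁻¹ • opB χ (opC χ f))) = _
      rw [hp, map_add, map_smul, hB, hC, mul_assoc, add_mul, one_mul, smul_mul_assoc, mul_assoc]
  | hm x y hx hy => rw [map_mul, Module.End.mul_apply, hx, hy, mul_assoc]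
  | ha x y hx hy => rw [map_add, LinearMap.add_apply, map_add, hx, hy, add_mul]

theorem eq_of_formRel_leftE {q : ℂ} (hq : q ≠ 0) {x y : Module.End ℂ V}
    (h : FormRel q (leftE q) x y) : x = y := by
  obtain ⟨v, hv⟩ := h
  exact sum_word_leftE_eq_zero hq v hv

/-- The representation of `Λ` on its model by left multiplication. -/
def invRep {q : ℂ} (hq : q ≠ 0) : InvForms q →ₐ[ℂ] Module.End ℂ V :=
  RingQuot.liftAlgHom ℂ ⟨FreeAlgebra.lift ℂ (leftE q), fun _ _ h =>
    eq_of_formRel_leftE hq (formRel_map q _ (fun x => by simp) h)⟩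

theorem invRep_invE {q : ℂ} (hq : q ≠ 0) (x : Fin 4) : invRep hq (invE q x) = leftE q x :=
  (RingQuot.liftAlgHom_mkAlgHom_apply ℂ _ _ _).trans (by simp)

theorem invRec_invRep {q : ℂ} (hq : q ≠ 0) (l : InvForms q) (v : V) :
    invRec q (invRep hq l v) = l * invRec q v := by
  induction l using invForms_induction generalizing v with
  | h0 z => rw [AlgHom.commutes, Module.algebraMap_end_apply, map_smul, Algebra.smul_def]
  | h1 x => rw [invRep_invE, invE_mul_invRec hq]
  | hm x y hx hy => rw [map_mul, Module.End.mul_apply, hx, hy, mul_assoc]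
  | ha x y hx hy => rw [map_add, LinearMap.add_apply, map_add, hx, hy, add_mul]

theorem invRec_oneV (q : ℂ) : invRec q oneV = 1 := by
  simp [invRec_apply, oneV, Pi.single_apply, invBasis]

/-- The elements of `Λ` are determined by their action on the unit of the model. -/
theorem invRec_invRep_oneV {q : ℂ} (hq : q ≠ 0) (l : InvForms q) :
    invRec q (invRep hq l oneV) = l := by
  rw [invRec_invRep, invRec_oneV, mul_one]

set_option maxHeartbeats 1000000 in
theorem invRep_invBasis {q : ℂ} (hq : q ≠ 0) (l : Fin 16) :
    invRep hq (invBasis q l) oneV = Pi.single l 1 := by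
  refine V_ext ?_
  fin_cases l <;>
    simp [invBasis, invRep_invE, leftE, La, Lb, Lc, Ld, oneV]

theorem invRep_invRec {q : ℂ} (hq : q ≠ 0) (v : V) : invRep hq (invRec q v) oneV = v := by
  rw [invRec_apply, map_sum, LinearMap.sum_apply]
  simp only [map_smul, LinearMap.smul_apply, invRep_invBasis]
  funext l
  simp [Finset.sum_apply, Pi.single_apply]
end

/-! ### The grading of `Λ` -/

/-- The degree of the basis elements of `V`. -/
def deg : Fin 16 → ℕ := ![0, 1, 1, 1, 1, 2, 2, 2, 2, 2, 2, 3, 3, 3, 3, 4]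

/-- Multiplication by a function of the degree. -/
def gradeV (c : ℕ → ℂ) : Module.End ℂ V := LinearMap.pi fun l => c (deg l) • co l

theorem gradeV_apply (c : ℕ → ℂ) (v : V) (l : Fin 16) : gradeV c v l = c (deg l) * v l := rfl

/-- The projection onto degree `n`. -/
def degProj (n : ℕ) : Module.End ℂ V := gradeV fun m => if m = n then 1 else 0

section
variable {q : ℂ}

set_option maxHeartbeats 1000000 in
theorem gradeV_leftE (c : ℕ → ℂ) (x : Fin 4) (v : V) :
    gradeV c (leftE q x v) = leftE q x (gradeV (fun n => c (n + 1)) v) := by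
  refine V_ext ?_
  simp only [gradeV_apply, deg]
  fin_cases x <;> simp [leftE, La, Lb, Lc, Ld, gradeV_apply, deg, -mul_eq_mul_left_iff]
  all_goals and_intros <;> ring1

set_option maxHeartbeats 1000000 in
theorem gradeV_rightE (c : ℕ → ℂ) (x : Fin 4) (v : V) :
    gradeV c (rightE q x v) = rightE q x (gradeV (fun n => c (n + 1)) v) := by
  refine V_ext ?_
  simp only [gradeV_apply, deg]
  fin_cases x <;> simp [rightE, Ra, Rb, Rc, Rd, gradeV_apply, deg, -mul_eq_mul_left_iff] <;>
    and_intros <;> ring1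

theorem gradeV_oneV (c : ℕ → ℂ) : gradeV c oneV = c 0 • oneV := by
  funext l
  by_cases h : l = 0 <;> simp [gradeV_apply, oneV, h, deg]

theorem word_invE_succ {n : ℕ} (w : Fin (n + 1) → Fin 4) :
    word (invE q) w = invE q (w 0) * word (invE q) (Fin.tail w) := by
  conv_lhs => rw [← Fin.cons_self_tail w]
  exact word_cons _ _ _

theorem gradeV_invRep (hq : q ≠ 0) {n : ℕ} {l : InvForms q} (hl : l ∈ invFormsDeg q n)
    (c : ℕ → ℂ) : gradeV c (invRep hq l oneV) = c n • invRep hq l oneV := by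
  induction hl using Submodule.span_induction with
  | mem l hl =>
    obtain ⟨w, rfl⟩ := hl
    induction n generalizing c with
    | zero => simpa [word] using gradeV_oneV c
    | succ n ih =>
      simp only at ih ⊢
      rw [word_invE_succ, map_mul, Module.End.mul_apply, invRep_invE, gradeV_leftE, ih, map_smul]
  | zero => simp
  | add a b _ _ ha hb => simp [ha, hb]
  | smul z a _ ha => rw [map_smul, LinearMap.smul_apply, map_smul, ha, smul_comm]

theorem invBasis_mem (l : Fin 16) : invBasis q l ∈ invFormsDeg q (deg l) := by
  have h0 : (1 : InvForms q) ∈ invFormsDeg q 0 :=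
    Submodule.subset_span ⟨Fin.elim0, by simp [word]⟩
  have h1 : ∀ x, invE q x ∈ invFormsDeg q 1 := fun x => by
    simpa using mul_invE_mem q h0 x
  fin_cases l
  · exact h0
  · exact h1 0
  · exact h1 1
  · exact h1 2
  · exact h1 3
  · exact mul_invE_mem q (h1 0) 1
  · exact mul_invE_mem q (h1 0) 2
  · exact mul_invE_mem q (h1 0) 3
  · exact mul_invE_mem q (h1 1) 2
  · exact mul_invE_mem q (h1 1) 3
  · exact mul_invE_mem q (h1 2) 3
  · exact mul_invE_mem q (mul_invE_mem q (h1 0) 1) 2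
  · exact mul_invE_mem q (mul_invE_mem q (h1 0) 1) 3
  · exact mul_invE_mem q (mul_invE_mem q (h1 0) 2) 3
  · exact mul_invE_mem q (mul_invE_mem q (h1 1) 2) 3
  · exact mul_invE_mem q (mul_invE_mem q (mul_invE_mem q (h1 0) 1) 2) 3

theorem degProj_eq_self_iff {n : ℕ} {v : V} : degProj n v = v ↔ ∀ l, deg l ≠ n → v l = 0 := by
  refine ⟨fun h l hl => ?_, fun h => funext fun l => ?_⟩
  · rw [← h]
    simp [degProj, gradeV_apply, hl]
  · by_cases hl : deg l = n <;> simp [degProj, gradeV_apply, hl, h l]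

theorem degProj_invRep (hq : q ≠ 0) {n : ℕ} {l : InvForms q} (hl : l ∈ invFormsDeg q n) :
    degProj n (invRep hq l oneV) = invRep hq l oneV := by
  rw [degProj, gradeV_invRep hq hl, if_pos rfl, one_smul]

theorem invRec_mem {n : ℕ} {v : V} (hv : degProj n v = v) : invRec q v ∈ invFormsDeg q n := by
  rw [invRec_apply]
  refine Submodule.sum_mem _ fun l _ => ?_
  by_cases hl : deg l = n
  · exact Submodule.smul_mem _ _ (hl ▸ invBasis_mem l)
  · rw [degProj_eq_self_iff.1 hv l hl, zero_smul]
    exact Submodule.zero_mem _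

theorem linearIndependent_invBasis (hq : q ≠ 0) : LinearIndependent ℂ (invBasis q) := by
  refine LinearIndependent.of_comp
    ((LinearMap.applyₗ oneV).comp (invRep hq).toLinearMap) ?_
  convert (Pi.basisFun ℂ (Fin 16)).linearIndependent using 1
  funext l
  simp [invRep_invBasis]

theorem invFormsDeg_eq_span (hq : q ≠ 0) (n : ℕ) : invFormsDeg q n =
    Submodule.span ℂ (Set.range fun l : {l : Fin 16 // deg l = n} => invBasis q l) := by
  refine le_antisymm (fun x hx => ?_) (Submodule.span_le.2 ?_)
  · rw [← invRec_invRep_oneV hq x, invRec_apply]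
    refine Submodule.sum_mem _ fun l _ => ?_
    by_cases hl : deg l = n
    · exact Submodule.smul_mem _ _ (Submodule.subset_span ⟨⟨l, hl⟩, rfl⟩)
    · rw [degProj_eq_self_iff.1 (degProj_invRep hq hx) l hl, zero_smul]
      exact Submodule.zero_mem _
  · rintro _ ⟨⟨l, rfl⟩, rfl⟩
    exact invBasis_mem l

/-- The ordered monomials of degree `n` are a basis of `Λⁿ`. -/
theorem finrank_invFormsDeg (hq : q ≠ 0) (n : ℕ) :
    Module.finrank ℂ (invFormsDeg q n) = Fintype.card {l : Fin 16 // deg l = n} := by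
  rw [invFormsDeg_eq_span hq]
  exact finrank_span_eq_card ((linearIndependent_invBasis hq).comp _ Subtype.val_injective)
end

/-! ### The exterior algebra on its monomial basis -/

section
variable {r : ℕ} {E : Type} [AddCommGroup E] [Module ℂ E]

/-- `id ⊗ g` for an endomorphism `g` of the coefficients. -/
def mapV : Module.End ℂ V →ₐ[ℂ] Module.End ℂ (Fam r V) where
  toFun g :=
    { toFun := fun f i j k => g (f i j k)
      map_add' := fun f f' => by funext i j k; exact map_add g _ _
      map_smul' := fun c f => by funext i j k; exact map_smul g _ _ }
  map_one' := rfl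
  map_mul' _ _ := rfl
  map_zero' := rfl
  map_add' _ _ := rfl
  commutes' _ := rfl

@[simp] theorem mapV_apply (g : Module.End ℂ V) (f : Fam r V) (i j k : ZMod r) :
    mapV g f i j k = g (f i j k) := rfl

/-- The family concentrated at `a ^ i b ^ j c ^ k` with coefficient `v`. -/
def single (i j k : ZMod r) (v : E) : Fam r E :=
  fun i' j' k' => if i' = i ∧ j' = j ∧ k' = k then v else 0

/-- The product of a family of scalars with a vector. -/
def tensor (f : Fam r ℂ) (v : V) : Fam r V := fun i j k => f i j k • v

theorem opA_single (i j k : ZMod r) (v : E) : opA (single i j k v) = single (i + 1) j k v := by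
  funext i' j' k'
  simp [single, sub_eq_iff_eq_add]

variable (χ : AddChar (ZMod r) ℂ)

theorem opB_single (i j k : ZMod r) (v : E) :
    opB χ (single i j k v) = if j + 1 = 0 then 0 else χ i • single i (j + 1) k v := by
  funext i' j' k'
  by_cases h : i' = i ∧ j' = j + 1 ∧ k' = k
  · obtain ⟨rfl, rfl, rfl⟩ := h
    by_cases h0 : j + 1 = 0 <;> simp [single, h0]
  · by_cases h0 : j + 1 = 0 <;> by_cases h1 : j' = 0 <;>
      simp [single, h0, h1, sub_eq_iff_eq_add] <;> simp_all

theorem opC_single (i j k : ZMod r) (v : E) :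
    opC χ (single i j k v) = if k + 1 = 0 then 0 else χ i • single i j (k + 1) v := by
  funext i' j' k'
  by_cases h : i' = i ∧ j' = j ∧ k' = k + 1
  · obtain ⟨rfl, rfl, rfl⟩ := h
    by_cases h0 : k + 1 = 0 <;> simp [single, h0]
  · by_cases h0 : k + 1 = 0 <;> by_cases h1 : k' = 0 <;>
      simp [single, h0, h1, sub_eq_iff_eq_add] <;> simp_all

theorem natCast_succ_ne_zero {n : ℕ} (hn : n + 1 < r) : (n : ZMod r) + 1 ≠ 0 := by
  intro h
  rw [← Nat.cast_succ, ZMod.natCast_eq_zero_iff] at h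
  exact absurd (Nat.le_of_dvd (Nat.succ_pos n) h) (by omega)

theorem opA_pow_single (n : ℕ) (j k : ZMod r) (v : E) :
    (opA ^ n : Module.End ℂ (Fam r E)) (single 0 j k v) = single n j k v := by
  induction n with
  | zero => simp
  | succ n ih => rw [pow_succ', Module.End.mul_apply, ih, opA_single, Nat.cast_succ]

theorem opB_pow_single {n : ℕ} (hn : n < r) (k : ZMod r) (v : E) :
    (opB χ ^ n : Module.End ℂ (Fam r E)) (single 0 0 k v) = single 0 n k v := by
  induction n with
  | zero => simp
  | succ n ih =>
    rw [pow_succ', Module.End.mul_apply, ih (by omega), opB_single,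
      if_neg (natCast_succ_ne_zero hn), AddChar.map_zero_eq_one, one_smul, Nat.cast_succ]

theorem opC_pow_single {n : ℕ} (hn : n < r) (v : E) :
    (opC χ ^ n : Module.End ℂ (Fam r E)) (single 0 0 0 v) = single 0 0 n v := by
  induction n with
  | zero => simp
  | succ n ih =>
    rw [pow_succ', Module.End.mul_apply, ih (by omega), opC_single,
      if_neg (natCast_succ_ne_zero hn), AddChar.map_zero_eq_one, one_smul, Nat.cast_succ]

theorem tau_tensor (i j : Fin 2) (f : Fam r ℂ) (v : V) :
    tau χ i j (tensor f v) = tensor (tau χ i j f) v := by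
  have hA : ∀ f : Fam r ℂ, opAinv (tensor f v) = tensor (opAinv f) v := fun f => rfl
  have hB : ∀ f : Fam r ℂ, opB χ (tensor f v) = tensor (opB χ f) v := fun f => by
    funext i j k
    by_cases h : j = 0 <;> simp [tensor, h, mul_smul]
  have hC : ∀ f : Fam r ℂ, opC χ (tensor f v) = tensor (opC χ f) v := fun f => by
    funext i j k
    by_cases h : k = 0 <;> simp [tensor, h, mul_smul]
  fin_cases i <;> fin_cases j
  · rfl
  · exact hB f
  · exact hC f
  · change opAinv (tensor f v) + (χ 1)⁻¹ • opAinv (opB χ (opC χ (tensor f v))) = _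
    rw [hC, hB, hA, hA]
    change _ = tensor (opAinv f + (χ 1)⁻¹ • opAinv (opB χ (opC χ f))) v
    funext i j k
    simp [tensor, add_smul, mul_smul]

theorem tau_mapV (i j : Fin 2) (g : Module.End ℂ V) :
    tau χ i j * mapV g = mapV g * tau χ i j := by
  have hA : (opAinv : Module.End ℂ (Fam r V)) * mapV g = mapV g * opAinv := rfl
  have hB : (opB χ : Module.End ℂ (Fam r V)) * mapV g = mapV g * opB χ := by
    ext1 f
    funext i j k
    by_cases h : j = 0 <;> simp [h]
  have hC : (opC χ : Module.End ℂ (Fam r V)) * mapV g = mapV g * opC χ := by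
    ext1 f
    funext i j k
    by_cases h : k = 0 <;> simp [h]
  fin_cases i <;> fin_cases j
  · rfl
  · exact hB
  · exact hC
  · change opD χ * mapV g = mapV g * opD χ
    rw [opD, add_mul, mul_add, hA, smul_mul_assoc, mul_smul_comm, mul_assoc, hC, ← mul_assoc,
      mul_assoc _ _ (mapV g), hB, ← mul_assoc, hA]
    simp only [mul_assoc]

theorem IsCoord.map {R S : Type} [Ring R] [Algebra ℂ R] [Ring S] [Algebra ℂ S] {q : ℂ}
    {t : Fin 2 → Fin 2 → R} (ht : IsCoord q r t) (f : R →ₐ[ℂ] S) :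
    IsCoord q r fun i j => f (t i j) := by
  have key : ∀ {x y}, CoordRel q r t x y → f x = f y := fun h => congrArg f (ht _ _ h)
  rintro _ _ (_ | _)
  · simpa only [map_mul, map_smul] using key .ba
  · simpa only [map_mul, map_smul] using key .ca
  · simpa only [map_mul, map_smul] using key .db
  · simpa only [map_mul, map_smul] using key .dc
  · simpa only [map_mul, map_smul] using key .cb
  · simpa only [map_mul, map_smul, map_sub] using key .da
  · simpa only [map_mul, map_smul, map_sub, map_one] using key .qdet
  · simpa only [map_pow, map_one] using key .a_pow
  · simpa only [map_pow, map_zero] using key .b_pow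
  · simpa only [map_pow, map_zero] using key .c_pow
  · simpa only [map_pow, map_one] using key .d_pow

/-- The action of `t^i_j` on `Λ ⊗ A`, through the coproduct. -/
def crossT (i j : Fin 2) : Module.End ℂ (Fam r V) :=
  mapV (rho (χ 1) i 0) * tau χ 0 j + mapV (rho (χ 1) i 1) * tau χ 1 j

/-- The action of the generators of `Ω` on `Λ ⊗ A`. -/
def genRep : Gen → Module.End ℂ (Fam r V)
  | .t i j => crossT χ i j
  | .e x => mapV (leftE (χ 1) x)

variable [NeZero r] [Fact (1 < r)]

/-- The action of `A` on `Λ ⊗ A` is the coproduct of its actions on the two factors. -/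
theorem isCoord_crossT (hr : 3 ≤ r) (hχ : IsPrimitiveRoot (χ 1 ^ 2) r) :
    IsCoord (χ 1) r (crossT χ) := by
  have h1 : χ 1 ^ r = 1 := by
    rw [← AddChar.map_nsmul_eq_pow]
    simp
  exact ((isCoord_rho (chi_ne_zero χ 1) hr h1).map mapV).coproduct (isCoord_tau χ hχ)
    (fun i j k l => tau_mapV χ i j _) hχ (NeZero.ne r)

theorem genRep_rel (hr : 3 ≤ r) (hχ : IsPrimitiveRoot (χ 1 ^ 2) r) {x y : FreeAlgebra ℂ Gen}
    (h : OmegaRel (χ 1) r x y) :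
    FreeAlgebra.lift ℂ (genRep χ) x = FreeAlgebra.lift ℂ (genRep χ) y := by
  have h0 := chi_ne_zero χ 1
  cases h with
  | coord h =>
    exact isCoord_crossT χ hr hχ _ _
      (coordRel_map (χ 1) r _ (fun i j => by simp [freeT, genRep]) h)
  | form h =>
    obtain ⟨v, hv⟩ := h
    have := congrArg (mapV (r := r)) (sum_word_leftE_eq_zero h0 v hv)
    simp only [map_sum, map_smul, map_zero] at this ⊢
    rw [← this]
    refine Finset.sum_congr rfl fun w _ => ?_
    rw [word_map (FreeAlgebra.lift ℂ (genRep χ)) (e' := fun x => mapV (leftE (χ 1) x))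
      (fun x => by simp [freeE, genRep]),
      word_map (mapV (r := r)) (e' := fun x => mapV (leftE (χ 1) x)) (fun x => rfl)]
  | cross i j x =>
    simp only [map_mul, map_sum, map_smul, freeT, freeE, FreeAlgebra.lift_ι_apply, genRep, crossT]
    have hmap : ∀ m, mapV (r := r) (rho (χ 1) i m) * mapV (leftE (χ 1) x) =
        ∑ k, (∑ y, act (χ 1) i k y x • mapV (leftE (χ 1) y)) * mapV (rho (χ 1) k m) := by
      intro m
      rw [← map_mul, rho_mul_leftE h0]
      simp only [map_mul, map_sum, map_smul]
    rw [add_mul, mul_assoc, mul_assoc, tau_mapV, tau_mapV, ← mul_assoc, ← mul_assoc, hmap, hmap]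
    simp only [Fin.sum_univ_two, mul_add, add_mul, mul_assoc]
    abel

/-- The representation of `Ω` on `Λ ⊗ A`, in coordinates. -/
def omegaRep (hr : 3 ≤ r) (hχ : IsPrimitiveRoot (χ 1 ^ 2) r) :
    Omega (χ 1) r →ₐ[ℂ] Module.End ℂ (Fam r V) :=
  RingQuot.liftAlgHom ℂ ⟨FreeAlgebra.lift ℂ (genRep χ), fun _ _ h => genRep_rel χ hr hχ h⟩
end

/-! ### Evaluation at the unit -/

section
variable {r : ℕ} (χ : AddChar (ZMod r) ℂ)

theorem rho_oneV (q : ℂ) (i j : Fin 2) : rho q i j oneV = if i = j then oneV else 0 := by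
  refine V_ext ?_
  fin_cases i <;> fin_cases j <;> simp [rho, rhoA, rhoB, rhoC, rhoD, oneV]

theorem ofCoord_coord (q : ℂ) (r : ℕ) (i j : Fin 2) :
    ofCoord q r (coord q r i j) = t q r i j := by
  rw [coord, ofCoord_mk, FreeAlgebra.lift_ι_apply]
  rfl

theorem tensor_mapV (g : Module.End ℂ V) (f : Fam r ℂ) (v : V) :
    mapV g (tensor f v) = tensor f (g v) := by
  funext i j k
  exact map_smul g _ _

theorem tensor_add_left (f g : Fam r ℂ) (v : V) : tensor (f + g) v = tensor f v + tensor g v := by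
  funext i j k
  exact add_smul _ _ _

theorem tensor_single (i j k : ZMod r) (v : V) : tensor (single i j k 1) v = single i j k v := by
  funext i' j' k'
  simp [tensor, single, ite_smul]

theorem coordRec_single [NeZero r] (q : ℂ) (i j k : ZMod r) :
    coordRec q r (single i j k 1) = mono q r i j k := by
  rw [coordRec_apply]
  simp only [single, ite_smul, one_smul, zero_smul, ite_and]
  simp [Finset.sum_ite_eq']

/-- The form with given coordinates. -/
def formRec (q : ℂ) (r : ℕ) [NeZero r] : Fam r V →ₗ[ℂ] Omega q r where
  toFun f := ∑ i, ∑ j, ∑ k, ofInv q r (invRec q (f i j k)) * ofCoord q r (mono q r i j k)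
  map_add' f g := by simp only [Pi.add_apply, map_add, add_mul, Finset.sum_add_distrib]
  map_smul' c f := by
    simp only [Pi.smul_apply, map_smul, smul_mul_assoc, Finset.smul_sum, RingHom.id_apply]

theorem formRec_apply (q : ℂ) [NeZero r] (f : Fam r V) : formRec q r f =
    ∑ i, ∑ j, ∑ k, ofInv q r (invRec q (f i j k)) * ofCoord q r (mono q r i j k) := rfl

theorem formRec_tensor (q : ℂ) [NeZero r] (f : Fam r ℂ) (v : V) :
    formRec q r (tensor f v) = ofInv q r (invRec q v) * ofCoord q r (coordRec q r f) := by
  simp only [formRec_apply, tensor, coordRec_apply, map_sum, map_smul, Finset.mul_sum,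
    mul_smul_comm, smul_mul_assoc]

theorem formRec_single (q : ℂ) [NeZero r] (i j k : ZMod r) (v : V) :
    formRec q r (single i j k v) = ofInv q r (invRec q v) * ofCoord q r (mono q r i j k) := by
  rw [← tensor_single, formRec_tensor, coordRec_single]

/-- The families of degree `n`. -/
def famDeg (r n : ℕ) : Submodule ℂ (Fam r V) :=
  LinearMap.eqLocus (mapV (degProj n)) LinearMap.id

theorem mem_famDeg {n : ℕ} {f : Fam r V} :
    f ∈ famDeg r n ↔ ∀ i j k, degProj n (f i j k) = f i j k :=
  ⟨fun h i j k => congrFun (congrFun (congrFun (show mapV (degProj n) f = f from h) i) j) k,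
    fun h => show mapV (degProj n) f = f from funext fun i => funext fun j => funext (h i j)⟩

theorem formRec_mem (q : ℂ) [NeZero r] {n : ℕ} {f : Fam r V} (hf : f ∈ famDeg r n) :
    formRec q r f ∈ forms q r n :=
  Submodule.sum_mem _ fun i _ => Submodule.sum_mem _ fun j _ => Submodule.sum_mem _ fun k _ =>
    Submodule.subset_span ⟨_, invRec_mem (mem_famDeg.1 hf i j k), _, rfl⟩

variable [NeZero r] [Fact (1 < r)] (hr : 3 ≤ r) (hχ : IsPrimitiveRoot (χ 1 ^ 2) r)

theorem coordRep_mono (i j k : ZMod r) :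
    coordRep χ hχ (mono (χ 1) r i j k) (single 0 0 0 1) = single i j k 1 := by
  simp only [mono, map_mul, map_pow, coordRep_coord, Module.End.mul_apply]
  change (opA ^ i.val : Module.End ℂ (Fam r ℂ)) ((opB χ ^ j.val : Module.End ℂ (Fam r ℂ))
    ((opC χ ^ k.val : Module.End ℂ (Fam r ℂ)) _)) = _
  rw [opC_pow_single χ k.val_lt, opB_pow_single χ j.val_lt, opA_pow_single]
  simp

theorem omegaRep_t (i j : Fin 2) : omegaRep χ hr hχ (t (χ 1) r i j) = crossT χ i j :=
  (RingQuot.liftAlgHom_mkAlgHom_apply ℂ _ _ _).trans (by simp [freeT, genRep])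

theorem omegaRep_e (x : Fin 4) : omegaRep χ hr hχ (e (χ 1) r x) = mapV (leftE (χ 1) x) :=
  (RingQuot.liftAlgHom_mkAlgHom_apply ℂ _ _ _).trans (by simp [freeE, genRep])

theorem omegaRep_ofInv (l : InvForms (χ 1)) :
    omegaRep χ hr hχ (ofInv (χ 1) r l) = mapV (invRep (chi_ne_zero χ 1) l) := by
  induction l using invForms_induction with
  | h0 z => simp only [AlgHom.commutes]
  | h1 x => rw [ofInv_invE, omegaRep_e, invRep_invE]
  | hm x y hx hy => simp only [map_mul, hx, hy]
  | ha x y hx hy => simp only [map_add, hx, hy]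

theorem omegaRep_ofCoord (h : CoordAlg (χ 1) r) (f : Fam r ℂ) :
    omegaRep χ hr hχ (ofCoord (χ 1) r h) (tensor f oneV) = tensor (coordRep χ hχ h f) oneV := by
  induction h using coordAlg_induction generalizing f with
  | h0 z =>
    simp only [AlgHom.commutes, Module.algebraMap_end_apply]
    funext i j k
    exact (smul_assoc z _ oneV).symm
  | h1 i j =>
    rw [ofCoord_coord, omegaRep_t, coordRep_coord, crossT]
    simp only [LinearMap.add_apply, Module.End.mul_apply, tau_tensor, tensor_mapV, rho_oneV]
    have h0 : ∀ g : Fam r ℂ, tensor g (0 : V) = 0 := fun g => by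
      funext i j k
      exact smul_zero _
    fin_cases i <;> simp [h0]
  | hm x y hx hy => simp only [map_mul, Module.End.mul_apply, hx, hy]
  | ha x y hx hy => simp only [map_add, LinearMap.add_apply, hx, hy, tensor_add_left]

/-- The coordinates of a form: its action on the unit. -/
def formCoord : Omega (χ 1) r →ₗ[ℂ] Fam r V :=
  (LinearMap.applyₗ (single 0 0 0 oneV)).comp (omegaRep χ hr hχ).toLinearMap

theorem formCoord_apply (ω : Omega (χ 1) r) :
    formCoord χ hr hχ ω = omegaRep χ hr hχ ω (single 0 0 0 oneV) := rfl

theorem formCoord_mul (l : InvForms (χ 1)) (h : CoordAlg (χ 1) r) :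
    formCoord χ hr hχ (ofInv (χ 1) r l * ofCoord (χ 1) r h) =
      tensor (coordRep χ hχ h (single 0 0 0 1)) (invRep (chi_ne_zero χ 1) l oneV) := by
  rw [formCoord_apply, map_mul, Module.End.mul_apply, ← tensor_single, omegaRep_ofCoord,
    omegaRep_ofInv, tensor_mapV]

theorem formRec_formCoord {n : ℕ} {ω : Omega (χ 1) r} (hω : ω ∈ forms (χ 1) r n) :
    formRec (χ 1) r (formCoord χ hr hχ ω) = ω := by
  induction hω using Submodule.span_induction with
  | mem ω hω =>
    obtain ⟨l, -, h, rfl⟩ := hω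
    have h1 : mono (χ 1) r 0 0 0 = 1 := by simp [mono]
    rw [formCoord_mul, formRec_tensor, invRec_invRep_oneV, coordRec_coordRep, coordRec_single, h1,
      mul_one]
  | zero => simp
  | add a b _ _ ha hb => rw [map_add, map_add, ha, hb]
  | smul z a _ ha => rw [map_smul, map_smul, ha]

theorem formCoord_formRec (f : Fam r V) : formCoord χ hr hχ (formRec (χ 1) r f) = f := by
  simp only [formRec_apply, map_sum, formCoord_mul, coordRep_mono, invRep_invRec, tensor_single]
  funext i j k
  simp only [Finset.sum_apply, single, ite_and]
  simp

theorem formCoord_mem {n : ℕ} {ω : Omega (χ 1) r} (hω : ω ∈ forms (χ 1) r n) :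
    formCoord χ hr hχ ω ∈ famDeg r n := by
  induction hω using Submodule.span_induction with
  | mem ω hω =>
    obtain ⟨l, hl, h, rfl⟩ := hω
    rw [formCoord_mul, mem_famDeg]
    intro i j k
    rw [tensor, map_smul, degProj_invRep _ hl]
  | zero => simp
  | add a b _ _ ha hb => rw [map_add]; exact add_mem ha hb
  | smul z a _ ha => rw [map_smul]; exact Submodule.smul_mem _ _ ha
end

/-! ### Right multiplication by `θ` -/

section
variable {r : ℕ} {E : Type} [AddCommGroup E] [Module ℂ E] (χ : AddChar (ZMod r) ℂ)

/-- The coefficient of `e_a` in `h θ`, for `h` in `A`. On the monomial basis it is diagonal. -/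
def thetaA : Module.End ℂ (Fam r E) where
  toFun f i j k := (χ i * χ j * (χ k)⁻¹) • f i j k
  map_add' f g := by funext i j k; simp
  map_smul' c f := by funext i j k; simp [smul_comm c]

/-- The coefficient of `e_b` in `h θ`: it takes `a ^ i b ^ j c ^ k` to a multiple of
`a ^ (i + 1) b ^ j c ^ (k - 1)`, which is zero for `k = 0`. -/
def thetaB : Module.End ℂ (Fam r E) where
  toFun f i j k := ((χ 1)⁻¹ * (χ (k + 1) - (χ (k + 1))⁻¹) * χ j) • f (i - 1) j (k + 1)
  map_add' f g := by funext i j k; simp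
  map_smul' c f := by funext i j k; simp [smul_comm c]

/-- The coefficient of `e_c` in `h θ`: it takes `a ^ i b ^ j c ^ k` to a combination of
`a ^ (i - 1) b ^ j c ^ (k + 1)` and `a ^ (i - 1) b ^ (j - 1) c ^ k`. The coefficient of the second
vanishes for `j = 0`, so that only the first has to be cut off by hand. -/
def thetaC : Module.End ℂ (Fam r E) where
  toFun f i j k :=
    (if k = 0 then 0 else ((χ 1)⁻¹ ^ 2 * (χ j)⁻¹ * (χ (k - 1))⁻¹ * (χ (i + 1) ^ 2 * χ j ^ 2 - 1)) •
      f (i + 1) j (k - 1)) +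
    ((χ 1)⁻¹ * (χ (j + 1))⁻¹ * (χ k)⁻¹ * (χ (j + 1) ^ 2 - 1)) • f (i + 1) (j + 1) k
  map_add' f g := by
    funext i j k
    simp only [Pi.add_apply, smul_add]
    split_ifs <;> abel
  map_smul' c f := by
    funext i j k
    simp only [Pi.smul_apply, RingHom.id_apply, smul_add, smul_ite, smul_zero, smul_comm c]

/-- The coefficient of `e_d` in `h θ`: it takes `a ^ i b ^ j c ^ k` to a combination of itself and
`a ^ i b ^ (j - 1) c ^ (k - 1)`, where the coefficient of the second vanishes for `j = 0` and for
`k = 0`. -/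
def thetaD : Module.End ℂ (Fam r E) where
  toFun f i j k :=
    ((χ 1)⁻¹ ^ 2 * (χ i)⁻¹ * (χ j)⁻¹ * (χ k)⁻¹ + χ i * χ j * χ k -
      (χ 1)⁻¹ ^ 2 * χ i * χ j * (χ k)⁻¹) • f i j k +
    ((χ 1)⁻¹ * (χ i)⁻¹ * (χ (j + 1))⁻¹ * (χ (k + 1))⁻¹ * (χ (j + 1) ^ 2 - 1) *
      (χ (k + 1) ^ 2 - 1)) • f i (j + 1) (k + 1)
  map_add' f g := by
    funext i j k
    simp only [Pi.add_apply]
    module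
  map_smul' c f := by
    funext i j k
    simp only [Pi.smul_apply, RingHom.id_apply]
    module

/-- The operators with `h θ = ∑ e_y (pull y h)` for `h` in `A`. -/
def pull : Fin 4 → Module.End ℂ (Fam r E) := ![thetaA χ, thetaB χ, thetaC χ, thetaD χ]

theorem thetaA_apply (f : Fam r E) (i j k : ZMod r) :
    thetaA χ f i j k = (χ i * χ j * (χ k)⁻¹) • f i j k := rfl

theorem thetaB_apply (f : Fam r E) (i j k : ZMod r) : thetaB χ f i j k =
    ((χ 1)⁻¹ * (χ (k + 1) - (χ (k + 1))⁻¹) * χ j) • f (i - 1) j (k + 1) := rfl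

theorem thetaC_apply (f : Fam r E) (i j k : ZMod r) : thetaC χ f i j k =
    (if k = 0 then 0 else ((χ 1)⁻¹ ^ 2 * (χ j)⁻¹ * (χ (k - 1))⁻¹ * (χ (i + 1) ^ 2 * χ j ^ 2 - 1)) •
      f (i + 1) j (k - 1)) +
    ((χ 1)⁻¹ * (χ (j + 1))⁻¹ * (χ k)⁻¹ * (χ (j + 1) ^ 2 - 1)) • f (i + 1) (j + 1) k := rfl

theorem thetaD_apply (f : Fam r E) (i j k : ZMod r) : thetaD χ f i j k =
    ((χ 1)⁻¹ ^ 2 * (χ i)⁻¹ * (χ j)⁻¹ * (χ k)⁻¹ + χ i * χ j * χ k -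
      (χ 1)⁻¹ ^ 2 * χ i * χ j * (χ k)⁻¹) • f i j k +
    ((χ 1)⁻¹ * (χ i)⁻¹ * (χ (j + 1))⁻¹ * (χ (k + 1))⁻¹ * (χ (j + 1) ^ 2 - 1) *
      (χ (k + 1) ^ 2 - 1)) • f i (j + 1) (k + 1) := rfl

set_option maxHeartbeats 8000000 in
/-- Left multiplication by a coordinate function on both sides of
`h θ = ∑ e_y (pull y h)`. -/
theorem pull_mul_tau [Fact (1 < r)] (hr : 3 ≤ r) (l j : Fin 2) (z : Fin 4) :
    (pull χ z * tau χ l j : Module.End ℂ (Fam r E)) =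
      ∑ m, ∑ y, act (χ 1) l m z y • (tau χ m j * pull χ y) := by
  have h0 := chi_ne_zero χ
  refine LinearMap.ext fun f => funext fun i' => funext fun j' => funext fun k' => ?_
  simp only [Fin.sum_univ_two, Fin.sum_univ_four]
  have h2 : (1 : ZMod r) + 1 ≠ 0 := by simpa using natCast_succ_ne_zero (n := 1) hr
  have h2' : (-1 : ZMod r) - 1 ≠ 0 := by rwa [← neg_add', neg_ne_zero]
  have hcase : ∀ x : ZMod r, x = 0 ∨ x = -1 ∨ (x ≠ 0 ∧ x + 1 ≠ 0) := fun x => by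
    by_cases h : x = 0
    · exact Or.inl h
    by_cases h1 : x + 1 = 0
    · exact Or.inr (Or.inl (eq_neg_of_add_eq_zero_left h1))
    · exact Or.inr (Or.inr ⟨h, h1⟩)
  have hcase1 : ∀ x : ZMod r, x = 0 ∨ x = -1 ∨ x = 1 ∨ (x ≠ 0 ∧ x + 1 ≠ 0 ∧ x - 1 ≠ 0) :=
    fun x => by
      by_cases h : x = 1
      · exact Or.inr (Or.inr (Or.inl h))
      · exact (hcase x).imp_right (Or.imp_right fun h' => Or.inr ⟨h'.1, h'.2, sub_ne_zero.2 h⟩)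
  -- The exponents at which a truncated term appears or disappears are treated separately; the
  -- first column of `tau` does not involve the exponent of `b`.
  fin_cases j
  · rcases hcase1 k' with rfl | rfl | rfl | ⟨hk, hk1, hk2⟩ <;> fin_cases l <;> fin_cases z <;>
    simp only [pull, tau, act, actA, actB, actC, actD, Matrix.of_apply, Matrix.cons_val,
      Fin.mk_one, Fin.zero_eta, Fin.reduceFinMk, Fin.isValue, Module.End.mul_apply,
      LinearMap.add_apply, LinearMap.smul_apply, Pi.add_apply, Pi.smul_apply, thetaA_apply,
      thetaB_apply, thetaC_apply, thetaD_apply, opA_apply, opC_apply,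
      zero_smul, zero_add, add_zero, one_smul, smul_zero, sub_add_cancel, add_sub_cancel_right,
      neg_add_cancel, zero_sub, sub_self, if_true, if_false, neg_eq_zero, one_ne_zero,
      AddChar.map_zero_eq_one, AddChar.map_add_eq_mul, AddChar.map_sub_eq_div,
      AddChar.map_neg_eq_inv, *] <;>
    (try match_scalars) <;> (try simp only [mu]) <;> field_simp [h0] <;> ring1
  · rcases hcase j' with rfl | rfl | ⟨hj, hj1⟩ <;>
    rcases hcase1 k' with rfl | rfl | rfl | ⟨hk, hk1, hk2⟩ <;>
    fin_cases l <;> fin_cases z <;>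
    simp only [pull, tau, act, actA, actB, actC, actD, Matrix.of_apply, Matrix.cons_val,
      Fin.mk_one, Fin.zero_eta, Fin.reduceFinMk, Fin.isValue, Module.End.mul_apply,
      LinearMap.add_apply, LinearMap.smul_apply, Pi.add_apply, Pi.smul_apply, thetaA_apply,
      thetaB_apply, thetaC_apply, thetaD_apply, opB_apply, opD_apply,
      zero_smul, zero_add, add_zero, one_smul, smul_zero, sub_add_cancel, add_sub_cancel_right,
      neg_add_cancel, zero_sub, sub_self, if_true, if_false, neg_eq_zero, one_ne_zero,
      AddChar.map_zero_eq_one, AddChar.map_add_eq_mul, AddChar.map_sub_eq_div,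
      AddChar.map_neg_eq_inv, *] <;>
    (try match_scalars) <;> (try simp only [mu]) <;> field_simp [h0] <;> ring1
end

/-! ### The exterior derivative in coordinates -/

section
variable {r : ℕ} (χ : AddChar (ZMod r) ℂ)

/-- Right multiplication by `θ` on forms: `l h θ = ∑ l e_y (pull y h)`. -/
def rightTheta : Module.End ℂ (Fam r V) := ∑ y, mapV (rightE (χ 1) y) * pull χ y

theorem pull_mul_mapV (y : Fin 4) (g : Module.End ℂ V) :
    pull χ y * mapV g = (mapV g : Module.End ℂ (Fam r V)) * pull χ y := by
  refine LinearMap.ext fun f => funext fun i => funext fun j => funext fun k => ?_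
  fin_cases y
  · exact (map_smul g _ _).symm
  · exact (map_smul g _ _).symm
  · by_cases hk : k = 0 <;> simp [pull, thetaC_apply, hk]
  · simp [pull, thetaD_apply]

theorem rightTheta_mul_crossT {i j : Fin 2}
    (h : ∀ l z, (pull χ z * tau χ l j : Module.End ℂ (Fam r V)) =
      ∑ k, ∑ y, act (χ 1) l k z y • (tau χ k j * pull χ y)) :
    rightTheta χ * crossT χ i j = crossT χ i j * rightTheta χ := by
  have hl : ∀ l, rightTheta χ * (mapV (rho (χ 1) i l) * tau χ l j) =
      ∑ k, ∑ y, ∑ z, act (χ 1) l k z y • (mapV (rightE (χ 1) z) * mapV (rho (χ 1) i l) *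
        (tau χ k j * pull χ y)) := by
    intro l
    have : ∀ z, mapV (rightE (χ 1) z) * pull χ z * (mapV (rho (χ 1) i l) * tau χ l j) =
        ∑ k, ∑ y, act (χ 1) l k z y • (mapV (rightE (χ 1) z) * mapV (rho (χ 1) i l) *
        (tau χ k j * pull χ y)) := by
      intro z
      rw [mul_assoc, ← mul_assoc (pull χ z), pull_mul_mapV, mul_assoc, ← mul_assoc, h]
      simp only [Finset.mul_sum, mul_smul_comm]
    rw [rightTheta, Finset.sum_mul, Finset.sum_congr rfl fun z _ => this z, Finset.sum_comm]
    exact Finset.sum_congr rfl fun k _ => Finset.sum_comm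
  have hk : ∀ k, mapV (rho (χ 1) i k) * tau χ k j * rightTheta χ =
      ∑ l, ∑ y, ∑ z, act (χ 1) l k z y • (mapV (rightE (χ 1) z) * mapV (rho (χ 1) i l) *
        (tau χ k j * pull χ y)) := by
    intro k
    rw [Finset.sum_comm, rightTheta, Finset.mul_sum]
    refine Finset.sum_congr rfl fun y _ => ?_
    rw [mul_assoc, ← mul_assoc (tau χ k j), tau_mapV, mul_assoc, ← mul_assoc, ← map_mul,
      rho_mul_rightE (chi_ne_zero χ 1)]
    simp only [map_sum, map_mul, map_smul, Finset.sum_mul, smul_mul_assoc]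
  have e1 : crossT χ i j = ∑ l, mapV (rho (χ 1) i l) * tau χ l j := by
    rw [Fin.sum_univ_two]
    rfl
  rw [e1, Finset.mul_sum, Finset.sum_mul, Finset.sum_congr rfl fun l _ => hl l,
    Finset.sum_congr rfl fun k _ => hk k, Finset.sum_comm]

/-- Left multiplication by `θ` on `Λ`. -/
def leftTheta (q : ℂ) : Module.End ℂ V := leftE q 0 + leftE q 3

/-- The sign `(-1) ^ n` in degree `n`. -/
def signV : Module.End ℂ V := gradeV fun n => (-1) ^ n

theorem rightTheta_unit :
    rightTheta χ (single 0 0 0 oneV) = mapV (leftTheta (χ 1)) (single 0 0 0 oneV) := by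
  have h : ∀ y, pull χ y (single 0 0 0 oneV : Fam r V) =
      if y = 0 ∨ y = 3 then single 0 0 0 oneV else 0 := by
    intro y
    funext i j k
    fin_cases y
    · by_cases h : i = 0 ∧ j = 0 ∧ k = 0
      · obtain ⟨rfl, rfl, rfl⟩ := h
        simp [pull, thetaA_apply]
      · simp [pull, thetaA_apply, single, h]
    · by_cases h : k + 1 = 0 <;> simp [pull, thetaB_apply, single, h]
    · have h1 : i + 1 = 0 → j = 0 → χ (i + 1) ^ 2 * χ j ^ 2 - 1 = 0 := fun h h' => by simp [h, h']
      have h2 : j + 1 = 0 → χ (j + 1) ^ 2 - 1 = 0 := fun h => by simp [h]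
      by_cases h : i + 1 = 0 <;> by_cases h' : j = 0 <;> by_cases h'' : j + 1 = 0 <;>
        simp_all [pull, thetaC_apply, single]
    · have h2 : j + 1 = 0 → χ (j + 1) ^ 2 - 1 = 0 := fun h => by simp [h]
      by_cases h : i = 0 ∧ j = 0 ∧ k = 0
      · obtain ⟨rfl, rfl, rfl⟩ := h
        by_cases h'' : (1 : ZMod r) = 0 <;> simp_all [pull, thetaD_apply, single]
      · by_cases h'' : j + 1 = 0 <;> simp_all [pull, thetaD_apply, single]
  have hone : rightE (χ 1) 0 oneV + rightE (χ 1) 3 oneV = leftTheta (χ 1) oneV := by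
    refine V_ext ?_
    simp [rightE, leftTheta, leftE, La, Ld, Ra, Rd, oneV]
  rw [rightTheta, LinearMap.sum_apply, Fin.sum_univ_four]
  simp only [Module.End.mul_apply, h]
  simp only [Fin.isValue, true_or, or_true, if_true, Fin.reduceEq, or_self, if_false, map_zero,
    add_zero, one_ne_zero]
  simp only [← tensor_single, tensor_mapV, ← hone]
  funext i j k
  exact (smul_add _ _ _).symm

/-- The exterior derivative in coordinates. -/
def famD : Module.End ℂ (Fam r V) := rightTheta χ * mapV signV - mapV (leftTheta (χ 1))

theorem mapV_gradeV_of_mem {n : ℕ} {f : Fam r V} (hf : f ∈ famDeg r n) (c : ℕ → ℂ) :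
    mapV (gradeV c) f = c n • f := by
  funext i j k l
  have h := degProj_eq_self_iff.1 (mem_famDeg.1 hf i j k) l
  by_cases hl : deg l = n
  · simp [gradeV_apply, hl]
  · simp [gradeV_apply, h hl]

theorem gradeV_mul_gradeV (c c' : ℕ → ℂ) : gradeV c * gradeV c' = gradeV fun n => c n * c' n := by
  refine LinearMap.ext fun v => funext fun l => ?_
  simp [gradeV_apply, mul_assoc]

theorem gradeV_mul_leftTheta (q : ℂ) (c : ℕ → ℂ) :
    gradeV c * leftTheta q = leftTheta q * gradeV fun n => c (n + 1) := by
  refine LinearMap.ext fun v => ?_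
  simp only [leftTheta, Module.End.mul_apply, LinearMap.add_apply, map_add, gradeV_leftE]

theorem mapV_gradeV_mul_rightTheta (c : ℕ → ℂ) :
    mapV (gradeV c) * rightTheta χ = rightTheta χ * mapV (gradeV fun n => c (n + 1)) := by
  rw [rightTheta, Finset.mul_sum, Finset.sum_mul]
  refine Finset.sum_congr rfl fun y _ => ?_
  rw [mul_assoc, pull_mul_mapV, ← mul_assoc, ← mul_assoc, ← map_mul, ← map_mul]
  congr 2
  exact LinearMap.ext fun v => gradeV_rightE c y v

theorem mapV_gradeV_mul_famD (c : ℕ → ℂ) :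
    mapV (gradeV c) * famD χ = famD χ * mapV (gradeV fun n => c (n + 1)) := by
  rw [famD, mul_sub, sub_mul, ← mul_assoc, mapV_gradeV_mul_rightTheta, ← map_mul,
    gradeV_mul_leftTheta, map_mul, mul_assoc, mul_assoc, ← map_mul, ← map_mul, signV,
    gradeV_mul_gradeV, ← map_mul, gradeV_mul_gradeV]
  simp only [mul_comm]

variable [NeZero r] [Fact (1 < r)] (hr : 3 ≤ r) (hχ : IsPrimitiveRoot (χ 1 ^ 2) r)

/-- Right multiplication by `θ` is linear over left multiplication by `Ω`, and so it is determined
by its value on the unit. -/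
theorem rightTheta_mul_omegaRep (ω : Omega (χ 1) r) :
    rightTheta χ * omegaRep χ hr hχ ω = omegaRep χ hr hχ ω * rightTheta χ := by
  obtain ⟨f, rfl⟩ : ∃ f, Omega.mk (χ 1) r f = ω := RingQuot.mkAlgHom_surjective ℂ _ ω
  induction f using FreeAlgebra.induction with
  | grade0 z => simp only [AlgHom.commutes, Algebra.commutes]
  | grade1 g =>
    cases g with
    | t i j =>
      change _ * omegaRep χ hr hχ (t (χ 1) r i j) = omegaRep χ hr hχ (t (χ 1) r i j) * _
      rw [omegaRep_t]
      exact rightTheta_mul_crossT χ fun l z => pull_mul_tau χ hr l j z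
    | e x =>
      change _ * omegaRep χ hr hχ (e (χ 1) r x) = omegaRep χ hr hχ (e (χ 1) r x) * _
      rw [omegaRep_e, rightTheta, Finset.sum_mul, Finset.mul_sum]
      refine Finset.sum_congr rfl fun y _ => ?_
      rw [mul_assoc, pull_mul_mapV, ← mul_assoc, ← mul_assoc, ← map_mul, ← map_mul,
        leftE_mul_rightE (chi_ne_zero χ 1)]
  | mul f g hf hg => rw [map_mul, map_mul, ← mul_assoc, hf, mul_assoc, hg, mul_assoc]
  | add f g hf hg => rw [map_add, map_add, mul_add, add_mul, hf, hg]

theorem formCoord_mul_theta (ω : Omega (χ 1) r) :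
    formCoord χ hr hχ (ω * theta (χ 1) r) = rightTheta χ (formCoord χ hr hχ ω) := by
  have h : omegaRep χ hr hχ (theta (χ 1) r) (single 0 0 0 oneV) =
      rightTheta χ (single 0 0 0 oneV) := by
    rw [rightTheta_unit, theta, map_add, omegaRep_e, omegaRep_e, ← map_add]
    rfl
  rw [formCoord_apply, map_mul, Module.End.mul_apply, h, ← Module.End.mul_apply,
    ← rightTheta_mul_omegaRep]
  rfl

theorem formCoord_theta_mul (ω : Omega (χ 1) r) :
    formCoord χ hr hχ (theta (χ 1) r * ω) = mapV (leftTheta (χ 1)) (formCoord χ hr hχ ω) := by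
  rw [formCoord_apply, map_mul, Module.End.mul_apply, theta, map_add, omegaRep_e, omegaRep_e,
    ← map_add]
  rfl

theorem formCoord_extD {n : ℕ} {ω : Omega (χ 1) r} (hω : ω ∈ forms (χ 1) r n) :
    formCoord χ hr hχ (extD (χ 1) r n ω) = famD χ (formCoord χ hr hχ ω) := by
  have h1 : extD (χ 1) r n ω = (-1 : ℂ) ^ n • (ω * theta (χ 1) r) - theta (χ 1) r * ω := rfl
  rw [h1, map_sub, map_smul, formCoord_mul_theta, formCoord_theta_mul, famD, LinearMap.sub_apply,
    Module.End.mul_apply, signV, mapV_gradeV_of_mem (formCoord_mem χ hr hχ hω), map_smul]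

theorem rightTheta_mul_rightTheta (hr : 3 ≤ r) (hχ : IsPrimitiveRoot (χ 1 ^ 2) r) :
    rightTheta χ * rightTheta χ = 0 := by
  refine LinearMap.ext fun f => ?_
  rw [Module.End.mul_apply, ← formCoord_formRec χ hr hχ f, ← formCoord_mul_theta,
    ← formCoord_mul_theta, mul_assoc, theta_mul_theta _ _ (chi_ne_zero χ 1), mul_zero, map_zero]
  rfl

theorem mapV_leftTheta_mul_self (hr : 3 ≤ r) (hχ : IsPrimitiveRoot (χ 1 ^ 2) r) :
    (mapV (leftTheta (χ 1)) : Module.End ℂ (Fam r V)) * mapV (leftTheta (χ 1)) = 0 := by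
  refine LinearMap.ext fun f => ?_
  rw [Module.End.mul_apply, ← formCoord_formRec χ hr hχ f, ← formCoord_theta_mul,
    ← formCoord_theta_mul, ← mul_assoc, theta_mul_theta _ _ (chi_ne_zero χ 1), zero_mul, map_zero]
  rfl

theorem famD_mul_famD (hr : 3 ≤ r) (hχ : IsPrimitiveRoot (χ 1 ^ 2) r) : famD χ * famD χ = 0 := by
  have h1 : (mapV signV : Module.End ℂ (Fam r V)) * mapV signV = 1 := by
    rw [← map_mul, signV, gradeV_mul_gradeV]
    simp only [← mul_pow, neg_mul_neg, one_mul, one_pow]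
    exact LinearMap.ext fun f => funext fun i => funext fun j => funext fun k => funext fun l =>
      one_mul _
  have hs : (gradeV fun n => (-1) ^ (n + 1) : Module.End ℂ V) = (-1 : ℂ) • signV := by
    refine LinearMap.ext fun v => funext fun l => ?_
    simp [gradeV_apply, signV, pow_succ]
  have h2 : mapV signV * rightTheta χ = (-1 : ℂ) • (rightTheta χ * mapV signV) := by
    rw [signV, mapV_gradeV_mul_rightTheta, hs, map_smul, mul_smul_comm, signV]
  have h3 : (mapV signV : Module.End ℂ (Fam r V)) * mapV (leftTheta (χ 1)) =
      (-1 : ℂ) • (mapV (leftTheta (χ 1)) * mapV signV) := by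
    rw [← map_mul, signV, gradeV_mul_leftTheta, hs, mul_smul_comm, map_smul, map_mul, signV]
  have h4 : rightTheta χ * mapV (leftTheta (χ 1)) = mapV (leftTheta (χ 1)) * rightTheta χ := by
    have := rightTheta_mul_omegaRep χ hr hχ (theta (χ 1) r)
    rwa [theta, map_add, omegaRep_e, omegaRep_e, ← map_add] at this
  have e1 : rightTheta χ * mapV signV * (rightTheta χ * mapV signV) = 0 := by
    rw [mul_assoc, ← mul_assoc (mapV signV), h2, smul_mul_assoc, mul_assoc, h1, mul_one,
      mul_smul_comm, rightTheta_mul_rightTheta χ hr hχ, smul_zero]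
  have e2 : rightTheta χ * mapV signV * mapV (leftTheta (χ 1)) =
      (-1 : ℂ) • (mapV (leftTheta (χ 1)) * (rightTheta χ * mapV signV)) := by
    rw [mul_assoc, h3, mul_smul_comm, ← mul_assoc, h4, mul_assoc]
  rw [famD, sub_mul, mul_sub, mul_sub, e1, e2, mapV_leftTheta_mul_self χ hr hχ]
  module
end

/-! ### Homotopies for the exterior derivative -/

section
variable {q : ℂ}

theorem signV_apply (v : V) (l : Fin 16) : signV v l = (-1) ^ deg l * v l := rfl

/-- The homotopy whose anticommutator with `d` is diagonal up to lower powers of `b`. -/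
def homC (q : ℂ) : Module.End ℂ V :=
  LinearMap.pi ![co 1 + (q ^ 2) • co 4, -((q ^ 2) • co 7), co 5 - (q ^ 2) • co 9,
    co 6 - (q ^ 2) • co 10, co 7, (q ^ 2) • co 12, (q ^ 2) • co 13, 0, co 11 + (q ^ 2) • co 14,
    co 12, co 13, -((q ^ 2) • co 15), 0, 0, co 15, 0]

set_option maxHeartbeats 1000000 in
theorem homC_rightE (hq : q ≠ 0) (y : Fin 4) :
    rightE q y * signV * homC q + homC q * (rightE q y * signV) =
      (![1, 0, 0, q ^ 2] y : ℂ) • (1 : Module.End ℂ V) := by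
  refine LinearMap.ext fun v => V_ext ?_
  fin_cases y <;> simp [rightE, Ra, Rb, Rc, Rd, homC, signV_apply, deg, -mul_eq_mul_left_iff] <;>
    and_intros <;> (first | ring1 | ((try simp only [mu]) <;> field_simp <;> ring1))

theorem homC_leftTheta :
    leftTheta q * homC q + homC q * leftTheta q = (1 + q ^ 2) • (1 : Module.End ℂ V) := by
  refine LinearMap.ext fun v => V_ext ?_
  simp [leftTheta, leftE, La, Ld, homC, -mul_eq_mul_left_iff]
  and_intros <;> ring1

theorem dera_leftTheta :
    leftTheta q * dera + dera * leftTheta q = (1 : Module.End ℂ V) := by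
  refine LinearMap.ext fun v => V_ext ?_
  simp [leftTheta, leftE, La, Ld, dera, -mul_eq_mul_left_iff]

end

section
variable {r : ℕ} (χ : AddChar (ZMod r) ℂ)

/-- The weight of the basis elements of `V`, with `e_b` of weight `-1` and `e_c` of weight `1`. -/
def wt : Fin 16 → ZMod r := ![0, 0, -1, 1, 0, -1, 1, 0, 0, -1, 1, 0, -1, 1, 0, 0]

/-- Multiplication by a function of the weight. -/
def weightV (φ : ZMod r → ℂ) : Module.End ℂ V := LinearMap.pi fun l => φ (wt l) • co l

theorem weightV_apply (φ : ZMod r → ℂ) (v : V) (l : Fin 16) :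
    weightV φ v l = φ (wt l) * v l := rfl

set_option maxHeartbeats 1000000 in
theorem weightV_rightE (q : ℂ) (φ : ZMod r → ℂ) (y : Fin 4) (v : V) :
    weightV φ (rightE q y v) = rightE q y (weightV (fun w => φ (w + ![0, -1, 1, 0] y)) v) := by
  refine V_ext ?_
  fin_cases y <;> simp [rightE, Ra, Rb, Rc, Rd, weightV_apply, wt, -mul_eq_mul_left_iff] <;>
    and_intros <;> ring1

theorem weightV_signV (φ : ZMod r → ℂ) (v : V) :
    weightV φ (signV v) = signV (weightV φ v) :=
  funext fun _ => mul_left_comm _ _ _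

theorem weightV_leftTheta (q : ℂ) (φ : ZMod r → ℂ) (v : V) :
    weightV φ (leftTheta q v) = leftTheta q (weightV φ v) := by
  refine V_ext ?_
  simp [leftTheta, leftE, La, Ld, weightV_apply, wt, -mul_eq_mul_left_iff]
  and_intros <;> ring1

set_option maxHeartbeats 1000000 in
theorem dera_rightE (y : Fin 4) :
    rightE (χ 1) y * signV * dera + dera * (rightE (χ 1) y * signV) =
      if y = 0 then weightV fun w => χ w ^ 2 else 0 := by
  have h0 := chi_ne_zero χ 1
  refine LinearMap.ext fun v => V_ext ?_
  fin_cases y <;> simp [rightE, Ra, Rb, Rc, Rd, dera, signV_apply, deg, weightV_apply, wt,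
    AddChar.map_neg_eq_inv, -mul_eq_mul_left_iff] <;>
    and_intros <;> ring1

theorem famD_apply (f : Fam r V) (i j k : ZMod r) : famD χ f i j k =
    ∑ y, rightE (χ 1) y (signV (pull χ y f i j k)) - leftTheta (χ 1) (f i j k) := by
  have h : ∀ y, pull χ y (mapV signV f) = mapV signV (pull χ y f) := fun y =>
    LinearMap.congr_fun (pull_mul_mapV χ y signV) f
  simp only [famD, rightTheta, LinearMap.sub_apply, Module.End.mul_apply, LinearMap.sum_apply,
    Pi.sub_apply, Finset.sum_apply, mapV_apply, h]

/-- The anticommutator of `d` with an operator on the coefficients, which commutes with the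
operators `pull`, reduces to anticommutators on `V`. -/
theorem famD_homotopy (h : Module.End ℂ V) (f : Fam r V) (i j k : ZMod r) :
    famD χ (mapV h f) i j k + h (famD χ f i j k) =
      ∑ y, (rightE (χ 1) y * signV * h + h * (rightE (χ 1) y * signV)) (pull χ y f i j k) -
        (leftTheta (χ 1) * h + h * leftTheta (χ 1)) (f i j k) := by
  have e : ∀ y, pull χ y (mapV h f) = mapV h (pull χ y f) := fun y =>
    LinearMap.congr_fun (pull_mul_mapV χ y h) f
  simp only [famD_apply, map_sub, map_sum, e, mapV_apply, LinearMap.add_apply,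
    Module.End.mul_apply, Finset.sum_add_distrib]
  abel

/-- Multiplication by a function of the two conserved charges `i + j - k + 2 w` and `i - j + k`. -/
def chargeMul (c : ZMod r → ZMod r → ℂ) : Module.End ℂ (Fam r V) where
  toFun f i j k := weightV (fun w => c (i + j - k + 2 * w) (i - j + k)) (f i j k)
  map_add' f g := by funext i j k; exact map_add _ _ _
  map_smul' z f := by funext i j k; exact map_smul (weightV _) _ _

theorem chargeMul_apply (c : ZMod r → ZMod r → ℂ) (f : Fam r V) (i j k : ZMod r) :
    chargeMul c f i j k = weightV (fun w => c (i + j - k + 2 * w) (i - j + k)) (f i j k) := rfl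

theorem chargeMul_apply_coord (c : ZMod r → ZMod r → ℂ) (f : Fam r V) (i j k : ZMod r)
    (l : Fin 16) : chargeMul c f i j k l = c (i + j - k + 2 * wt l) (i - j + k) * f i j k l := rfl

theorem chargeMul_pull (c : ZMod r → ZMod r → ℂ) (f : Fam r V) (y : Fin 4) (i j k : ZMod r) :
    pull χ y (chargeMul c f) i j k =
      weightV (fun w => c (i + j - k + 2 * (w + ![0, -1, 1, 0] y)) (i - j + k))
        (pull χ y f i j k) := by
  fin_cases y
  · simp [pull, thetaA_apply, chargeMul_apply]
  · simp only [pull, Matrix.cons_val, Fin.reduceFinMk, thetaB_apply, chargeMul_apply, map_smul]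
    congr 3
    funext w
    congr 1 <;> ring
  · simp only [pull, Matrix.cons_val, Fin.reduceFinMk, thetaC_apply, chargeMul_apply, map_smul,
      map_add]
    have e1 : (fun w => c (i + 1 + j - (k - 1) + 2 * w) (i + 1 - j + (k - 1))) =
        fun w => c (i + j - k + 2 * (w + 1)) (i - j + k) := by
      funext w
      congr 1 <;> ring
    have e2 : (fun w => c (i + 1 + (j + 1) - k + 2 * w) (i + 1 - (j + 1) + k)) =
        fun w => c (i + j - k + 2 * (w + 1)) (i - j + k) := by
      funext w
      congr 1 <;> ring
    rw [e1, e2]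
    split_ifs <;> simp
  · simp only [pull, Matrix.cons_val, Fin.reduceFinMk, thetaD_apply, chargeMul_apply, map_smul,
      map_add, add_zero]
    have e2 : (fun w => c (i + (j + 1) - (k + 1) + 2 * w) (i - (j + 1) + (k + 1))) =
        fun w => c (i + j - k + 2 * w) (i - j + k) := by
      funext w
      congr 1 <;> ring
    rw [e2]

theorem famD_chargeMul (c : ZMod r → ZMod r → ℂ) (f : Fam r V) :
    famD χ (chargeMul c f) = chargeMul c (famD χ f) := by
  funext i j k
  rw [chargeMul_apply, famD_apply, famD_apply]
  simp only [map_sub, map_sum, weightV_leftTheta, weightV_rightE, weightV_signV, chargeMul_pull,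
    chargeMul_apply]

/-- `∂_a` contracts the part of `Ω` on which `q ^ (i + j - k + 2 w) ≠ 1`. -/
theorem famD_dera (f : Fam r V) :
    famD χ (mapV dera f) + mapV dera (famD χ f) = chargeMul (fun s _ => χ s - 1) f := by
  funext i j k
  refine (famD_homotopy χ dera f i j k).trans ?_
  simp only [dera_rightE, dera_leftTheta, Fin.sum_univ_four, Fin.isValue, if_true, one_ne_zero,
    if_false, Fin.reduceEq, LinearMap.zero_apply, add_zero, chargeMul_apply]
  funext l
  simp only [pull, Matrix.cons_val_zero, thetaA_apply, weightV_apply, map_smul, Pi.sub_apply,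
    Pi.smul_apply, smul_eq_mul, Module.End.one_apply, sub_mul, one_mul, AddChar.map_add_eq_mul,
    AddChar.map_sub_eq_div, two_mul]
  ring

/-- On the charge `s = 0` part the exponents satisfy `i + j + k = t + 2 j`, where `t = i - j + k`,
so that the diagonal coefficient is invertible unless `t + 2 j = 0` or `t + 2 j + 2 = 0`. The other
term comes from the next higher power of `b`. -/
theorem famD_homC (f : Fam r V) (i j k : ZMod r) :
    famD χ (mapV (homC (χ 1)) f) i j k + homC (χ 1) (famD χ f i j k) =
      ((χ (i + j + k))⁻¹ * (χ (i + j + k) - 1) * (χ 1 ^ 2 * χ (i + j + k) - 1)) • f i j k +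
        (χ 1 * (χ i)⁻¹ * (χ (j + 1))⁻¹ * (χ (k + 1))⁻¹ * (χ (j + 1) ^ 2 - 1) *
          (χ (k + 1) ^ 2 - 1)) • f i (j + 1) (k + 1) := by
  have h0 := chi_ne_zero χ
  rw [famD_homotopy]
  simp only [homC_rightE (h0 1), homC_leftTheta, Fin.sum_univ_four, pull, thetaA_apply,
    thetaD_apply, Matrix.cons_val, LinearMap.smul_apply, Module.End.one_apply, zero_smul, one_smul,
    add_zero, AddChar.map_add_eq_mul]
  match_scalars <;> field_simp [h0] <;> ring1

end

/-! ### The complexes on the critical layers -/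

section
variable (q : ℂ)

/-- The differential induced by `d` on the critical coordinates of a layer with `t + 2 n = 0`. -/
def critZero : Module.End ℂ V :=
  LinearMap.pi ![0, 0, 0, 0, 0, 0, 0, 0, (mu q) • (-co 1 + co 3 + co 4), 0, 0,
    (mu q) • (-co 6 - co 7), 0, 0, (mu q) • (-co 7 + co 10), -((mu q) • co 13)]

/-- The differential induced by `d` on the critical coordinates of a layer with
`t + 2 n + 2 = 0`. -/
def critOne : Module.End ℂ V :=
  LinearMap.pi ![0, 0, -((mu q) • co 0), 0, 0, (mu q) • co 1, 0, 0, (mu q) • (-co 1 + co 4),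
    -((mu q) • co 4), 0, -((mu q) • co 7), (mu q) • co 7, 0, -((mu q) • co 7), 0]

/-- The component of `d` that leads from the critical layer with `t + 2 n = 0` to the one below it,
without the factor `q ^ (2 n) - 1`. -/
def critLink : Module.End ℂ V :=
  LinearMap.pi ![0, 0, 0, (q⁻¹ ^ 2) • co 0, 0, 0, -((q⁻¹ ^ 2) • co 1), 0, -co 2, (mu q) • co 2,
    -((mu q) • co 3) + (q⁻¹ ^ 2) • co 4, co 5, -((mu q) • co 5),
    (mu q) • co 6 - (q⁻¹ ^ 2) • co 7, -co 9, co 12]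

variable {q}

set_option maxHeartbeats 1000000 in
/-- The two critical layers together are acyclic. -/
theorem critPair_exact (hq : q ≠ 0) (hm : mu q ≠ 0) {u v : V} (hu : critZero q u = 0)
    (huv : critOne q v + critLink q u = 0) :
    ∃ g g', critZero q g = u ∧ critOne q g' + critLink q g = v := by
  have hp : q⁻¹ ^ 2 = 1 - mu q := by rw [mu, sub_sub_cancel]
  have hp0 : 1 - mu q ≠ 0 := hp ▸ pow_ne_zero 2 (inv_ne_zero hq)
  have e := fun l => congrFun hu l
  have f := fun l => congrFun huv l
  have e8 := e 8
  have e11 := e 11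
  have e14 := e 14
  have e15 := e 15
  have f2 := f 2
  have f3 := f 3
  have f5 := f 5
  have f6 := f 6
  have f8 := f 8
  have f9 := f 9
  have f10 := f 10
  have f11 := f 11
  have f12 := f 12
  have f13 := f 13
  have f14 := f 14
  have f15 := f 15
  simp only [critZero, critOne, critLink, hp, LinearMap.pi_apply, Pi.add_apply, Pi.zero_apply]
    at e8 e11 e14 e15 f2 f3 f5 f6 f8 f9 f10 f11 f12 f13 f14 f15
  simp [hm, hp0] at e8 e11 e14 e15 f2 f3 f5 f6 f15
  simp [f5, f6] at f8 f9 f10 f11 f12 f13 f14 e8 e11 e14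
  have cancel : ∀ {x y : ℂ}, x ≠ 0 → x * y = 0 → y = 0 := fun hx h =>
    (mul_eq_zero.1 h).resolve_left hx
  have u2 : u 2 = 0 := cancel hp0 (by linear_combination -f8 - f9)
  have v4 : v 4 = 0 := cancel hm (by linear_combination f8 + u2)
  have u5 : u 5 = 0 := cancel hp0 (by linear_combination f11 + f12)
  have v7 : v 7 = 0 := cancel hm (by linear_combination -f11 + u5)
  have u9 : u 9 = 0 := by linear_combination -f14 - mu q * v7
  have e8' : u 3 + u 4 = 0 := cancel hm (by linear_combination e8)
  have u3 : u 3 = 0 := by linear_combination -f10 + (1 - mu q) * e8'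
  have u4 : u 4 = 0 := by linear_combination e8' - u3
  have u6 : u 6 = 0 := by linear_combination f13 - (1 - mu q) * e11
  have u7 : u 7 = 0 := by linear_combination -e11 - u6
  have u10 : u 10 = 0 := cancel hm (by linear_combination e14 + mu q * u7)
  clear hu huv e f e8 e11 e14 f8 f9 f10 f11 f12 f13 f14 e8'
  obtain ⟨p, hpq⟩ : ∃ p, p = 1 - mu q := ⟨_, rfl⟩
  have hmp : mu q = 1 - p := by rw [hpq, sub_sub_cancel]
  rw [← hpq] at hp hp0
  refine ⟨![p⁻¹ * v 3, -p⁻¹ * v 6, -p⁻¹ * (v 8 + v 5 + v 9),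
      p * ((mu q)⁻¹ * u 8 - p⁻¹ * v 6) - v 10,
      (mu q)⁻¹ * u 8 - p⁻¹ * v 6 - (p * ((mu q)⁻¹ * u 8 - p⁻¹ * v 6) - v 10),
      p⁻¹ * (v 11 + v 12), v 13 - p * ((mu q)⁻¹ * u 11),
      -(mu q)⁻¹ * u 11 - (v 13 - p * ((mu q)⁻¹ * u 11)), 0,
      -v 14 - mu q * ((mu q)⁻¹ * v 12 + p⁻¹ * (v 11 + v 12)),
      (mu q)⁻¹ * u 14 + (-(mu q)⁻¹ * u 11 - (v 13 - p * ((mu q)⁻¹ * u 11))), 0, v 15,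
      -(mu q)⁻¹ * u 15, 0, 0],
    ![-(mu q)⁻¹ * v 2, (mu q)⁻¹ * v 5, 0, 0,
      -p⁻¹ * (v 8 + v 5 + v 9) - (mu q)⁻¹ * v 9, 0, 0,
      (mu q)⁻¹ * v 12 + p⁻¹ * (v 11 + v 12), 0, 0, 0, 0, 0, 0, 0, 0], V_ext ?_, V_ext ?_⟩
  · simp [critZero, f3, f6, u2, u3, u4, u5, u6, u7, u9, u10, f15, e15]
    and_intros <;> field_simp <;> ring1
  · simp [critOne, critLink, hp, f2, f5, v4, v7, -inv_pow]
    and_intros <;> field_simp <;> rw [hmp] <;> ring1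

/-- The conditions on the coordinates of `v` are linear conditions that separate the cohomology of
`critOne`. -/
theorem critOne_exact (hm : mu q ≠ 0) {v : V} (hv : critOne q v = 0)
    (h3 : v 3 = 0) (h6 : v 6 = 0) (h10 : v 10 = 0) (h5 : v 5 + v 9 + v 8 = 0)
    (h14 : v 14 - v 11 = 0) (h13 : v 13 = 0) (h12 : v 12 + v 11 = 0) (h15 : v 15 = 0) :
    ∃ g, critOne q g = v := by
  have e := fun l => congrFun hv l
  have e2 := e 2
  have e5 := e 5
  have e9 := e 9
  have e12 := e 12
  simp [critOne, hm] at e2 e5 e9 e12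
  refine ⟨![-(mu q)⁻¹ * v 2, (mu q)⁻¹ * v 5, 0, 0, -(mu q)⁻¹ * v 9, 0, 0, (mu q)⁻¹ * v 12, 0, 0, 0,
    0, 0, 0, 0, 0], V_ext ?_⟩
  simp [critOne, e2, e5, e9, e12, h3, h6, h10, h13, h15, hm]
  and_intros
  · linear_combination -h5
  · linear_combination -h12
  · linear_combination -h12 - h14

/-- The conditions on the coordinates of `u` are linear conditions that separate the cohomology of
`critZero`. -/
theorem critZero_exact (hm : mu q ≠ 0) {u : V} (hu : critZero q u = 0)
    (h0 : u 0 = 0) (h2 : u 2 = 0) (h3 : u 3 = 0) (h1 : u 1 - u 3 = 0) (h9 : u 9 = 0)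
    (h5 : u 5 = 0) (h6 : u 6 = 0) (h12 : u 12 = 0) : ∃ g, critZero q g = u := by
  have e := fun l => congrFun hu l
  have e8 := e 8
  have e11 := e 11
  have e14 := e 14
  have e15 := e 15
  simp [critZero, hm] at e8 e11 e14 e15
  refine ⟨![0, 0, 0, (mu q)⁻¹ * u 8, 0, 0, -(mu q)⁻¹ * u 11, 0, 0, 0, (mu q)⁻¹ * u 14, 0, 0,
    -(mu q)⁻¹ * u 15, 0, 0], V_ext ?_⟩
  simp [critZero, h0, h2, h3, h9, h5, h6, h12, e15, hm]
  have h7 : u 7 = 0 := by linear_combination -e11 - h6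
  have h10 : u 10 = 0 := (mul_eq_zero.1 (show mu q * u 10 = 0 by
    linear_combination e14 + mu q * h7)).resolve_left hm
  have h4 : u 4 = 0 := (mul_eq_zero.1 (show mu q * u 4 = 0 by
    linear_combination e8 + mu q * h1)).resolve_left hm
  refine ⟨?_, h4.symm, h7.symm, h10.symm⟩
  linear_combination -h1 - h3
end

/-! ### The filtration by powers of `b` -/

section
variable {r : ℕ} (χ : AddChar (ZMod r) ℂ)

/-- The families supported on powers of `b` with exponent less than `n`. -/
def Below (n : ℕ) (f : Fam r V) : Prop := ∀ i j k, n ≤ j.val → f i j k = 0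

theorem Below.sub {n : ℕ} {f g : Fam r V} (hf : Below n f) (hg : Below n g) : Below n (f - g) :=
  fun i j k h => by rw [Pi.sub_apply, Pi.sub_apply, Pi.sub_apply, hf i j k h, hg i j k h, sub_zero]

theorem Below.mono {m n : ℕ} (hmn : m ≤ n) {f : Fam r V} (hf : Below m f) : Below n f :=
  fun i j k h => hf i j k (hmn.trans h)

theorem Below.chargeMul {n : ℕ} {f : Fam r V} (hf : Below n f) (c : ZMod r → ZMod r → ℂ) :
    Below n (chargeMul c f) :=
  fun i j k h => by rw [chargeMul_apply, hf i j k h, map_zero]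

theorem Below.layer [NeZero r] {n : ℕ} {f : Fam r V} (hf : Below (n + 1) f)
    (h : ∀ i k, f i n k = 0) : Below n f := fun i j k hj => by
  rcases Nat.lt_or_ge n j.val with h' | h'
  · exact hf i j k h'
  · rw [← ZMod.natCast_zmod_val j, le_antisymm h' hj]
    exact h i k

/-- The coefficient `q ^ (2 j) - 1` cuts the wrap-around of the powers of `b`. -/
theorem Below.wrap [NeZero r] [Fact (1 < r)] {n : ℕ} {f : Fam r V} (hf : Below (n + 1) f)
    {j : ZMod r} (hj : n ≤ j.val) (i k : ZMod r) :
    (χ (j + 1) ^ 2 - 1) • f i (j + 1) k = 0 := by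
  by_cases h : j + 1 = 0
  · rw [h, AddChar.map_zero_eq_one, one_pow, sub_self, zero_smul]
  · have h1 := val_sub_one_lt h
    rw [add_sub_cancel_right] at h1
    rw [hf _ _ _ (by omega), smul_zero]

theorem Below.pull [NeZero r] [Fact (1 < r)] {n : ℕ} {f : Fam r V} (hf : Below n f) (y : Fin 4) :
    Below n (pull χ y f) := by
  intro i j k hj
  have h := fun i' k' => (hf.mono n.le_succ).wrap χ hj i' k'
  have h0 := fun i' k' => hf i' j k' hj
  fin_cases y
  · exact (congrArg _ (h0 _ _)).trans (smul_zero _)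
  · exact (congrArg _ (h0 _ _)).trans (smul_zero _)
  · change thetaC χ f i j k = 0
    rw [thetaC_apply, h0, mul_smul _ (χ (j + 1) ^ 2 - 1), h]
    simp
  · change thetaD χ f i j k = 0
    rw [thetaD_apply, h0, mul_right_comm _ (χ (j + 1) ^ 2 - 1), mul_smul _ (χ (j + 1) ^ 2 - 1), h]
    simp

theorem Below.famD [NeZero r] [Fact (1 < r)] {n : ℕ} {f : Fam r V} (hf : Below n f) :
    Below n (famD χ f) := fun i j k hj => by
  have h := fun y => hf.pull χ y i j k hj
  simp only [famD_apply, h, hf i j k hj, map_zero, Finset.sum_const_zero, sub_zero]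

/-- The critical coordinates in the layer `b ^ n`, for `κ = 0` or `κ = 1`. -/
def res (κ n : ZMod r) : Fam r V →ₗ[ℂ] V where
  toFun f l := χ (n * wt l) * f (-n - wt l - κ) n (wt l - κ) l
  map_add' f g := by funext l; exact mul_add _ _ _
  map_smul' c f := by funext l; exact mul_left_comm _ _ _

theorem res_apply (κ n : ZMod r) (f : Fam r V) (l : Fin 16) :
    res χ κ n f l = χ (n * wt l) * f (-n - wt l - κ) n (wt l - κ) l := rfl

variable [Fact (1 < r)]

set_option maxHeartbeats 2000000 in
/-- The hypothesis says that the layer `b ^ (n + 1)` does not contribute. -/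
theorem res_famD_zero (n : ZMod r) (f : Fam r V)
    (hf : ∀ i k, (χ (n + 1) ^ 2 - 1) • f i (n + 1) k = 0) :
    res χ 0 n (famD χ f) = critZero (χ 1) (res χ 0 n f) := by
  have h0 := chi_ne_zero χ
  have hC : ∀ i k, thetaC χ f i n k = (if k = 0 then 0 else
      ((χ 1)⁻¹ ^ 2 * (χ n)⁻¹ * (χ (k - 1))⁻¹ * (χ (i + 1) ^ 2 * χ n ^ 2 - 1)) •
        f (i + 1) n (k - 1)) := fun i k => by
    rw [thetaC_apply, mul_smul _ (χ (n + 1) ^ 2 - 1), hf, smul_zero, add_zero]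
  have hD : ∀ i k, thetaD χ f i n k =
    ((χ 1)⁻¹ ^ 2 * (χ i)⁻¹ * (χ n)⁻¹ * (χ k)⁻¹ + χ i * χ n * χ k -
      (χ 1)⁻¹ ^ 2 * χ i * χ n * (χ k)⁻¹) • f i n k := fun i k => by
    rw [thetaD_apply, mul_right_comm _ (χ (n + 1) ^ 2 - 1), mul_smul _ (χ (n + 1) ^ 2 - 1), hf,
      smul_zero, add_zero]
  refine V_ext ?_
  simp only [res_apply, famD_apply, Fin.sum_univ_four, pull, Matrix.cons_val, thetaA_apply,
    thetaB_apply, hC, hD, wt]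
  simp [leftTheta, leftE, rightE, La, Ld, Ra, Rb, Rc, Rd, critZero, res_apply, wt, signV_apply, deg,
    AddChar.map_add_eq_mul, AddChar.map_sub_eq_div, AddChar.map_neg_eq_inv,
    -mul_eq_mul_left_iff, -mul_eq_zero, -zero_eq_mul]
  and_intros <;> (try field_simp [h0]) <;> (try simp only [mu]) <;> (try field_simp [h0]) <;>
    (try ring1)

set_option maxHeartbeats 2000000 in
theorem res_famD_one (n : ZMod r) (f : Fam r V) :
    res χ 1 n (famD χ f) = critOne (χ 1) (res χ 1 n f) +
      (χ (n + 1) ^ 2 - 1) • critLink (χ 1) (res χ 0 (n + 1) f) := by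
  have h0 := chi_ne_zero χ
  have hres : ∀ l, res χ 0 (n + 1) f l =
      χ ((n + 1) * wt l) * f (-n - wt l - 1) (n + 1) (wt l) l := fun l => by
    rw [res_apply, sub_zero, sub_zero, neg_add, sub_right_comm (-n), ← sub_eq_add_neg]
  refine V_ext ?_
  simp only [res_apply χ 1, famD_apply, Fin.sum_univ_four, pull, Matrix.cons_val, thetaA_apply,
    thetaB_apply, thetaC_apply, thetaD_apply, wt]
  simp [leftTheta, leftE, rightE, La, Ld, Ra, Rb, Rc, Rd, critOne, critLink, res_apply χ 1, hres,
    wt, signV_apply, deg, AddChar.map_add_eq_mul, AddChar.map_sub_eq_div, AddChar.map_neg_eq_inv,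
    -mul_eq_mul_left_iff, -mul_eq_zero, -zero_eq_mul]
  and_intros <;> (try field_simp [h0]) <;> (try simp only [mu]) <;> (try field_simp [h0]) <;>
    (try ring1)
end

/-! ### Closed forms of given charges -/

section
variable {r : ℕ} (χ : AddChar (ZMod r) ℂ)

/-- The projection onto the families with charges `0` and `t`. -/
def chargeProj (t : ZMod r) : Module.End ℂ (Fam r V) :=
  chargeMul fun s t' => if s = 0 ∧ t' = t then 1 else 0

theorem chargeProj_apply (t : ZMod r) (f : Fam r V) (i j k : ZMod r) (l : Fin 16) :
    chargeProj t f i j k l = if i + j - k + 2 * wt l = 0 ∧ i - j + k = t then f i j k l else 0 := by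
  rw [chargeProj, chargeMul_apply_coord, ite_mul, one_mul, zero_mul]

theorem chargeProj_chargeProj (t : ZMod r) (f : Fam r V) :
    chargeProj t (chargeProj t f) = chargeProj t f := by
  funext i j k l
  simp only [chargeProj_apply]
  split_ifs <;> rfl

theorem sub_famD_chargeProj {t : ZMod r} {f : Fam r V} (hf : chargeProj t f = f) (g : Fam r V) :
    f - famD χ (chargeProj t g) = chargeProj t (f - famD χ g) := by
  rw [map_sub, hf, chargeProj, famD_chargeMul]

/-- Closed families of charges `0` and `t`. -/
structure IsClosed (t : ZMod r) (f : Fam r V) : Prop where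
  famD_eq_zero : famD χ f = 0
  proj_eq : chargeProj t f = f

variable {χ}

theorem IsClosed.charge {t : ZMod r} {f : Fam r V} (hf : IsClosed χ t f) {i j k : ZMod r}
    {l : Fin 16} (h : f i j k l ≠ 0) : i + j - k + 2 * wt l = 0 ∧ i - j + k = t := by
  by_contra hc
  apply h
  rw [← hf.proj_eq, chargeProj_apply, if_neg hc]

theorem chi_eq_one {x : ZMod r} [NeZero r] (hχ : IsPrimitiveRoot (χ 1 ^ 2) r) (h : χ x = 1) :
    x = 0 := by
  have h1 : (χ 1 ^ 2) ^ x.val = 1 := by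
    rw [← pow_mul, mul_comm, pow_mul, ← chi_eq_pow, h, one_pow]
  rw [← ZMod.val_eq_zero]
  exact Nat.eq_zero_of_dvd_of_lt (hχ.dvd_of_pow_eq_one _ h1) x.val_lt

theorem two_mul_eq_zero {x : ZMod r} [NeZero r] (hχ : IsPrimitiveRoot (χ 1 ^ 2) r)
    (h : 2 * x = 0) : x = 0 := by
  have h1 : (χ 1 ^ 2) ^ x.val = 1 := by
    rw [← pow_mul, mul_comm, pow_mul, ← chi_eq_pow, sq, ← AddChar.map_add_eq_mul, ← two_mul, h,
      AddChar.map_zero_eq_one]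
  rw [← ZMod.val_eq_zero]
  exact Nat.eq_zero_of_dvd_of_lt (hχ.dvd_of_pow_eq_one _ h1) x.val_lt

theorem mu_ne_zero [NeZero r] (hr : 3 ≤ r) (hχ : IsPrimitiveRoot (χ 1 ^ 2) r) :
    mu (χ 1) ≠ 0 := by
  have h := hχ.ne_one (by omega)
  rw [mu, inv_pow, sub_ne_zero, ne_comm, Ne, inv_eq_one]
  exact h

section
variable [NeZero r] [Fact (1 < r)] (hr : 3 ≤ r) (hχ : IsPrimitiveRoot (χ 1 ^ 2) r)

theorem IsClosed.sub {t : ZMod r} {f : Fam r V} (hf : IsClosed χ t f) (hr : 3 ≤ r)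
    (hχ : IsPrimitiveRoot (χ 1 ^ 2) r) (g : Fam r V) :
    IsClosed χ t (f - famD χ (chargeProj t g)) := by
  refine ⟨?_, ?_⟩
  · rw [map_sub, hf.1, ← Module.End.mul_apply, famD_mul_famD χ hr hχ]
    simp
  · rw [sub_famD_chargeProj χ hf.2, chargeProj_chargeProj]

/-- A noncritical top layer is exact. -/
theorem IsClosed.lower_layer {t : ZMod r} {f : Fam r V} (hf : IsClosed χ t f) {n : ℕ}
    (hb : Below (n + 1) f) (h1 : χ (t + 2 * n) ≠ 1) (h2 : χ (t + 2 * n + 2) ≠ 1) :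
    ∃ g, Below n (f - famD χ (chargeProj t g)) := by
  have h0 := chi_ne_zero χ
  let c := (χ (t + 2 * n))⁻¹ * (χ (t + 2 * n) - 1) * (χ 1 ^ 2 * χ (t + 2 * n) - 1)
  have hc : c ≠ 0 := by
    refine mul_ne_zero (mul_ne_zero (inv_ne_zero (h0 _)) (sub_ne_zero.2 h1)) (sub_ne_zero.2 ?_)
    rwa [sq, ← AddChar.map_add_eq_mul, ← AddChar.map_add_eq_mul, one_add_one_eq_two, add_comm]
  refine ⟨c⁻¹ • mapV (homC (χ 1)) f, ?_⟩
  rw [sub_famD_chargeProj χ hf.2]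
  refine Below.chargeMul (fun i j k hj => ?_) _
  have key := famD_homC χ f i j k
  have hz : famD χ f i j k = 0 := by rw [hf.1]; rfl
  rw [hz, map_zero, add_zero, mul_right_comm _ (χ (j + 1) ^ 2 - 1),
    mul_smul _ (χ (j + 1) ^ 2 - 1), hb.wrap χ hj, smul_zero, add_zero] at key
  rw [map_smul]
  simp only [Pi.sub_apply, Pi.smul_apply, key]
  funext l
  by_cases hl : f i j k l = 0
  · simp [hl]
  obtain ⟨-, ht⟩ := hf.charge hl
  have hjn : j = n := by
    rw [← ZMod.natCast_zmod_val j]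
    congr 1
    by_contra hne
    exact hl (congrFun (hb i j k (by omega)) l)
  have hs : i + j + k = t + 2 * n := by
    rw [← ht, hjn]
    ring
  rw [hs]
  change f i j k l - c⁻¹ * (c * f i j k l) = 0
  rw [inv_mul_cancel_left₀ hc, sub_self]

/-- Repeated removal of noncritical top layers. -/
theorem IsClosed.lower_layers {t : ZMod r} {f : Fam r V} (hf : IsClosed χ t f) (hr : 3 ≤ r)
    (hχ : IsPrimitiveRoot (χ 1 ^ 2) r) {m n : ℕ} (hmn : m ≤ n) (hb : Below n f)
    (h : ∀ p : ℕ, m ≤ p → p < n → χ (t + 2 * p) ≠ 1 ∧ χ (t + 2 * p + 2) ≠ 1) :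
    ∃ g, Below m (f - famD χ (chargeProj t g)) := by
  induction n, hmn using Nat.le_induction generalizing f with
  | base => exact ⟨0, by simpa using hb⟩
  | succ n hmn ih =>
    obtain ⟨h1, h2⟩ := h n hmn (by omega)
    obtain ⟨g, hg⟩ := hf.lower_layer hb h1 h2
    obtain ⟨g', hg'⟩ := ih (hf.sub hr hχ g) hg fun p hp hpn => h p hp (by omega)
    refine ⟨g + g', ?_⟩
    rwa [map_add, map_add, ← sub_sub]
end

/-- On a critical layer the charges `0` and `t` fix the exponents of `a` and `c` for each
coordinate of `V`, so that the critical coordinates `res` hold the whole layer. -/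
theorem IsClosed.layer_eq_zero [NeZero r] (hχ : IsPrimitiveRoot (χ 1 ^ 2) r) {t κ n : ZMod r}
    {f : Fam r V} (hf : IsClosed χ t f) (ht : t + 2 * n + 2 * κ = 0) (h : res χ κ n f = 0)
    (i k : ZMod r) : f i n k = 0 := by
  funext l
  by_contra hl
  obtain ⟨h1, h2⟩ := hf.charge hl
  have hi : i = -n - wt l - κ := by
    refine sub_eq_zero.1 (two_mul_eq_zero hχ ?_)
    linear_combination h1 + h2 + ht
  have hk : k = wt l - κ := by
    refine sub_eq_zero.1 ?_
    linear_combination -h1 + hi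
  rw [hi, hk] at hl
  exact mul_ne_zero (chi_ne_zero χ _) hl (congrFun h l)

theorem res_chargeProj {t κ n : ZMod r} (ht : t + 2 * n + 2 * κ = 0) (f : Fam r V) :
    res χ κ n (chargeProj t f) = res χ κ n f := by
  funext l
  rw [res_apply, res_apply, chargeProj_apply, if_pos]
  exact ⟨by ring, by linear_combination -ht⟩

variable (χ)

/-- The family in the layer `b ^ n` with given critical coordinates. -/
def ext (κ n : ZMod r) (v : V) : Fam r V := fun i j k l =>
  if i = -n - wt l - κ ∧ j = n ∧ k = wt l - κ then (χ (n * wt l))⁻¹ * v l else 0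

variable {χ}

theorem res_ext (κ n : ZMod r) (v : V) : res χ κ n (ext χ κ n v) = v := by
  funext l
  rw [res_apply, ext, if_pos ⟨rfl, rfl, rfl⟩, mul_inv_cancel_left₀ (chi_ne_zero χ _)]

theorem ext_eq_zero {κ n j : ZMod r} (h : j ≠ n) (v : V) (i k : ZMod r) :
    ext χ κ n v i j k = 0 :=
  funext fun _ => if_neg fun hj => h hj.2.1

theorem res_ext_of_ne {κ κ' n n' : ZMod r} (h : n ≠ n') (v : V) :
    res χ κ n (ext χ κ' n' v) = 0 := by
  funext l
  rw [res_apply, ext_eq_zero h]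
  exact mul_zero _

theorem ext_below {κ n : ZMod r} {m : ℕ} (h : n.val < m) (v : V) : Below m (ext χ κ n v) :=
  fun i _ k hj => ext_eq_zero (fun hn => by rw [hn] at hj; omega) v i k

end

/-! ### Closed forms modulo exact forms -/

section
variable {r : ℕ}

/-- The coefficient of `e_l a ^ i b ^ j c ^ k`. -/
def coeff (i j k : ZMod r) (l : Fin 16) : Fam r V →ₗ[ℂ] ℂ where
  toFun f := f i j k l
  map_add' _ _ := rfl
  map_smul' _ _ := rfl

theorem coeff_apply (i j k : ZMod r) (l : Fin 16) (f : Fam r V) : coeff i j k l f = f i j k l := rfl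

/-- Functionals on forms that vanish on exact forms and separate the cohomology classes. -/
def dual (q : ℂ) (r : ℕ) : Fin 16 → Fam r V →ₗ[ℂ] ℂ :=
  ![coeff 0 0 0 0,
    coeff 0 0 0 1 + q⁻¹ ^ 2 • coeff 1 1 0 2 - coeff (-1) 0 1 3,
    coeff 1 0 (-1) 2,
    coeff (-1) (-1) 0 3,
    coeff (-1) 0 1 3 - q⁻¹ ^ 2 • coeff 1 1 0 2,
    coeff 1 0 (-1) 9,
    coeff 1 0 (-1) 5,
    coeff (-1) (-1) 0 6,
    coeff (-1) (-1) 0 10,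
    coeff (-1) 0 1 6 - q⁻¹ ^ 2 • coeff 1 1 0 5,
    coeff 1 (-1) (-1 - 1) 5 + coeff 1 (-1) (-1 - 1) 9 + q⁻¹ • coeff 0 (-1) (-1) 8,
    coeff 0 (-1) (-1) 14 - coeff 0 (-1) (-1) 11,
    coeff 1 0 (-1) 12,
    coeff (-1) (-1) 0 13,
    coeff 1 (-1) (-1 - 1) 12 + q⁻¹ • coeff 0 (-1) (-1) 11,
    coeff 0 (-1) (-1) 15]

theorem natCast_val_sub_one [NeZero r] {j : ZMod r} {n : ℕ} (h : j.val = n + 1) :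
    (n : ZMod r) = j - 1 := by
  rw [← ZMod.natCast_zmod_val j, h]
  simp

variable {χ : AddChar (ZMod r) ℂ}

set_option maxHeartbeats 4000000 in
theorem dual_famD [Fact (1 < r)] (hr : 3 ≤ r) (l : Fin 16) (f : Fam r V) :
    dual (χ 1) r l (famD χ f) = 0 := by
  have h0 := chi_ne_zero χ
  have h2 : (1 : ZMod r) + 1 ≠ 0 := by simpa using natCast_succ_ne_zero (n := 1) hr
  have h2' : (-1 : ZMod r) - 1 ≠ 0 := by rwa [← neg_add', neg_ne_zero]
  fin_cases l <;>
    simp [dual, coeff_apply, famD_apply, Fin.sum_univ_four, pull, thetaA_apply, thetaB_apply,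
      thetaC_apply, thetaD_apply, leftTheta, leftE, rightE, La, Ld, Ra, Rb, Rc, Rd, signV_apply,
      deg, h2', AddChar.map_add_eq_mul, AddChar.map_sub_eq_div, AddChar.map_neg_eq_inv,
      -mul_eq_mul_left_iff, -mul_eq_zero, -zero_eq_mul] <;>
    (try simp only [mu]) <;> (try field_simp [h0]) <;> (try ring1)

theorem dual_chargeProj (l : Fin 16) (f : Fam r V) :
    dual (χ 1) r l (chargeProj 0 f) = dual (χ 1) r l f := by
  have h1 : (1 : ZMod r) + 1 = 2 := one_add_one_eq_two
  have h2 : (-1 : ZMod r) - 1 = -2 := by ring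
  have h3 : (-1 : ZMod r) + -1 + 2 = 0 := by ring
  fin_cases l <;> simp [dual, coeff_apply, chargeProj_apply, wt, h1, h2, h3]

theorem dual_sub_famD [Fact (1 < r)] (hr : 3 ≤ r) {f : Fam r V} (hF : ∀ l, dual (χ 1) r l f = 0)
    (g : Fam r V) (l : Fin 16) :
    dual (χ 1) r l (f - famD χ g) = 0 := by
  rw [map_sub, hF, dual_famD hr, sub_zero]

variable [NeZero r] [Fact (1 < r)]

/-- For `t ≠ 0` the two critical layers, at `j = -t / 2` and `j - 1`, are adjacent, and `critLink`
cancels their cohomologies. -/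
theorem IsClosed.exact_of_ne {t : ZMod r} {f : Fam r V} (hf : IsClosed χ t f) (hr : 3 ≤ r)
    (hχ : IsPrimitiveRoot (χ 1 ^ 2) r) (ht : t ≠ 0) : ∃ g, f = famD χ g := by
  have h0 := chi_ne_zero χ
  obtain ⟨j, hj⟩ : ∃ j : ZMod r, t + 2 * j = 0 := by
    have hinj : Function.Injective fun x : ZMod r => 2 * x := fun x y h =>
      sub_eq_zero.1 (two_mul_eq_zero hχ (by rw [mul_sub]; exact sub_eq_zero.2 h))
    obtain ⟨j, hj⟩ := (Finite.injective_iff_surjective.1 hinj) (-t)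
    exact ⟨j, by rw [show 2 * j = -t from hj, add_neg_cancel]⟩
  have hj0 : j ≠ 0 := by
    rintro rfl
    exact ht (by simpa using hj)
  obtain ⟨n, hn⟩ : ∃ n, j.val = n + 1 :=
    ⟨j.val - 1,
      (Nat.sub_add_cancel (Nat.pos_of_ne_zero fun h => hj0 ((ZMod.val_eq_zero j).1 h))).symm⟩
  have hnj := natCast_val_sub_one hn
  have hnr : n + 1 < r := hn ▸ j.val_lt
  have layers : ∀ p : ℕ, p < r → p ≠ n → p ≠ n + 1 →
      χ (t + 2 * p) ≠ 1 ∧ χ (t + 2 * p + 2) ≠ 1 := by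
    intro p hp h1 h2
    have hpc : (p : ZMod r) ≠ j := fun h => h2 (by rw [← hn, ← h, ZMod.val_cast_of_lt hp])
    have hpc' : (p : ZMod r) ≠ j - 1 := fun h => h1 (by
      rw [← hnj] at h
      rw [← ZMod.val_cast_of_lt hp, h, ZMod.val_cast_of_lt (by omega)])
    refine ⟨fun h => hpc (sub_eq_zero.1 (two_mul_eq_zero hχ ?_)),
      fun h => hpc' (sub_eq_zero.1 (two_mul_eq_zero hχ ?_))⟩
    · linear_combination chi_eq_one hχ h - hj
    · linear_combination chi_eq_one hχ h - hj
  obtain ⟨g1, hg1⟩ := hf.lower_layers hr hχ hnr (m := n + 2) (n := r)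
    (fun i j k hj => absurd j.val_lt (by omega)) fun p h1 h2 => layers p h2 (by omega) (by omega)
  have hf1 := hf.sub hr hχ g1
  set f1 := f - famD χ (chargeProj t g1)
  -- The two critical layers.
  have hwrap : ∀ {f : Fam r V}, Below (n + 2) f →
      ∀ i k, (χ (j + 1) ^ 2 - 1) • f i (j + 1) k = 0 := fun hb => hb.wrap χ (by omega)
  have hz : ∀ κ n, res χ κ n (famD χ f1) = 0 := fun κ n => by rw [hf1.1, map_zero]
  have hu := (res_famD_zero χ j f1 (hwrap hg1)).symm.trans (hz _ _)
  have huv := (res_famD_one χ (j - 1) f1).symm.trans (hz _ _)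
  rw [sub_add_cancel, ← map_smul] at huv
  have hc : χ j ^ 2 - 1 ≠ 0 := by
    rw [sub_ne_zero, sq, ← AddChar.map_add_eq_mul, ← two_mul]
    exact fun h => hj0 (two_mul_eq_zero hχ (chi_eq_one hχ h))
  obtain ⟨v, v', hv, hv'⟩ := critPair_exact (h0 1) (mu_ne_zero hr hχ)
    (u := (χ j ^ 2 - 1) • res χ 0 j f1) (by rw [map_smul, hu, smul_zero]) huv
  have hjj : j ≠ j - 1 := fun h => one_ne_zero (sub_eq_self.1 h.symm)
  let g2 := ext χ 0 j ((χ j ^ 2 - 1)⁻¹ • v) + ext χ 1 (j - 1) v'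
  have hb2 : Below (n + 2) g2 := fun i j' k h => by
    have e1 : Below (n + 2) (ext χ 0 j ((χ j ^ 2 - 1)⁻¹ • v)) := ext_below (by omega) _
    have e2 : Below (n + 2) (ext χ 1 (j - 1) v') := ext_below
      (by rw [← hnj, ZMod.val_cast_of_lt (by omega)]; omega) _
    change (ext χ 0 j _ i j' k + ext χ 1 (j - 1) v' i j' k : V) = 0
    rw [e1 i j' k h, e2 i j' k h, add_zero]
  have r0 : res χ 0 j g2 = (χ j ^ 2 - 1)⁻¹ • v := by
    rw [map_add, res_ext, res_ext_of_ne hjj, add_zero]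
  have r1 : res χ 1 (j - 1) g2 = v' := by
    rw [map_add, res_ext, res_ext_of_ne hjj.symm, zero_add]
  have hd0 : res χ 0 j (f1 - famD χ g2) = 0 := by
    rw [map_sub, res_famD_zero χ j g2 (hwrap hb2), r0, map_smul, hv, inv_smul_smul₀ hc, sub_self]
  have hd1 : res χ 1 (j - 1) (f1 - famD χ g2) = 0 := by
    rw [map_sub, res_famD_one, r1, sub_add_cancel, r0, map_smul, smul_inv_smul₀ hc, hv', sub_self]
  have hf2 := hf1.sub hr hχ g2
  have hb3 : Below (n + 2) (f1 - famD χ (chargeProj t g2)) := by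
    rw [sub_famD_chargeProj χ hf1.2]
    exact (hg1.sub (hb2.famD χ)).chargeMul _
  rw [← res_chargeProj (t := t) (by linear_combination hj), ← sub_famD_chargeProj χ hf1.2]
    at hd0 hd1
  have hb4 := (hb3.layer fun i k => by
    rw [Nat.cast_succ, hnj, sub_add_cancel]
    exact hf2.layer_eq_zero hχ (by linear_combination hj) hd0 i k).layer fun i k => by
      rw [hnj]
      exact hf2.layer_eq_zero hχ (by linear_combination hj) hd1 i k
  obtain ⟨g3, hg3⟩ := hf2.lower_layers hr hχ (Nat.zero_le n) hb4 fun p _ h2 =>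
    layers p (by omega) (by omega) (by omega)
  refine ⟨chargeProj t g1 + chargeProj t g2 + chargeProj t g3, ?_⟩
  rw [map_add, map_add, ← sub_eq_zero, ← sub_sub, ← sub_sub]
  funext i j k
  exact hg3 i j k (Nat.zero_le _)

/-- For `t = 0` the critical layers are the lowest and the highest, and are not adjacent. -/
theorem IsClosed.exact_of_dual {f : Fam r V} (hf : IsClosed χ 0 f) (hr : 3 ≤ r)
    (hχ : IsPrimitiveRoot (χ 1 ^ 2) r) (hF : ∀ l, dual (χ 1) r l f = 0) :
    ∃ g, f = famD χ g := by
  have h0 := chi_ne_zero χ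
  have hm := mu_ne_zero hr hχ
  obtain ⟨n, hn⟩ : ∃ n, r = n + 2 := ⟨r - 2, by omega⟩
  have hnj : ((n + 1 : ℕ) : ZMod r) = -1 := by
    rw [eq_neg_iff_add_eq_zero, ← Nat.cast_succ, ← Nat.succ_eq_add_one,
      show n.succ.succ = r from hn.symm]
    exact ZMod.natCast_self r
  have hb : Below (n + 2) f := fun i j k hj => absurd j.val_lt (by omega)
  -- The top layer.
  have hv : critOne (χ 1) (res χ 1 (-1) f) = 0 := by
    have h := res_famD_one χ (-1) f
    rw [hf.1, map_zero, neg_add_cancel, AddChar.map_zero_eq_one, one_pow, sub_self, zero_smul,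
      add_zero] at h
    exact h.symm
  have e := hF
  have e3 := e 3
  have e7 := e 7
  have e8 := e 8
  have e10 := e 10
  have e11 := e 11
  have e13 := e 13
  have e14 := e 14
  have e15 := e 15
  simp only [dual, Matrix.cons_val, LinearMap.add_apply, LinearMap.sub_apply, LinearMap.smul_apply,
    coeff_apply, smul_eq_mul] at e3 e7 e8 e10 e11 e13 e14 e15
  obtain ⟨v, hv'⟩ := critOne_exact hm hv (by simp [res_apply, wt, e3]) (by simp [res_apply, wt, e7])
    (by simp [res_apply, wt, e8])
    (by
      simp [res_apply, wt]
      linear_combination χ 1 * e10 - (mul_inv_cancel₀ (h0 1)) * f 0 (-1) (-1) 8)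
    (by simp [res_apply, wt, e11]) (by simp [res_apply, wt, e13])
    (by
      simp [res_apply, wt]
      linear_combination χ 1 * e14 - (mul_inv_cancel₀ (h0 1)) * f 0 (-1) (-1) 11)
    (by simp [res_apply, wt, e15])
  have hd : res χ 1 (-1) (f - famD χ (ext χ 1 (-1) v)) = 0 := by
    rw [map_sub, res_famD_one, res_ext, neg_add_cancel, AddChar.map_zero_eq_one, one_pow, sub_self,
      zero_smul, add_zero, hv', sub_self]
  rw [← res_chargeProj (t := 0) (by ring), ← sub_famD_chargeProj χ hf.2] at hd
  have hf1 := hf.sub hr hχ (ext χ 1 (-1) v)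
  have hF1 := dual_sub_famD hr hF (chargeProj 0 (ext χ 1 (-1) v))
  set f1 := f - famD χ (chargeProj 0 (ext χ 1 (-1) v))
  have hb1 : Below (n + 1) f1 := Below.layer (fun i j k hj => absurd j.val_lt (by omega))
    fun i k => by
      rw [hnj]
      exact hf1.layer_eq_zero hχ (by ring) hd i k
  -- The layers in between.
  obtain ⟨g2, hb2⟩ := hf1.lower_layers hr hχ (m := 1) (by omega) hb1 fun p h1 h2 => by
    have hp : (p : ZMod r) ≠ 0 := by
      obtain ⟨p, rfl⟩ := Nat.exists_eq_add_of_le' h1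
      simpa using natCast_succ_ne_zero (n := p) (r := r) (by omega)
    refine ⟨fun h => hp (two_mul_eq_zero hχ ?_),
      fun h => natCast_succ_ne_zero (n := p) (r := r) (by omega) (two_mul_eq_zero hχ ?_)⟩
    · linear_combination chi_eq_one hχ h
    · linear_combination chi_eq_one hχ h
  have hf2 := hf1.sub hr hχ g2
  have hF2 := dual_sub_famD hr hF1 (chargeProj 0 g2)
  set f2 := f1 - famD χ (chargeProj 0 g2)
  -- The lowest layer.
  have hone : (1 : ZMod r).val = 1 := ZMod.val_one r
  have hz : ∀ i k, f2 i 1 k = 0 := fun i k => hb2 i 1 k (by rw [hone])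
  have hu : critZero (χ 1) (res χ 0 0 f2) = 0 := by
    rw [← res_famD_zero, hf2.1, map_zero]
    intro i k
    rw [zero_add, hz, smul_zero]
  have e := hF2
  have e0 := e 0
  have e1 := e 1
  have e2 := e 2
  have e4 := e 4
  have e5 := e 5
  have e6 := e 6
  have e9 := e 9
  have e12 := e 12
  simp only [dual, Matrix.cons_val, LinearMap.add_apply, LinearMap.sub_apply, LinearMap.smul_apply,
    coeff_apply, hz, Pi.zero_apply, smul_zero, add_zero, sub_zero] at e0 e1 e2 e4 e5 e6 e9 e12
  obtain ⟨u, hu'⟩ := critZero_exact hm hu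
    (by simp [res_apply, wt, e0]) (by simp [res_apply, wt, e2])
    (by simp [res_apply, wt, e4]) (by simpa [res_apply, wt] using e1)
    (by simp [res_apply, wt, e5]) (by simp [res_apply, wt, e6]) (by simp [res_apply, wt, e9])
    (by simp [res_apply, wt, e12])
  have hbe : Below 1 (ext χ 0 0 u) := ext_below (by simp) u
  have hd2 : res χ 0 0 (f2 - famD χ (ext χ 0 0 u)) = 0 := by
    rw [map_sub, res_famD_zero, res_ext, hu', sub_self]
    intro i k
    rw [zero_add, hbe i 1 k (by rw [hone]), smul_zero]
  rw [← res_chargeProj (t := 0) (by ring), ← sub_famD_chargeProj χ hf2.2] at hd2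
  have hb3 : Below 1 (f2 - famD χ (chargeProj 0 (ext χ 0 0 u))) := by
    rw [sub_famD_chargeProj χ hf2.2]
    exact (hb2.sub (hbe.famD χ)).chargeMul _
  have hb4 := hb3.layer (n := 0) fun i k => by
    rw [Nat.cast_zero]
    exact (hf2.sub hr hχ _).layer_eq_zero hχ (by ring) hd2 i k
  refine ⟨chargeProj 0 (ext χ 1 (-1) v) + chargeProj 0 g2 + chargeProj 0 (ext χ 0 0 u), ?_⟩
  rw [map_add, map_add, ← sub_eq_zero, ← sub_sub, ← sub_sub]
  funext i j k
  exact hb4 i j k (Nat.zero_le _)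

/-- A closed form on which the dual functionals vanish is exact. -/
theorem exists_famD_eq (hr : 3 ≤ r) (hχ : IsPrimitiveRoot (χ 1 ^ 2) r) {f : Fam r V}
    (hf : famD χ f = 0) (hF : ∀ l, dual (χ 1) r l f = 0) : ∃ g, f = famD χ g := by
  have hcl : ∀ t, IsClosed χ t (chargeProj t f) := fun t =>
    ⟨by rw [chargeProj, famD_chargeMul, hf, map_zero], chargeProj_chargeProj t f⟩
  have hex : ∀ t, ∃ g, chargeProj t f = famD χ g := fun t => by
    by_cases ht : t = 0
    · subst ht
      exact (hcl 0).exact_of_dual hr hχ fun l => by rw [dual_chargeProj, hF]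
    · exact (hcl t).exact_of_ne hr hχ ht
  choose g hg using hex
  let c : ZMod r → ZMod r → ℂ := fun s _ => if s = 0 then 0 else (χ s - 1)⁻¹
  have hK : chargeMul c (famD χ (mapV dera f)) = f - ∑ t, chargeProj t f := by
    have h := famD_dera χ f
    rw [hf, map_zero, add_zero] at h
    rw [h]
    funext i j k l
    simp only [chargeMul_apply_coord, Pi.sub_apply, Finset.sum_apply, chargeProj_apply, c]
    by_cases hs : i + j - k + 2 * wt l = 0
    · simp [hs]
    · have : χ (i + j - k + 2 * wt l) - 1 ≠ 0 :=
        sub_ne_zero.2 fun h => hs (chi_eq_one hχ h)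
      simp [hs, this]
  refine ⟨chargeMul c (mapV dera f) + ∑ t, g t, ?_⟩
  rw [map_add, map_sum, famD_chargeMul, hK, ← Finset.sum_congr rfl fun t _ => hg t,
    sub_add_cancel]
end

/-! ### Representatives of the cohomology classes -/

section
variable {r : ℕ} (χ : AddChar (ZMod r) ℂ)

/-- The component of `d (v a ^ i b ^ j c ^ k)` at `a ^ i b ^ j c ^ k`. -/
def dSame (i j k : ZMod r) (v : V) : V :=
  (χ i * χ j * (χ k)⁻¹) • rightE (χ 1) 0 (signV v) +
    ((χ 1)⁻¹ ^ 2 * (χ i)⁻¹ * (χ j)⁻¹ * (χ k)⁻¹ + χ i * χ j * χ k -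
      (χ 1)⁻¹ ^ 2 * χ i * χ j * (χ k)⁻¹) • rightE (χ 1) 3 (signV v) - leftTheta (χ 1) v

/-- The component of `d (v a ^ i b ^ j c ^ k)` at `a ^ (i + 1) b ^ j c ^ (k - 1)`. -/
def dB (j k : ZMod r) (v : V) : V :=
  ((χ 1)⁻¹ * (χ k - (χ k)⁻¹) * χ j) • rightE (χ 1) 1 (signV v)

/-- The component of `d (v a ^ i b ^ j c ^ k)` at `a ^ (i - 1) b ^ j c ^ (k + 1)`. -/
def dC (i j k : ZMod r) (v : V) : V :=
  (if k + 1 = 0 then 0 else (χ 1)⁻¹ ^ 2 * (χ j)⁻¹ * (χ k)⁻¹ * (χ i ^ 2 * χ j ^ 2 - 1)) •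
    rightE (χ 1) 2 (signV v)

/-- The component of `d (v a ^ i b ^ j c ^ k)` at `a ^ (i - 1) b ^ (j - 1) c ^ k`. -/
def dCB (j k : ZMod r) (v : V) : V :=
  ((χ 1)⁻¹ * (χ j)⁻¹ * (χ k)⁻¹ * (χ j ^ 2 - 1)) • rightE (χ 1) 2 (signV v)

/-- The component of `d (v a ^ i b ^ j c ^ k)` at `a ^ i b ^ (j - 1) c ^ (k - 1)`. -/
def dBC (i j k : ZMod r) (v : V) : V :=
  ((χ 1)⁻¹ * (χ i)⁻¹ * (χ j)⁻¹ * (χ k)⁻¹ * (χ j ^ 2 - 1) * (χ k ^ 2 - 1)) •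
    rightE (χ 1) 3 (signV v)

theorem single_apply {E : Type} [AddCommGroup E] (i j k : ZMod r) (v : E) (i' j' k' : ZMod r) :
    single i j k v i' j' k' = if i' = i ∧ j' = j ∧ k' = k then v else 0 := rfl

/-- The exponents are cyclic: a term that would wrap around the top power of `b` or `c` has
coefficient zero. -/
theorem famD_single (i j k : ZMod r) (v : V) : famD χ (single i j k v) =
    single i j k (dSame χ i j k v) + single (i + 1) j (k - 1) (dB χ j k v) +
      single (i - 1) j (k + 1) (dC χ i j k v) + single (i - 1) (j - 1) k (dCB χ j k v) +
      single i (j - 1) (k - 1) (dBC χ i j k v) := by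
  have eA : thetaA χ (single i j k v) = single i j k ((χ i * χ j * (χ k)⁻¹) • v) := by
    funext i' j' k'
    rw [thetaA_apply, single_apply, single_apply]
    split_ifs with h
    · obtain ⟨rfl, rfl, rfl⟩ := h
      rfl
    · exact smul_zero _
  have eB : thetaB χ (single i j k v) =
      single (i + 1) j (k - 1) (((χ 1)⁻¹ * (χ k - (χ k)⁻¹) * χ j) • v) := by
    funext i' j' k'
    rw [thetaB_apply, single_apply, single_apply]
    simp only [sub_eq_iff_eq_add, eq_sub_iff_add_eq]
    split_ifs with h
    · obtain ⟨rfl, rfl, rfl⟩ := h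
      rfl
    · exact smul_zero _
  have eC : thetaC χ (single i j k v) =
      single (i - 1) j (k + 1) ((if k + 1 = 0 then 0 else
        (χ 1)⁻¹ ^ 2 * (χ j)⁻¹ * (χ k)⁻¹ * (χ i ^ 2 * χ j ^ 2 - 1)) • v) +
      single (i - 1) (j - 1) k (((χ 1)⁻¹ * (χ j)⁻¹ * (χ k)⁻¹ * (χ j ^ 2 - 1)) • v) := by
    funext i' j' k'
    simp only [thetaC_apply, Pi.add_apply, single_apply, sub_eq_iff_eq_add, eq_sub_iff_add_eq]
    congr 1
    · by_cases h : i' + 1 = i ∧ j' = j ∧ k' = k + 1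
      · obtain ⟨rfl, rfl, rfl⟩ := h
        by_cases hk : k + 1 = 0 <;> simp [hk]
      · simp [h]
    · split_ifs with h
      · obtain ⟨rfl, rfl, rfl⟩ := h
        rfl
      · exact smul_zero _
  have eD : thetaD χ (single i j k v) =
      single i j k (((χ 1)⁻¹ ^ 2 * (χ i)⁻¹ * (χ j)⁻¹ * (χ k)⁻¹ + χ i * χ j * χ k -
        (χ 1)⁻¹ ^ 2 * χ i * χ j * (χ k)⁻¹) • v) +
      single i (j - 1) (k - 1) (((χ 1)⁻¹ * (χ i)⁻¹ * (χ j)⁻¹ * (χ k)⁻¹ * (χ j ^ 2 - 1) *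
        (χ k ^ 2 - 1)) • v) := by
    funext i' j' k'
    simp only [thetaD_apply, Pi.add_apply, single_apply, eq_sub_iff_add_eq]
    congr 1
    · split_ifs with h
      · obtain ⟨rfl, rfl, rfl⟩ := h
        rfl
      · exact smul_zero _
    · split_ifs with h
      · obtain ⟨rfl, rfl, rfl⟩ := h
        rfl
      · exact smul_zero _
  funext i' j' k'
  simp only [famD_apply, Fin.sum_univ_four, pull, Matrix.cons_val, eA, eB, eC, eD, Pi.add_apply,
    single_apply, dSame, dB, dC, dCB, dBC, map_add, map_smul, apply_ite signV,
    apply_ite (rightE (χ 1) 0), apply_ite (rightE (χ 1) 1), apply_ite (rightE (χ 1) 2),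
    apply_ite (rightE (χ 1) 3), apply_ite (leftTheta (χ 1)), map_zero]
  by_cases h : i' = i ∧ j' = j ∧ k' = k
  · simp only [h, and_self, if_true]
    abel
  · simp only [h, if_false]
    abel

/-- The basis vectors of `V`. -/
def E (l : Fin 16) : V := Pi.single l 1

/-- Closed forms whose classes are a basis of the cohomology, in coordinates. -/
def rep (q : ℂ) (r : ℕ) : Fin 16 → Fam r V :=
  ![single 0 0 0 (E 0),
    single 0 0 0 (E 1 + E 4),
    single 1 0 (-1) (E 2),
    single (-1) (-1) 0 (E 3),
    single 0 0 0 (E 1) + single (-1) 0 1 (E 3),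
    single 1 0 (-1) (E 9),
    single 1 0 (-1) (E 5),
    single (-1) (-1) 0 (E 6),
    single (-1) (-1) 0 (E 10),
    single (-1) 0 1 (E 6 - E 10) - single 0 0 0 (E 7),
    single 1 (-1) (-1 - 1) (E 9) + q ^ 4 • single (-1) (-1 - 1) (-1) (E 10),
    single 0 (-1) (-1) (E 14),
    single 1 0 (-1) (E 12),
    single (-1) (-1) 0 (E 13),
    single 1 (-1) (-1 - 1) (E 12) + q ^ 4 • single (-1) (-1 - 1) (-1) (E 13),
    single 0 (-1) (-1) (E 15)]

theorem single_zero {E : Type} [AddCommGroup E] (i j k : ZMod r) :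
    single i j k (0 : E) = 0 := by
  funext i' j' k'
  exact ite_self _

theorem famD_single_eq_zero {i j k : ZMod r} {v : V} (h1 : dSame χ i j k v = 0)
    (h2 : dB χ j k v = 0) (h3 : dC χ i j k v = 0) (h4 : dCB χ j k v = 0) (h5 : dBC χ i j k v = 0) :
    famD χ (single i j k v) = 0 := by
  rw [famD_single, h1, h2, h3, h4, h5]
  simp only [single_zero, add_zero]

set_option maxHeartbeats 4000000 in
/-- The representatives and the functionals are dual to each other, which gives the linear
independence of the classes. -/
theorem dual_rep [Fact (1 < r)] (hr : 3 ≤ r) (l m : Fin 16) :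
    dual (χ 1) r l (rep (χ 1) r m) = if l = m then 1 else 0 := by
  have h0 := chi_ne_zero χ
  have h2 : (1 : ZMod r) + 1 ≠ 0 := by simpa using natCast_succ_ne_zero (n := 1) hr
  have h2' : (-1 : ZMod r) - 1 ≠ 0 := by rwa [← neg_add', neg_ne_zero]
  have h3 : (1 : ZMod r) ≠ -1 := fun h => h2 (eq_neg_iff_add_eq_zero.1 h)
  have h5 : (-1 : ZMod r) ≠ -1 - 1 := fun h => one_ne_zero (sub_eq_self.1 h.symm)
  have h6 : (0 : ZMod r) ≠ -1 := (neg_ne_zero.2 one_ne_zero).symm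
  have h7 : (0 : ZMod r) ≠ -1 - 1 := h2'.symm
  fin_cases l <;> fin_cases m <;>
    simp only [dual, coeff_apply, rep, single_apply, E, Matrix.cons_val, Fin.reduceFinMk,
      Fin.zero_eta, Fin.mk_one, Fin.isValue, LinearMap.add_apply, LinearMap.sub_apply,
      LinearMap.smul_apply, Pi.add_apply, Pi.sub_apply, Pi.smul_apply, smul_eq_mul, ite_apply,
      Pi.zero_apply, h2', h3, h3.symm, h5, h5.symm, h6, h6.symm, h7, zero_ne_one,
      one_ne_zero, and_true, and_false, false_and, if_true, if_false, ne_eq,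
      not_false_eq_true, Pi.single_eq_same, Pi.single_eq_of_ne, Fin.reduceEq, mul_zero, add_zero,
      zero_add, sub_zero, sub_self]

theorem single_smul (i j k : ZMod r) (c : ℂ) (v : V) :
    single i j k (c • v) = c • single i j k v := by
  funext i' j' k'
  simp only [Pi.smul_apply, single_apply]
  split_ifs
  · rfl
  · exact (smul_zero c).symm

theorem famD_single_add_single_C {i j k : ZMod r} {v w : V}
    (h1 : dSame χ i j k v + dB χ j (k + 1) w = 0) (h2 : dB χ j k v = 0)
    (h3 : dC χ i j k v + dSame χ (i - 1) j (k + 1) w = 0) (h4 : dCB χ j k v = 0)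
    (h5 : dBC χ i j k v = 0) (h6 : dC χ (i - 1) j (k + 1) w = 0) (h7 : dCB χ j (k + 1) w = 0)
    (h8 : dBC χ (i - 1) j (k + 1) w = 0) :
    famD χ (single i j k v + single (i - 1) j (k + 1) w) = 0 := by
  rw [map_add, famD_single, famD_single, h2, h4, h5, h6, h7, h8, eq_neg_of_add_eq_zero_left h1,
    eq_neg_of_add_eq_zero_left h3]
  simp only [single_zero, add_zero, sub_add_cancel, add_sub_cancel_right,
    ← neg_one_smul ℂ (dB _ _ _ _), ← neg_one_smul ℂ (dSame _ _ _ _ _), single_smul]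
  module

theorem famD_single_add_single_CB {i j k : ZMod r} {v w : V} (h1 : dSame χ i j k v = 0)
    (h2 : dB χ j k v = 0) (h3 : dC χ i j k v = 0)
    (h4 : dCB χ j k v + dB χ (j - 1) (k + 1) w = 0) (h5 : dBC χ i j k v = 0)
    (h6 : dSame χ (i - 1 - 1) (j - 1) (k + 1) w = 0) (h7 : dC χ (i - 1 - 1) (j - 1) (k + 1) w = 0)
    (h8 : dCB χ (j - 1) (k + 1) w = 0) (h9 : dBC χ (i - 1 - 1) (j - 1) (k + 1) w = 0) :
    famD χ (single i j k v + single (i - 1 - 1) (j - 1) (k + 1) w) = 0 := by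
  rw [map_add, famD_single, famD_single, h1, h2, h3, h5, h6, h7, h8, h9,
    eq_neg_of_add_eq_zero_left h4]
  simp only [single_zero, add_zero, zero_add, sub_add_cancel, add_sub_cancel_right,
    ← neg_one_smul ℂ (dB _ _ _ _), single_smul]
  module

set_option maxHeartbeats 4000000 in
theorem famD_rep [Fact (1 < r)] (l : Fin 16) : famD χ (rep (χ 1) r l) = 0 := by
  have h0 := chi_ne_zero χ
  have e4 : rep (χ 1) r 4 = single 0 0 0 (E 1) + single (0 - 1) 0 (0 + 1) (E 3) := by
    simp [rep]
  have e9 : rep (χ 1) r 9 =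
      single 0 0 0 ((-1 : ℂ) • E 7) + single (0 - 1) 0 (0 + 1) (E 6 - E 10) := by
    rw [single_smul, neg_one_smul, neg_add_eq_sub, zero_sub, zero_add]
    rfl
  have e10 : rep (χ 1) r 10 = single 1 (-1) (-1 - 1) (E 9) +
      single (1 - 1 - 1) (-1 - 1) (-1 - 1 + 1) (χ 1 ^ 4 • E 10) := by
    rw [single_smul, sub_self, zero_sub, sub_add_cancel]
    rfl
  have e14 : rep (χ 1) r 14 = single 1 (-1) (-1 - 1) (E 12) +
      single (1 - 1 - 1) (-1 - 1) (-1 - 1 + 1) (χ 1 ^ 4 • E 13) := by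
    rw [single_smul, sub_self, zero_sub, sub_add_cancel]
    rfl
  fin_cases l
  all_goals first
    | refine e4 ▸ famD_single_add_single_C χ ?_ ?_ ?_ ?_ ?_ ?_ ?_ ?_
    | refine e9 ▸ famD_single_add_single_C χ ?_ ?_ ?_ ?_ ?_ ?_ ?_ ?_
    | refine e10 ▸ famD_single_add_single_CB χ ?_ ?_ ?_ ?_ ?_ ?_ ?_ ?_ ?_
    | refine e14 ▸ famD_single_add_single_CB χ ?_ ?_ ?_ ?_ ?_ ?_ ?_ ?_ ?_
    | refine famD_single_eq_zero χ ?_ ?_ ?_ ?_ ?_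
  all_goals
    refine V_ext ?_
    simp only [dSame, dB, dC, dCB, dBC, E, leftTheta, leftE, rightE, La, Ld, Ra, Rb, Rc, Rd,
      signV_apply, deg, Matrix.cons_val, LinearMap.pi_apply, LinearMap.proj_apply,
      LinearMap.add_apply, LinearMap.sub_apply, LinearMap.neg_apply, LinearMap.smul_apply,
      LinearMap.zero_apply, Pi.add_apply, Pi.sub_apply, Pi.smul_apply, Pi.zero_apply,
      smul_eq_mul, Pi.single_eq_same, Pi.single_eq_of_ne, ne_eq, Fin.isValue, Fin.reduceEq,
      not_false_eq_true, zero_add, add_zero, sub_self, zero_sub, sub_add_cancel,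
      neg_add_cancel, zero_mul, mul_zero, neg_zero, sub_zero, if_true, if_false,
      one_ne_zero, neg_eq_zero,
      AddChar.map_zero_eq_one, AddChar.map_neg_eq_inv, AddChar.map_sub_eq_div, one_pow, inv_one]
  all_goals
    (try and_intros) <;> (try simp only [mu]) <;> (try field_simp [h0]) <;> ring1
end

/-! ### The cohomology -/

section
variable {r : ℕ} (χ : AddChar (ZMod r) ℂ)

theorem degProj_single {n : ℕ} {v : V} (hv : degProj n v = v) (i j k : ZMod r) :
    single i j k v ∈ famDeg r n := by
  rw [mem_famDeg]
  intro i' j' k'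
  rw [single_apply]
  split_ifs
  · exact hv
  · exact map_zero _

theorem degProj_E (l : Fin 16) : degProj (deg l) (E l) = E l :=
  degProj_eq_self_iff.2 fun m hm => Pi.single_eq_of_ne (fun h => hm (by rw [h])) _

theorem rep_mem (q : ℂ) (l : Fin 16) : rep q r l ∈ famDeg r (deg l) := by
  have hE : ∀ (m : Fin 16) (i j k : ZMod r), single i j k (E m) ∈ famDeg r (deg m) :=
    fun m => degProj_single (degProj_E m)
  fin_cases l
  · exact hE 0 _ _ _
  · exact degProj_single (n := 1)
      (by rw [map_add]; exact congrArg₂ _ (degProj_E 1) (degProj_E 4)) _ _ _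
  · exact hE 2 _ _ _
  · exact hE 3 _ _ _
  · exact add_mem (hE 1 _ _ _) (hE 3 _ _ _)
  · exact hE 9 _ _ _
  · exact hE 5 _ _ _
  · exact hE 6 _ _ _
  · exact hE 10 _ _ _
  · exact sub_mem (degProj_single (n := 2)
      (by rw [map_sub]; exact congrArg₂ _ (degProj_E 6) (degProj_E 10)) _ _ _) (hE 7 _ _ _)
  · exact add_mem (hE 9 _ _ _) (Submodule.smul_mem _ _ (hE 10 _ _ _))
  · exact hE 14 _ _ _
  · exact hE 12 _ _ _
  · exact hE 13 _ _ _
  · exact add_mem (hE 12 _ _ _) (Submodule.smul_mem _ _ (hE 13 _ _ _))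
  · exact hE 15 _ _ _

theorem dual_eq_zero (q : ℂ) {n : ℕ} {l : Fin 16} (hl : deg l ≠ n) {f : Fam r V}
    (hf : f ∈ famDeg r n) : dual q r l f = 0 := by
  have h : ∀ i j k m, deg m = deg l → f i j k m = 0 := fun i j k m hm =>
    degProj_eq_self_iff.1 (mem_famDeg.1 hf i j k) m (by rwa [hm])
  fin_cases l <;> simp [dual, coeff_apply] <;> repeat rw [h]
  all_goals first | rfl | simp

theorem degProj_famD (n : ℕ) (g : Fam r V) :
    mapV (degProj (n + 1)) (famD χ g) = famD χ (mapV (degProj n) g) := by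
  rw [← Module.End.mul_apply, degProj, mapV_gradeV_mul_famD]
  simp only [Nat.add_right_cancel_iff]
  rfl

theorem degProj_zero_famD (g : Fam r V) : mapV (degProj 0) (famD χ g) = 0 := by
  have h : (gradeV fun _ => 0) = 0 := LinearMap.ext fun v => funext fun l => zero_mul _
  rw [← Module.End.mul_apply, degProj, mapV_gradeV_mul_famD]
  simp only [Nat.add_eq_zero_iff, one_ne_zero, and_false, if_false, h, map_zero, mul_zero]
  rfl

variable [NeZero r] [Fact (1 < r)]

theorem extD_formRec (hr : 3 ≤ r) (hχ : IsPrimitiveRoot (χ 1 ^ 2) r) {n : ℕ} {f : Fam r V}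
    (hf : f ∈ famDeg r n) :
    extD (χ 1) r n (formRec (χ 1) r f) = formRec (χ 1) r (famD χ f) := by
  have h := formRec_mem (χ 1) hf
  rw [← formRec_formCoord χ hr hχ (extD_mem (χ 1) r h), formCoord_extD χ hr hχ h,
    formCoord_formRec]

theorem dual_formCoord_coboundaries (hr : 3 ≤ r) (hχ : IsPrimitiveRoot (χ 1 ^ 2) r) (l : Fin 16)
    {n : ℕ} {ω : Omega (χ 1) r} (hω : ω ∈ coboundaries (χ 1) r n) :
    dual (χ 1) r l (formCoord χ hr hχ ω) = 0 := by
  cases n with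
  | zero => rw [(Submodule.mem_bot ℂ).1 hω, map_zero, map_zero]
  | succ n =>
    obtain ⟨η, hη, rfl⟩ := hω
    rw [formCoord_extD χ hr hχ hη, dual_famD hr]

/-- A closed form is, up to an exact form, the combination of the representatives given by the
dual functionals. -/
theorem sub_sum_dual_mem (hr : 3 ≤ r) (hχ : IsPrimitiveRoot (χ 1 ^ 2) r) {n : ℕ}
    {ω : Omega (χ 1) r} (hω : ω ∈ cocycles (χ 1) r n) :
    ω - ∑ l : {l : Fin 16 // deg l = n}, dual (χ 1) r l (formCoord χ hr hχ ω) •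
      formRec (χ 1) r (rep (χ 1) r l) ∈ coboundaries (χ 1) r n := by
  obtain ⟨hωn, hωd⟩ := hω
  let f := formCoord χ hr hχ ω
  let f' := f - ∑ l : {l : Fin 16 // deg l = n}, dual (χ 1) r l f • rep (χ 1) r l
  have hf : f ∈ famDeg r n := formCoord_mem χ hr hχ hωn
  have hrep : ∀ l : {l : Fin 16 // deg l = n}, rep (χ 1) r l ∈ famDeg r n := fun l => by
    simpa only [l.2] using rep_mem (χ 1) (r := r) (l : Fin 16)
  have hf' : f' ∈ famDeg r n :=
    sub_mem hf (Submodule.sum_mem _ fun l _ => Submodule.smul_mem _ _ (hrep l))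
  have hω' : ω - ∑ l : {l : Fin 16 // deg l = n},
      dual (χ 1) r l f • formRec (χ 1) r (rep (χ 1) r l) = formRec (χ 1) r f' := by
    rw [map_sub, map_sum, formRec_formCoord χ hr hχ hωn]
    simp only [map_smul]
  have hd : famD χ f' = 0 := by
    have h1 : famD χ f = 0 := by
      rw [← formCoord_extD χ hr hχ hωn, LinearMap.mem_ker.1 hωd, map_zero]
    rw [map_sub, h1, map_sum]
    simp only [map_smul, famD_rep, smul_zero, Finset.sum_const_zero, sub_zero]
  obtain ⟨g, hg⟩ := exists_famD_eq hr hχ hd fun m => by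
    by_cases hm : deg m = n
    · rw [map_sub, map_sum]
      simp only [map_smul, dual_rep χ hr, smul_eq_mul, mul_ite, mul_one, mul_zero]
      rw [Finset.sum_eq_single ⟨m, hm⟩, if_pos rfl, sub_self]
      · exact fun l _ hl => if_neg fun h => hl (Subtype.ext h.symm)
      · exact fun h => absurd (Finset.mem_univ _) h
    · exact dual_eq_zero (χ 1) hm hf'
  have hp : mapV (degProj n) f' = f' := hf'
  change ω - ∑ l : {l : Fin 16 // deg l = n}, dual (χ 1) r l f • formRec (χ 1) r (rep (χ 1) r l) ∈ _
  rw [hω', ← hp, hg]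
  cases n with
  | zero =>
    rw [degProj_zero_famD, map_zero]
    exact Submodule.zero_mem _
  | succ n =>
    have hgn : mapV (degProj n) g ∈ famDeg r n := by
      change mapV (degProj n) (mapV (degProj n) g) = mapV (degProj n) g
      rw [← Module.End.mul_apply, ← map_mul, degProj, gradeV_mul_gradeV]
      congr 3
      funext m
      split_ifs <;> simp
    rw [degProj_famD, ← extD_formRec χ hr hχ hgn]
    exact ⟨_, formRec_mem _ hgn, rfl⟩

theorem formRec_rep_mem (hr : 3 ≤ r) (hχ : IsPrimitiveRoot (χ 1 ^ 2) r) {n : ℕ}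
    (l : {l : Fin 16 // deg l = n}) : formRec (χ 1) r (rep (χ 1) r l) ∈ cocycles (χ 1) r n := by
  obtain ⟨l, rfl⟩ := l
  refine ⟨formRec_mem _ (rep_mem _ l), LinearMap.mem_ker.2 ?_⟩
  rw [extD_formRec χ hr hχ (rep_mem _ l), famD_rep, map_zero]

/-- The dual functionals give the linear independence of the classes, and `sub_sum_dual_mem` shows
that they span. -/
theorem representBasis_rep (hr : 3 ≤ r) (hχ : IsPrimitiveRoot (χ 1 ^ 2) r) (n : ℕ) :
    RepresentBasis (χ 1) r n fun l : {l : Fin 16 // deg l = n} =>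
      formRec (χ 1) r (rep (χ 1) r l) := by
  refine ⟨formRec_rep_mem χ hr hχ, ?_, eq_top_iff.2 fun x _ => ?_⟩
  · -- The dual functionals descend to the cohomology.
    let φ : DeRham (χ 1) r n →ₗ[ℂ] ({l : Fin 16 // deg l = n} → ℂ) :=
      Submodule.liftQ _ ((LinearMap.pi fun l : {l : Fin 16 // deg l = n} =>
        (dual (χ 1) r l).comp (formCoord χ hr hχ)).comp (cocycles (χ 1) r n).subtype)
        fun ω hω => LinearMap.mem_ker.2 (funext fun l =>
          dual_formCoord_coboundaries χ hr hχ l hω)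
    refine LinearIndependent.of_comp φ ?_
    convert (Pi.basisFun ℂ {l : Fin 16 // deg l = n}).linearIndependent using 1
    funext l m
    change dual (χ 1) r m (formCoord χ hr hχ (formRec (χ 1) r (rep (χ 1) r l))) = _
    rw [formCoord_formRec, dual_rep χ hr, Pi.basisFun_apply, Pi.single_apply]
    simp only [Subtype.ext_iff]
  · obtain ⟨ω, rfl⟩ := Submodule.Quotient.mk_surjective _ x
    have hx : (Submodule.Quotient.mk ω : DeRham (χ 1) r n) =
        ∑ l : {l : Fin 16 // deg l = n}, dual (χ 1) r l (formCoord χ hr hχ ω) •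
          Submodule.Quotient.mk ⟨_, formRec_rep_mem χ hr hχ l⟩ := by
      have h : Submodule.mkQ ((coboundaries (χ 1) r n).submoduleOf (cocycles (χ 1) r n)) ω =
          Submodule.mkQ _ (∑ l : {l : Fin 16 // deg l = n},
          dual (χ 1) r l (formCoord χ hr hχ ω) •
            (⟨_, formRec_rep_mem χ hr hχ l⟩ : cocycles (χ 1) r n)) :=
        (Submodule.Quotient.eq _).2 (Submodule.mem_comap.2 (by
          simpa using sub_sum_dual_mem χ hr hχ ω.2))
      refine h.trans ?_
      simp only [map_sum, map_smul]
      rfl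
    rw [hx]
    exact Submodule.sum_mem _ fun l _ => Submodule.smul_mem _ _ (Submodule.subset_span ⟨l, rfl⟩)
end

theorem RepresentBasis.finite {q : ℂ} {r n : ℕ} {ι : Type} [Fintype ι] {v : ι → Omega q r}
    (h : RepresentBasis q r n v) : Module.Finite ℂ (DeRham q r n) := by
  obtain ⟨hv, h1, h2⟩ := h
  exact Module.Finite.of_basis (Module.Basis.mk h1 h2.ge)

theorem RepresentBasis.finrank_eq {q : ℂ} {r n : ℕ} {ι : Type} [Fintype ι] {v : ι → Omega q r}
    (h : RepresentBasis q r n v) : Module.finrank ℂ (DeRham q r n) = Fintype.card ι := by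
  obtain ⟨hv, h1, h2⟩ := h
  exact Module.finrank_eq_card_basis (Module.Basis.mk h1 h2.ge)

theorem RepresentBasis.reindex {q : ℂ} {r n : ℕ} {ι κ : Type} {v : ι → Omega q r}
    {w : κ → Omega q r} (h : RepresentBasis q r n v) (e : κ ≃ ι) (hw : ∀ i, w i = v (e i)) :
    RepresentBasis q r n w := by
  obtain rfl : w = v ∘ e := funext hw
  obtain ⟨hv, h1, h2⟩ := h
  refine ⟨fun i => hv (e i), h1.comp e e.injective, ?_⟩
  rw [← h2]
  congr 1
  exact EquivLike.range_comp (fun i => (Submodule.Quotient.mk ⟨v i, hv i⟩ : DeRham q r n)) e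

section
variable {r : ℕ}

theorem val_neg_one_eq [NeZero r] : (-1 : ZMod r).val = r - 1 := by
  have h : (((r - 1 : ℕ)) : ZMod r) = -1 := by
    rw [Nat.cast_sub NeZero.one_le, ZMod.natCast_self, Nat.cast_one, zero_sub]
  rw [← h, ZMod.val_cast_of_lt (Nat.sub_lt (NeZero.pos r) Nat.one_pos)]

theorem val_neg_two_eq (hr : 3 ≤ r) : (-1 - 1 : ZMod r).val = r - 2 := by
  have : NeZero r := ⟨by omega⟩
  have h : (((r - 2 : ℕ)) : ZMod r) = -1 - 1 := by
    rw [Nat.cast_sub (by omega), ZMod.natCast_self, Nat.cast_ofNat]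
    ring
  rw [← h, ZMod.val_cast_of_lt (by omega)]

theorem invRec_E (q : ℂ) (l : Fin 16) : invRec q (E l) = invBasis q l := by
  simp [invRec_apply, E, Pi.single_apply]

theorem repH_eq [NeZero r] [Fact (1 < r)] (q : ℂ) (hr : 3 ≤ r) :
    (∀ i : Fin 6, repH2 q r i = formRec q r (rep q r (![5, 6, 7, 8, 9, 10] i))) ∧
    (∀ i : Fin 4, repH3 q r i = formRec q r (rep q r (![11, 12, 13, 14] i))) ∧
    ∀ i : Fin 1, repH4 q r i = formRec q r (rep q r (![15] i)) := by
  have h1 : (1 : ZMod r).val = 1 := ZMod.val_one r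
  refine ⟨fun i => ?_, fun i => ?_, fun i => ?_⟩ <;> fin_cases i <;>
    simp [repH2, repH3, repH4, rep, formRec_single, invRec_E, invBasis, mono, ofInv_invE,
      ofCoord_coord, val_neg_one_eq, val_neg_two_eq hr, h1, mul_assoc, sub_mul]
end

end QSL2

end

theorem proposition3p4 (r : ℕ) (hr : r = 3 ∨ r = 5 ∨ r = 7) (q : ℂ)
    (hq : IsPrimitiveRoot q r) :
    (∀ n : ℕ, Module.Finite ℂ (QSL2.DeRham q r n) ∧
      Module.finrank ℂ (QSL2.DeRham q r n) = Module.finrank ℂ (QSL2.invFormsDeg q n)) ∧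
    (Module.finrank ℂ (QSL2.invFormsDeg q 0) = 1 ∧
      Module.finrank ℂ (QSL2.invFormsDeg q 1) = 4 ∧
      Module.finrank ℂ (QSL2.invFormsDeg q 2) = 6 ∧
      Module.finrank ℂ (QSL2.invFormsDeg q 3) = 4 ∧
      Module.finrank ℂ (QSL2.invFormsDeg q 4) = 1 ∧
      ∀ n : ℕ, 4 < n → Module.finrank ℂ (QSL2.invFormsDeg q n) = 0) ∧
    QSL2.RepresentBasis q r 2 (QSL2.repH2 q r) ∧
    QSL2.RepresentBasis q r 3 (QSL2.repH3 q r) ∧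
    QSL2.RepresentBasis q r 4 (QSL2.repH4 q r) := by
  have h3 : 3 ≤ r := by omega
  have hodd : Nat.Coprime 2 r := by rcases hr with rfl | rfl | rfl <;> decide
  have : NeZero r := ⟨by omega⟩
  have : Fact (1 < r) := ⟨by omega⟩
  obtain ⟨χ, rfl⟩ : ∃ χ : AddChar (ZMod r) ℂ, χ 1 = q := by
    refine ⟨AddChar.zmodChar r hq.pow_eq_one, ?_⟩
    rw [AddChar.zmodChar_apply, ZMod.val_one, pow_one]
  have hχ : IsPrimitiveRoot (χ 1 ^ 2) r := hq.pow_of_coprime 2 hodd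
  have h0 := QSL2.chi_ne_zero χ 1
  have hB := QSL2.representBasis_rep χ h3 hχ
  obtain ⟨e2, e3, e4⟩ := QSL2.repH_eq (χ 1) h3
  refine ⟨fun n => ⟨(hB n).finite, by rw [(hB n).finrank_eq, QSL2.finrank_invFormsDeg h0]⟩,
    ⟨?_, ?_, ?_, ?_, ?_, fun n hn => ?_⟩, ?_, ?_, ?_⟩
  · rw [QSL2.finrank_invFormsDeg h0]; decide
  · rw [QSL2.finrank_invFormsDeg h0]; decide
  · rw [QSL2.finrank_invFormsDeg h0]; decide
  · rw [QSL2.finrank_invFormsDeg h0]; decide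
  · rw [QSL2.finrank_invFormsDeg h0]; decide
  · rw [QSL2.finrank_invFormsDeg h0, Fintype.card_eq_zero_iff]
    have hle : ∀ l, QSL2.deg l ≤ 4 := by decide
    exact ⟨fun l => absurd (hle l) (by rw [l.2]; omega)⟩
  · exact (hB 2).reindex (Equiv.ofBijective (fun i : Fin 6 =>
      ⟨![5, 6, 7, 8, 9, 10] i, by fin_cases i <;> rfl⟩) (by decide)) e2
  · exact (hB 3).reindex (Equiv.ofBijective (fun i : Fin 4 =>
      ⟨![11, 12, 13, 14] i, by fin_cases i <;> rfl⟩) (by decide)) e3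
  · exact (hB 4).reindex (Equiv.ofBijective (fun i : Fin 1 =>
      ⟨![15] i, by fin_cases i; rfl⟩) (by decide)) e4
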